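/- Let $n\ge 1$ and let $p_0,\dots,p_n$ be $n+1$ points of the plane in convex position, i.e. no $p_i$ lies in the convex hull of the other points. A non-crossing spanning tree of these points is a tree with vertex set $\{p_0,\dots,p_n\}$ such that, when its edges are drawn as straight segments, any two distinct edges meet at most in a common endpoint. The flip chain is the Markov chain on the set $\Omega$ of all non-crossing spanning trees of these points in which one step from $S\in\Omega$ removes an edge $e$ of $S$ chosen uniformly at random and then adds to $S\setminus e$ an edge $f$ chosen uniformly at random among all edges (including $e$) for which $(S\setminus e)\cup f$ is again a non-crossing spanning tree. Let $P$ be its transition matrix. Then the uniform distribution $\pi$ on $\Omega$ is stationary for $P$, and the mixing time $$t_{\mathrm{mix}}(P)=\min\Bigl\{t\ge 0:\ \max_{S\in\Omega}\ \tfrac12\sum_{T\in\Omega}\bigl|P^t(S,T)-\pi(T)\bigr|\le \tfrac14\Bigr\}$$ is finite and satisfies $t_{\mathrm{mix}}(P)=O(n^8\log n)$; that is, there is an absolute constant $C>0$, independent of $n$ and of the points, such that $t_{\mathrm{mix}}(P)\le C\,n^8\log n$ for all $n\ge1$ and all such points. -/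

import Mathlib

/-- The Euclidean plane. -/
abbrev Plane : Type := EuclideanSpace ℝ (Fin 2)

/-- `G` is a non-crossing spanning tree of the points `p 0, …, p n`: it is a tree on all the points
and, with edges drawn as straight segments, two distinct edges meet at most in a common endpoint. -/
def IsNCST {n : ℕ} (p : Fin (n + 1) → Plane) (G : SimpleGraph (Fin (n + 1))) : Prop :=
  G.IsTree ∧
    ∀ a b c d : Fin (n + 1), G.Adj a b → G.Adj c d → s(a, b) ≠ s(c, d) →
      segment ℝ (p a) (p b) ∩ segment ℝ (p c) (p d) ⊆ ({p a, p b} ∩ {p c, p d} : Set Plane)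

/-- The state space of the flip chain. -/
abbrev NCST {n : ℕ} (p : Fin (n + 1) → Plane) : Type :=
  {G : SimpleGraph (Fin (n + 1)) // IsNCST p G}

noncomputable instance NCST.fintype {n : ℕ} (p : Fin (n + 1) → Plane) : Fintype (NCST p) :=
  Fintype.ofFinite _

noncomputable instance NCST.decidableEq {n : ℕ} (p : Fin (n + 1) → Plane) :
    DecidableEq (NCST p) :=
  Classical.decEq _

open Classical in
/-- The finite set of edges of `G`. -/
noncomputable def edges {n : ℕ} (G : SimpleGraph (Fin (n + 1))) : Finset (Sym2 (Fin (n + 1))) :=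
  Finset.univ.filter (fun e => e ∈ G.edgeSet)

/-- The graph `G` without the edge `e`. -/
def dropEdge {n : ℕ} (G : SimpleGraph (Fin (n + 1))) (e : Sym2 (Fin (n + 1))) :
    SimpleGraph (Fin (n + 1)) :=
  G.deleteEdges {e}

/-- The graph `G` with the edge `f` added. -/
def addEdge {n : ℕ} (G : SimpleGraph (Fin (n + 1))) (f : Sym2 (Fin (n + 1))) :
    SimpleGraph (Fin (n + 1)) :=
  G ⊔ SimpleGraph.fromEdgeSet {f}

open Classical in
/-- The edges that can be added to `F` to make it a non-crossing spanning tree. -/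
noncomputable def validEdges {n : ℕ} (p : Fin (n + 1) → Plane) (F : SimpleGraph (Fin (n + 1))) :
    Finset (Sym2 (Fin (n + 1))) :=
  Finset.univ.filter (fun f => IsNCST p (addEdge F f))

open Classical in
/-- The transition matrix of the flip chain: drop an edge `e` of `S` chosen uniformly at random, then
add an edge `f` chosen uniformly at random among all the valid ones (`e` itself is one of them). -/
noncomputable def flipChain {n : ℕ} (p : Fin (n + 1) → Plane) : Matrix (NCST p) (NCST p) ℝ :=
  fun S T =>
    ∑ e ∈ edges S.1, ((edges S.1).card : ℝ)⁻¹ *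
      ∑ f ∈ validEdges p (dropEdge S.1 e), ((validEdges p (dropEdge S.1 e)).card : ℝ)⁻¹ *
        (if addEdge (dropEdge S.1 e) f = T.1 then 1 else 0)

/-- The uniform distribution on a finite set. -/
noncomputable def uniformDist (Ω : Type) [Fintype Ω] : Ω → ℝ :=
  fun _ => (Fintype.card Ω : ℝ)⁻¹

/-- Total variation distance. -/
noncomputable def tvDist {Ω : Type} [Fintype Ω] (μ ν : Ω → ℝ) : ℝ :=
  (1 / 2) * ∑ x, |μ x - ν x|

/-- `d(t)`, the largest total variation distance to `π` after `t` steps over all starting states. -/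
noncomputable def mixingDist {Ω : Type} [Fintype Ω] [DecidableEq Ω] (P : Matrix Ω Ω ℝ) (π : Ω → ℝ)
    (t : ℕ) : ℝ :=
  ⨆ x : Ω, tvDist ((P ^ t) x) π

/-- `P` is a transition matrix on `Ω` and `π` is a stationary distribution of it. -/
def IsStationaryFor {Ω : Type} [Fintype Ω] [DecidableEq Ω] (P : Matrix Ω Ω ℝ) (π : Ω → ℝ) : Prop :=
  P ∈ Matrix.rowStochastic ℝ Ω ∧ π ∈ stdSimplex ℝ Ω ∧ Matrix.vecMul π P = π

/-- `τ` is the mixing time of `P` with stationary distribution `π`: the least `t` such that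
`d(t) ≤ 1/4`. -/
def IsMixingTime {Ω : Type} [Fintype Ω] [DecidableEq Ω] (P : Matrix Ω Ω ℝ) (π : Ω → ℝ)
    (τ : ℕ) : Prop :=
  IsLeast {t : ℕ | mixingDist P π t ≤ 1 / 4} τ

/-! The flip chain is a heat-bath chain. Each forest left by removing an edge defines the block of
its completions, and a step picks one of the `n` blocks containing the current tree and resamples
uniformly in it. Hence the matrix is symmetric and positive semidefinite (`flipChain_eq`,
`sum_sq_blockChain_le`), and a Poincaré inequality alone bounds the mixing time
(`mixingDist_le_of_gap`). The gap obtained is of order `n⁻⁷`, and there are at most `27 ^ n` trees,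
so the chain mixes within `O(n⁸)` steps. The logarithm is only needed as a lower bound for `n ≥ 2`;
for `n = 1` there is a single state.

The Poincaré inequality comes from a comparison with adjacent transpositions on lattice paths with
`n` steps `+2` and `2n` steps `-1`. That chain is monotone, and the sum of the height differences
with weights `k (3n - k)` contracts under it, because these weights have constant second difference
`-2`. Contraction of Lipschitz constants passes to the `L²` norm by log-convexity of the norms of
iterates, which gives `LatticePath.poincare`.

Non-crossing trees on `0, …, n` correspond to ternary trees with `n` nodes: split at the longest
edge of the first vertex (`IsNCTree.exists_tree`). Written as words in `O`, `B`, `C`, ternary trees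
correspond to the lattice paths above by forgetting the difference between `B` and `C`. Convex
position makes the points an ordered cycle in which two chords cross exactly when their ends
interleave, so the geometry disappears (`exists_labelling`).

For the comparison, a transposition is simulated by moving a letter `B` past a whole code, three
flips per node, and by at most two further flips that move a letter `C` past a code. The
intermediate words carry a mark at a letter `C`, that is, at an edge. The elementary moves on marked
words are injective (`Marked.Step.source_unique`), so at each time a marked tree is used by at most
one simulation. Congestion thus stays quadratic in `n` (`LatticePath.sum_sq_swap_le`), although
there are exponentially many trees. -/

/-! ### Lattice paths and resampling of one position -/

/-- `u k` counts the up-steps among the first `k` letters of a lattice word with `n` up-steps of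
height `2` and `2 * n` down-steps of height `-1` which stays non-negative. -/
def IsLatticePath (n : ℕ) (u : ℕ → ℤ) : Prop :=
  u 0 = 0 ∧ (∀ k, u k ≤ u (k + 1) ∧ u (k + 1) ≤ u k + 1) ∧ (∀ k, 3 * n ≤ k → u k = n) ∧
    ∀ k, k ≤ 3 * n → (k : ℤ) ≤ 3 * u k

abbrev LatticePath (n : ℕ) : Type := {u : ℕ → ℤ // IsLatticePath n u}

namespace LatticePath

variable {n : ℕ}

lemma monotone (x : LatticePath n) : Monotone x.1 :=
  monotone_nat_of_le_succ fun k => (x.2.2.1 k).1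

lemma nonneg (x : LatticePath n) (k : ℕ) : 0 ≤ x.1 k := by
  have := x.monotone (Nat.zero_le k)
  rwa [x.2.1] at this

lemma le_card (x : LatticePath n) (k : ℕ) : x.1 k ≤ n := by
  have h := x.monotone (Nat.le_add_left k (3 * n))
  rwa [x.2.2.2.1 _ (Nat.le_add_right _ _)] at h

instance : Finite (LatticePath n) := by
  refine Finite.of_injective (β := Fin (3 * n + 1) → Set.Icc (0 : ℤ) n)
    (fun x i => ⟨x.1 i, x.nonneg i, x.le_card i⟩) ?_
  intro x y h
  apply Subtype.ext
  funext k
  by_cases hk : k < 3 * n + 1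
  · exact congrArg Subtype.val (congrFun h ⟨k, hk⟩)
  · rw [x.2.2.2.1 k (by omega), y.2.2.2.1 k (by omega)]

noncomputable instance : Fintype (LatticePath n) := Fintype.ofFinite _

/-- The largest admissible value at position `j + 1`, given the values at `j` and `j + 2`. -/
def hi (u : ℕ → ℤ) (j : ℕ) : ℤ := min (u j + 1) (u (j + 2))

/-- The smallest admissible value at position `j + 1`, given the values at `j` and `j + 2`. -/
def lo (u : ℕ → ℤ) (j : ℕ) : ℤ := max (max (u j) (u (j + 2) - 1)) (((j : ℤ) + 3) / 3)

/-- The term `(j + 3) / 3` in `lo` is the ceiling of `(j + 1) / 3`, the least value that the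
positivity constraint allows at position `j + 1`. -/
lemma isLatticePath_update {u : ℕ → ℤ} (hu : IsLatticePath n u) {j : ℕ} (hj : j + 1 < 3 * n) {a : ℤ}
    (h1 : lo u j ≤ a) (h2 : a ≤ hi u j) : IsLatticePath n (Function.update u (j + 1) a) := by
  obtain ⟨h0, hs, he, hc⟩ := hu
  simp only [lo, hi, max_le_iff, le_min_iff] at h1 h2
  refine ⟨?_, ?_, ?_, ?_⟩
  · rw [Function.update_of_ne (by omega), h0]
  · intro k
    have := hs k
    by_cases h3 : k = j + 1
    · subst h3
      rw [Function.update_self, Function.update_of_ne (by omega)]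
      have : j + 1 + 1 = j + 2 := rfl
      rw [this]
      omega
    · by_cases h4 : k = j
      · subst h4
        rw [Function.update_self, Function.update_of_ne (by omega)]
        omega
      · rw [Function.update_of_ne h3, Function.update_of_ne (by omega)]
        exact this
  · intro k hk
    rw [Function.update_of_ne (by omega)]
    exact he k hk
  · intro k hk
    by_cases h3 : k = j + 1
    · subst h3
      rw [Function.update_self]
      push_cast
      omega
    · rw [Function.update_of_ne h3]
      exact hc k hk

lemma lo_le (x : LatticePath n) {j : ℕ} (hj : j + 1 < 3 * n) : lo x.1 j ≤ x.1 (j + 1) := by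
  have h1 := x.2.2.1 j
  have h2 := x.2.2.1 (j + 1)
  have h3 := x.2.2.2.2 (j + 1) hj.le
  have e : j + 1 + 1 = j + 2 := rfl
  rw [e] at h2
  simp only [lo, max_le_iff]
  push_cast at h3
  omega

lemma le_hi (x : LatticePath n) (j : ℕ) : x.1 (j + 1) ≤ hi x.1 j := by
  have h1 := x.2.2.1 j
  have h2 := x.2.2.1 (j + 1)
  have e : j + 1 + 1 = j + 2 := rfl
  rw [e] at h2
  simp only [hi, le_min_iff]
  omega

/-- At most two values are admissible at a position, so a fair choice between `up` and `down` is a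
fair choice between the path and its swap. -/
lemma hi_le_lo_add_one (u : ℕ → ℤ) (j : ℕ) : hi u j ≤ lo u j + 1 := by
  simp only [hi, lo]
  omega

/-- The path with the value at `j + 1` replaced by the largest admissible one. -/
def up (j : ℕ) (x : LatticePath n) : LatticePath n :=
  if hj : j + 1 < 3 * n then
    ⟨Function.update x.1 (j + 1) (hi x.1 j),
      isLatticePath_update x.2 hj ((x.lo_le hj).trans (x.le_hi j)) le_rfl⟩
  else x

/-- The path with the value at `j + 1` replaced by the smallest admissible one. -/
def down (j : ℕ) (x : LatticePath n) : LatticePath n :=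
  if hj : j + 1 < 3 * n then
    ⟨Function.update x.1 (j + 1) (lo x.1 j),
      isLatticePath_update x.2 hj le_rfl ((x.lo_le hj).trans (x.le_hi j))⟩
  else x

/-- The path with the letters `j` and `j + 1` exchanged, if that is admissible. -/
def swap (j : ℕ) (x : LatticePath n) : LatticePath n :=
  if hj : j + 1 < 3 * n then
    ⟨Function.update x.1 (j + 1) (lo x.1 j + hi x.1 j - x.1 (j + 1)),
      isLatticePath_update x.2 hj (by linarith [x.le_hi j]) (by linarith [x.lo_le hj])⟩
  else x

lemma up_coe {j : ℕ} (hj : j + 1 < 3 * n) (x : LatticePath n) :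
    (x.up j).1 = Function.update x.1 (j + 1) (hi x.1 j) := by
  simp [up, hj]

lemma down_coe {j : ℕ} (hj : j + 1 < 3 * n) (x : LatticePath n) :
    (x.down j).1 = Function.update x.1 (j + 1) (lo x.1 j) := by
  simp [down, hj]

lemma swap_coe {j : ℕ} (hj : j + 1 < 3 * n) (x : LatticePath n) :
    (x.swap j).1 = Function.update x.1 (j + 1) (lo x.1 j + hi x.1 j - x.1 (j + 1)) := by
  simp [swap, hj]

lemma lo_update (u : ℕ → ℤ) (j : ℕ) (a : ℤ) : lo (Function.update u (j + 1) a) j = lo u j := by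
  simp [lo, Function.update_of_ne]

lemma hi_update (u : ℕ → ℤ) (j : ℕ) (a : ℤ) : hi (Function.update u (j + 1) a) j = hi u j := by
  simp [hi, Function.update_of_ne]

lemma swap_involutive (j : ℕ) : Function.Involutive (swap (n := n) j) := by
  intro x
  by_cases hj : j + 1 < 3 * n
  · apply Subtype.ext
    rw [swap_coe hj, swap_coe hj, lo_update, hi_update, Function.update_self, Function.update_idem]
    simp
  · simp [swap, hj]

/-- The two resampled paths are the path itself and its swap. -/
lemma up_down_eq (j : ℕ) (x : LatticePath n) :
    (x.up j = x ∧ x.down j = x.swap j) ∨ (x.down j = x ∧ x.up j = x.swap j) := by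
  by_cases hj : j + 1 < 3 * n
  · have h1 := x.lo_le hj
    have h2 := x.le_hi j
    have h3 := hi_le_lo_add_one x.1 j
    rcases h1.eq_or_lt with h | h
    · right
      constructor <;> apply Subtype.ext
      · rw [down_coe hj, h, Function.update_eq_self]
      · rw [up_coe hj, swap_coe hj, h]
        congr 1
        ring
    · have h4 : hi x.1 j = x.1 (j + 1) := by omega
      left
      constructor <;> apply Subtype.ext
      · rw [up_coe hj, h4, Function.update_eq_self]
      · rw [down_coe hj, swap_coe hj, h4]
        congr 1
        ring
  · left
    simp [up, down, swap, hj]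

lemma hi_mono {u v : ℕ → ℤ} (h : u ≤ v) (j : ℕ) : hi u j ≤ hi v j := by
  have h1 : u j ≤ v j := h j
  have h2 : u (j + 2) ≤ v (j + 2) := h (j + 2)
  simp only [hi]
  omega

lemma lo_mono {u v : ℕ → ℤ} (h : u ≤ v) (j : ℕ) : lo u j ≤ lo v j := by
  have h1 : u j ≤ v j := h j
  have h2 : u (j + 2) ≤ v (j + 2) := h (j + 2)
  simp only [lo]
  omega

lemma up_mono (j : ℕ) {x y : LatticePath n} (h : x ≤ y) : x.up j ≤ y.up j := by
  by_cases hj : j + 1 < 3 * n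
  · rw [← Subtype.coe_le_coe, up_coe hj, up_coe hj]
    exact update_le_update_iff.2 ⟨hi_mono h j, fun k _ => h k⟩
  · simpa [up, hj] using h

lemma down_mono (j : ℕ) {x y : LatticePath n} (h : x ≤ y) : x.down j ≤ y.down j := by
  by_cases hj : j + 1 < 3 * n
  · rw [← Subtype.coe_le_coe, down_coe hj, down_coe hj]
    exact update_le_update_iff.2 ⟨lo_mono h j, fun k _ => h k⟩
  · simpa [down, hj] using h

/-- Resampling averages the differences of the neighbouring values, up to the boundary effect of the
lower constraint, which only helps. -/
lemma resample_sub_le {u v : ℕ → ℤ} (h : u ≤ v) (j : ℕ) :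
    (hi v j - hi u j) + (lo v j - lo u j) ≤ (v j - u j) + (v (j + 2) - u (j + 2)) := by
  have h1 : u j ≤ v j := h j
  have h2 : u (j + 2) ≤ v (j + 2) := h (j + 2)
  simp only [lo, hi]
  omega

/-- The weight of position `k`. -/
def weight (n k : ℕ) : ℝ := (k : ℝ) * ((3 * n : ℕ) - k : ℝ)

lemma weight_nonneg {k : ℕ} (hk : k ≤ 3 * n) : 0 ≤ weight n k := by
  have : (k : ℝ) ≤ (3 * n : ℕ) := by exact_mod_cast hk
  unfold weight
  have h0 : (0 : ℝ) ≤ k := Nat.cast_nonneg k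
  nlinarith

/-- The weighted distance of two comparable paths. -/
def wdist (x y : LatticePath n) : ℝ :=
  ∑ k ∈ Finset.range (3 * n - 1), weight n (k + 1) * ((y.1 (k + 1) - x.1 (k + 1) : ℤ) : ℝ)

lemma wdist_update (x y x' y' : LatticePath n) {j : ℕ} (hj : j + 1 < 3 * n) {a b : ℤ}
    (hx : x'.1 = Function.update x.1 (j + 1) a) (hy : y'.1 = Function.update y.1 (j + 1) b) :
    wdist x' y' = wdist x y +
      weight n (j + 1) * (((b - a) - (y.1 (j + 1) - x.1 (j + 1)) : ℤ) : ℝ) := by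
  have hjm : j ∈ Finset.range (3 * n - 1) := Finset.mem_range.2 (by omega)
  unfold wdist
  rw [← Finset.add_sum_erase _ _ hjm, ← Finset.add_sum_erase (a := j) _ _ hjm]
  have : ∀ k ∈ (Finset.range (3 * n - 1)).erase j,
      weight n (k + 1) * ((y'.1 (k + 1) - x'.1 (k + 1) : ℤ) : ℝ) =
        weight n (k + 1) * ((y.1 (k + 1) - x.1 (k + 1) : ℤ) : ℝ) := by
    intro k hk
    have : k + 1 ≠ j + 1 := by
      have := Finset.ne_of_mem_erase hk
      omega
    rw [hx, hy, Function.update_of_ne this, Function.update_of_ne this]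
  rw [Finset.sum_congr rfl this, hx, hy, Function.update_self, Function.update_self]
  push_cast
  ring

end LatticePath

/-! ### Contraction of the weighted distance -/

namespace LatticePath

variable {n : ℕ}

/-- Summation by parts: the weight `k (3n - k)` has second difference `-2`, and the boundary terms
vanish because both the weight and `D` vanish at the two ends. -/
lemma sum_weight_laplacian (D : ℕ → ℝ) (h0 : D 0 = 0) (hn : 1 ≤ n) (hN : D (3 * n) = 0) :
    ∑ j ∈ Finset.range (3 * n - 1), weight n (j + 1) * (D j + D (j + 2) - 2 * D (j + 1)) =
      -(2 * ∑ j ∈ Finset.range (3 * n - 1), D (j + 1)) := by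
  have key : ∀ j, weight n (j + 1) * (D j + D (j + 2) - 2 * D (j + 1)) =
      -(2 * D (j + 1)) - ((weight n (j + 1 + 1) * D (j + 1) - weight n (j + 1) * D (j + 1 + 1)) -
        (weight n (j + 1) * D j - weight n j * D (j + 1))) := by
    intro j
    simp only [weight]
    push_cast
    ring
  rw [Finset.sum_congr rfl fun j _ => key j, Finset.sum_sub_distrib,
    Finset.sum_range_sub (fun j => weight n (j + 1) * D j - weight n j * D (j + 1)),
    Finset.mul_sum, Finset.sum_neg_distrib]
  have e : 3 * n - 1 + 1 = 3 * n := by omega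
  rw [e, hN, h0]
  simp [weight]

lemma weight_le (k : ℕ) : weight n k ≤ ((3 * n : ℕ) : ℝ) ^ 2 / 4 := by
  unfold weight
  nlinarith [sq_nonneg ((k : ℝ) - ((3 * n : ℕ) : ℝ) / 2)]

lemma wdist_nonneg {x y : LatticePath n} (h : x ≤ y) : 0 ≤ wdist x y := by
  refine Finset.sum_nonneg fun k hk => mul_nonneg (weight_nonneg ?_) ?_
  · have := Finset.mem_range.1 hk
    omega
  · exact_mod_cast sub_nonneg.2 (h (k + 1))

/-- The contraction factor lost in one resampling step at a uniformly random position. -/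
noncomputable def rate (n : ℕ) : ℝ := 4 / (((3 * n : ℕ) : ℝ) ^ 2 * ((3 * n - 1 : ℕ) : ℝ))

/-- Both paths use the same position and the same direction, so they stay ordered. By
`resample_sub_le` their difference evolves at most like discrete heat flow, and the weighted sum of
the differences loses `2 ∑ D`. Since every weight is at most `(3n)² / 4`, this loss is a fixed
proportion of `wdist`. -/
lemma sum_wdist_le (hn : 1 ≤ n) {x y : LatticePath n} (h : x ≤ y) :
    ∑ j ∈ Finset.range (3 * n - 1), (wdist (x.up j) (y.up j) + wdist (x.down j) (y.down j)) ≤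
      2 * ((3 * n - 1 : ℕ) : ℝ) * ((1 - rate n) * wdist x y) := by
  set D : ℕ → ℝ := fun k => ((y.1 k - x.1 k : ℤ) : ℝ) with hD
  have hDnn : ∀ k, 0 ≤ D k := fun k => by
    simp only [hD]
    exact_mod_cast sub_nonneg.2 (h k)
  have hpos : (0 : ℝ) < ((3 * n : ℕ) : ℝ) := by exact_mod_cast (by omega : 0 < 3 * n)
  have hpos' : (0 : ℝ) < ((3 * n - 1 : ℕ) : ℝ) := by exact_mod_cast (by omega : 0 < 3 * n - 1)
  have step : ∀ j ∈ Finset.range (3 * n - 1),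
      wdist (x.up j) (y.up j) + wdist (x.down j) (y.down j) ≤
        2 * wdist x y + weight n (j + 1) * (D j + D (j + 2) - 2 * D (j + 1)) := by
    intro j hj
    have hj' : j + 1 < 3 * n := by
      have := Finset.mem_range.1 hj
      omega
    rw [wdist_update x y _ _ hj' (up_coe hj' x) (up_coe hj' y),
      wdist_update x y _ _ hj' (down_coe hj' x) (down_coe hj' y)]
    have h1 := resample_sub_le (u := x.1) (v := y.1) h j
    have h2 : ((hi y.1 j - hi x.1 j : ℤ) : ℝ) + ((lo y.1 j - lo x.1 j : ℤ) : ℝ) ≤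
        D j + D (j + 2) := by
      simp only [hD]
      exact_mod_cast h1
    have h3 := weight_nonneg (n := n) hj'.le
    have h4 := mul_le_mul_of_nonneg_left h2 h3
    simp only [hD] at h4 ⊢
    push_cast at h4 ⊢
    nlinarith [h4]
  refine (Finset.sum_le_sum step).trans ?_
  rw [Finset.sum_add_distrib, sum_weight_laplacian D (by simp [hD, x.2.1, y.2.1]) hn
    (by simp [hD, x.2.2.2.1 _ le_rfl, y.2.2.2.1 _ le_rfl])]
  have h5 : wdist x y ≤ ((3 * n : ℕ) : ℝ) ^ 2 / 4 * ∑ j ∈ Finset.range (3 * n - 1), D (j + 1) := by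
    rw [Finset.mul_sum]
    exact Finset.sum_le_sum fun k _ => mul_le_mul_of_nonneg_right (weight_le _) (hDnn _)
  have h6 : ((3 * n - 1 : ℕ) : ℝ) * (rate n * wdist x y) ≤
      ∑ j ∈ Finset.range (3 * n - 1), D (j + 1) := by
    have : ((3 * n - 1 : ℕ) : ℝ) * (rate n * wdist x y) =
        4 / ((3 * n : ℕ) : ℝ) ^ 2 * wdist x y := by
      unfold rate
      field_simp
    rw [this]
    calc _ ≤ 4 / ((3 * n : ℕ) : ℝ) ^ 2 *
          (((3 * n : ℕ) : ℝ) ^ 2 / 4 * ∑ j ∈ Finset.range (3 * n - 1), D (j + 1)) :=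
          mul_le_mul_of_nonneg_left h5 (by positivity)
      _ = _ := by field_simp
  simp only [Finset.sum_const, Finset.card_range, nsmul_eq_mul]
  nlinarith

/-- Resampling at a uniformly random position. -/
noncomputable def avg (f : LatticePath n → ℝ) (x : LatticePath n) : ℝ :=
  (∑ j ∈ Finset.range (3 * n - 1), (f (x.up j) + f (x.down j))) / (2 * ((3 * n - 1 : ℕ) : ℝ))

/-- `f` is `K`-Lipschitz on comparable pairs for the weighted distance. -/
def LipBound (f : LatticePath n → ℝ) (K : ℝ) : Prop :=
  ∀ x y : LatticePath n, x ≤ y → |f y - f x| ≤ K * wdist x y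

/-- The dual form of path coupling: contraction of the distance under the coupled moves contracts
Lipschitz constants of averaged functions. -/
lemma LipBound.avg (hn : 1 ≤ n) {f : LatticePath n → ℝ} {K : ℝ} (hK : 0 ≤ K) (hf : LipBound f K) :
    LipBound (avg f) (K * (1 - rate n)) := by
  intro x y h
  have hpos' : (0 : ℝ) < ((3 * n - 1 : ℕ) : ℝ) := by exact_mod_cast (by omega : 0 < 3 * n - 1)
  unfold LatticePath.avg
  rw [← sub_div, ← Finset.sum_sub_distrib, abs_div, abs_of_pos (a := 2 * _) (by positivity),
    div_le_iff₀ (by positivity)]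
  calc _ ≤ ∑ j ∈ Finset.range (3 * n - 1),
        |f (y.up j) + f (y.down j) - (f (x.up j) + f (x.down j))| := Finset.abs_sum_le_sum_abs _ _
    _ ≤ ∑ j ∈ Finset.range (3 * n - 1),
        K * (wdist (x.up j) (y.up j) + wdist (x.down j) (y.down j)) := by
        refine Finset.sum_le_sum fun j _ => ?_
        have h1 := hf _ _ (up_mono j h)
        have h2 := hf _ _ (down_mono j h)
        calc _ = |(f (y.up j) - f (x.up j)) + (f (y.down j) - f (x.down j))| := by congr 1; ring
          _ ≤ _ := abs_add_le _ _
          _ ≤ _ := by linarith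
    _ ≤ K * (2 * ((3 * n - 1 : ℕ) : ℝ) * ((1 - rate n) * wdist x y)) := by
        rw [← Finset.mul_sum]
        exact mul_le_mul_of_nonneg_left (sum_wdist_le hn h) hK
    _ = _ := by ring

/-- The order-preserving maps `up` and `down` serve the coupling; the involution `swap` serves
self-adjointness. Both describe the same averaging operator. -/
lemma avg_eq (f : LatticePath n → ℝ) (x : LatticePath n) :
    avg f x = (∑ j ∈ Finset.range (3 * n - 1), (f x + f (x.swap j))) /
      (2 * ((3 * n - 1 : ℕ) : ℝ)) := by
  unfold avg
  congr 1
  refine Finset.sum_congr rfl fun j _ => ?_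
  rcases up_down_eq j x with ⟨h1, h2⟩ | ⟨h1, h2⟩ <;> rw [h1, h2]
  ring

lemma sum_mul_swap (f g : LatticePath n → ℝ) (j : ℕ) :
    ∑ x, g x * f (x.swap j) = ∑ x, g (x.swap j) * f x := by
  rw [← Equiv.sum_comp (swap_involutive j).toPerm]
  refine Finset.sum_congr rfl fun x _ => ?_
  simp [swap_involutive j x]

lemma sum_mul_avg (f g : LatticePath n → ℝ) : ∑ x, g x * avg f x = ∑ x, avg g x * f x := by
  simp only [avg_eq, mul_div_assoc', div_mul_eq_mul_div, ← Finset.sum_div]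
  congr 1
  simp only [Finset.mul_sum, Finset.sum_mul]
  rw [Finset.sum_comm, Finset.sum_comm (s := Finset.univ)]
  refine Finset.sum_congr rfl fun j _ => ?_
  simp only [mul_add, add_mul, Finset.sum_add_distrib, sum_mul_swap f g j]

lemma sum_avg (hn : 1 ≤ n) (f : LatticePath n → ℝ) : ∑ x, avg f x = ∑ x, f x := by
  have h := sum_mul_avg f (fun _ => 1)
  have hpos' : ((3 * n - 1 : ℕ) : ℝ) ≠ 0 := by exact_mod_cast (by omega : 3 * n - 1 ≠ 0)
  have h1 : ∀ x, avg (n := n) (fun _ => 1) x = 1 := by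
    intro x
    simp only [avg, Finset.sum_const, Finset.card_range, nsmul_eq_mul]
    field_simp
    norm_num
  simpa [h1] using h

lemma energy_eq (hn : 1 ≤ n) (f : LatticePath n → ℝ) :
    ∑ x, f x * (f x - avg f x) =
      (∑ j ∈ Finset.range (3 * n - 1), ∑ x, (f x - f (x.swap j)) ^ 2) /
        (4 * ((3 * n - 1 : ℕ) : ℝ)) := by
  have hpos' : ((3 * n - 1 : ℕ) : ℝ) ≠ 0 := by exact_mod_cast (by omega : 3 * n - 1 ≠ 0)
  have h1 : ∀ x, f x * (f x - avg f x) =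
      (∑ j ∈ Finset.range (3 * n - 1), (f x * f x - f x * f (x.swap j))) /
        (2 * ((3 * n - 1 : ℕ) : ℝ)) := by
    intro x
    rw [avg_eq, Finset.sum_add_distrib, Finset.sum_sub_distrib, ← Finset.mul_sum (f := fun j => f (x.swap j))]
    simp only [Finset.sum_const, Finset.card_range, nsmul_eq_mul]
    field_simp
    ring
  have h2 : ∀ j, ∑ x, (f x - f (x.swap j)) ^ 2 =
      2 * ∑ x : LatticePath n, (f x * f x - f x * f (x.swap j)) := by
    intro j
    have h3 : ∑ x : LatticePath n, f (x.swap j) * f (x.swap j) = ∑ x, f x * f x :=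
      Equiv.sum_comp (swap_involutive j).toPerm (fun x => f x * f x)
    have h4 : ∀ x : LatticePath n, (f x - f (x.swap j)) ^ 2 =
        f x * f x - 2 * (f x * f (x.swap j)) + f (x.swap j) * f (x.swap j) := fun x => by ring
    simp only [h4, Finset.sum_add_distrib, Finset.sum_sub_distrib, h3, ← Finset.mul_sum]
    ring
  simp only [h1, h2, ← Finset.sum_div, ← Finset.mul_sum]
  rw [Finset.sum_comm]
  field_simp
  ring

/-- The highest path. -/
def top (n : ℕ) : LatticePath n :=
  ⟨fun k => min k n, by
    refine ⟨?_, ?_, ?_, ?_⟩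
    · simp
    · intro k; push_cast; omega
    · intro k hk; simp only; omega
    · intro k hk; simp only; omega⟩

lemma le_top (x : LatticePath n) : x ≤ top n := by
  intro k
  have h1 := x.le_card k
  have h2 : x.1 k ≤ k := by
    induction k with
    | zero => simp [x.2.1]
    | succ k ih =>
      have := (x.2.2.1 k).2
      have := ih (x.le_card k)
      push_cast
      omega
  exact le_min h2 h1

/-- An upper bound for the weighted distance. -/
noncomputable def wdiam (n : ℕ) : ℝ := ∑ x : LatticePath n, wdist x (top n)

lemma wdist_top_le (x : LatticePath n) : wdist x (top n) ≤ wdiam n :=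
  Finset.single_le_sum (f := fun x : LatticePath n => wdist x (top n))
    (fun y _ => wdist_nonneg y.le_top) (Finset.mem_univ x)

/-- Every path is comparable with `top n`, so a bound on comparable pairs controls the oscillation,
and mean zero turns it into a bound on values. -/
lemma LipBound.abs_le {f : LatticePath n → ℝ} {K : ℝ} (hK : 0 ≤ K) (hf : LipBound f K)
    (h0 : ∑ x, f x = 0) (x : LatticePath n) : |f x| ≤ 2 * K * wdiam n := by
  have h1 : ∀ y, |f (top n) - f y| ≤ K * wdiam n := fun y =>
    (hf y (top n) y.le_top).trans (mul_le_mul_of_nonneg_left (wdist_top_le y) hK)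
  have h2 : |f (top n)| ≤ K * wdiam n := by
    have hcard : (0 : ℝ) < Fintype.card (LatticePath n) := by
      have : Nonempty (LatticePath n) := ⟨top n⟩
      exact_mod_cast Fintype.card_pos
    have : (Fintype.card (LatticePath n) : ℝ) * f (top n) = ∑ y, (f (top n) - f y) := by
      simp [Finset.sum_sub_distrib, h0]
    have h3 : (Fintype.card (LatticePath n) : ℝ) * |f (top n)| ≤
        Fintype.card (LatticePath n) * (K * wdiam n) := by
      rw [← abs_of_pos hcard, ← abs_mul, this, abs_of_pos hcard]
      refine (Finset.abs_sum_le_sum_abs _ _).trans ?_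
      refine (Finset.sum_le_sum fun y _ => h1 y).trans ?_
      simp
    exact le_of_mul_le_mul_left h3 hcard
  have h3 := h1 x
  have h4 : |f x| ≤ |f (top n)| + |f (top n) - f x| := by
    have := abs_sub (f (top n)) (f (top n) - f x)
    simpa using this
  linarith

lemma one_le_wdist {x y : LatticePath n} (h : x ≤ y) (hne : x ≠ y) : 1 ≤ wdist x y := by
  obtain ⟨k, hk⟩ : ∃ k, x.1 k ≠ y.1 k := by
    by_contra! hc
    exact hne (Subtype.ext (funext hc))
  have hk0 : k ≠ 0 := by
    rintro rfl
    exact hk (by rw [x.2.1, y.2.1])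
  have hkN : k < 3 * n := by
    by_contra hc
    exact hk (by rw [x.2.2.2.1 k (by omega), y.2.2.2.1 k (by omega)])
  obtain ⟨j, rfl⟩ := Nat.exists_eq_succ_of_ne_zero hk0
  have h1 : ∀ k ∈ Finset.range (3 * n - 1),
      0 ≤ weight n (k + 1) * ((y.1 (k + 1) - x.1 (k + 1) : ℤ) : ℝ) := fun k hk =>
    mul_nonneg (weight_nonneg (by have := Finset.mem_range.1 hk; omega))
      (by exact_mod_cast sub_nonneg.2 (h (k + 1)))
  refine le_trans ?_ (Finset.single_le_sum h1 (Finset.mem_range.2 (by omega : j < 3 * n - 1)))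
  have h2 : (1 : ℝ) ≤ ((y.1 (j + 1) - x.1 (j + 1) : ℤ) : ℝ) := by
    have h3 : x.1 (j + 1) ≤ y.1 (j + 1) := h (j + 1)
    have h4 : x.1 (j + 1) ≠ y.1 (j + 1) := hk
    exact_mod_cast (by omega : 1 ≤ y.1 (j + 1) - x.1 (j + 1))
  have h5 : 1 ≤ weight n (j + 1) := by
    unfold weight
    have : ((j + 1 : ℕ) : ℝ) + 1 ≤ ((3 * n : ℕ) : ℝ) := by exact_mod_cast (by omega)
    have h6 : (1 : ℝ) ≤ ((j + 1 : ℕ) : ℝ) := by exact_mod_cast (by omega)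
    nlinarith
  nlinarith

/-- Distinct comparable paths have distance at least 1, so any function is Lipschitz with some
constant. Its size is irrelevant, since only the decay rate of iterates is used. -/
lemma exists_lipBound (f : LatticePath n → ℝ) : ∃ K, 0 ≤ K ∧ LipBound f K := by
  refine ⟨2 * ∑ x, |f x|, by positivity, fun x y h => ?_⟩
  have hs : ∀ z, |f z| ≤ ∑ x, |f x| := fun z =>
    Finset.single_le_sum (f := fun x => |f x|) (fun _ _ => abs_nonneg _) (Finset.mem_univ z)
  by_cases hne : x = y
  · subst hne
    simp [wdist]
  · have h1 := one_le_wdist h hne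
    have h2 := abs_sub (f y) (f x)
    have h3 : 0 ≤ ∑ x, |f x| := by positivity
    nlinarith [hs x, hs y]

end LatticePath

/-! ### From Lipschitz decay to a Poincaré inequality -/

/-- A log-convex sequence with a geometric upper bound decays at least at that rate from the start. -/
lemma le_mul_of_logConvex {b : ℕ → ℝ} (hb : ∀ s, 0 ≤ b s) (hlc : ∀ s, b (s + 1) ^ 2 ≤ b s * b (s + 2))
    {A q : ℝ} (hq : 0 ≤ q) (hle : ∀ s, b s ≤ A * q ^ s) : b 1 ≤ q * b 0 := by
  -- The ratios of consecutive terms are nondecreasing; this is stated without division because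
  -- terms may vanish.
  have h1 : ∀ s, b s * b 1 ≤ b (s + 1) * b 0 := by
    intro s
    induction s with
    | zero => simp [mul_comm]
    | succ s ih =>
      rcases (hb (s + 1)).eq_or_lt with h | h
      · rw [← h]
        simpa using mul_nonneg (hb (s + 2)) (hb 0)
      · refine le_of_mul_le_mul_left ?_ h
        calc b (s + 1) * (b (s + 1) * b 1) = b (s + 1) ^ 2 * b 1 := by ring
          _ ≤ b s * b (s + 2) * b 1 := mul_le_mul_of_nonneg_right (hlc s) (hb 1)
          _ = b s * b 1 * b (s + 2) := by ring
          _ ≤ b (s + 1) * b 0 * b (s + 2) := mul_le_mul_of_nonneg_right ih (hb _)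
          _ = b (s + 1) * (b (s + 1 + 1) * b 0) := by ring
  by_contra! hlt
  have hb1 : 0 < b 1 := (mul_nonneg hq (hb 0)).trans_lt hlt
  have hb0 : 0 < b 0 := by
    rcases (hb 0).eq_or_lt with h | h
    · have := hlc 0
      rw [← h] at this
      nlinarith
    · exact h
  -- If the first ratio `r` exceeded `q`, the growth `b 0 * r ^ s` would eventually outrun `A * q ^
  -- s`.
  set r := b 1 / b 0 with hr
  have hqr : q < r := by rwa [hr, lt_div_iff₀ hb0]
  have h2 : ∀ s, b 0 * r ^ s ≤ b s := by
    intro s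
    induction s with
    | zero => simp
    | succ s ih =>
      have : b s * r ≤ b (s + 1) := by
        rw [hr, mul_div_assoc', div_le_iff₀ hb0]
        exact h1 s
      calc b 0 * r ^ (s + 1) = b 0 * r ^ s * r := by ring
        _ ≤ b s * r := mul_le_mul_of_nonneg_right ih (by positivity)
        _ ≤ _ := this
  have hrpos : 0 < r := by positivity
  have hlim : Filter.Tendsto (fun s => A * (q / r) ^ s) Filter.atTop (nhds (A * 0)) :=
    (tendsto_pow_atTop_nhds_zero_of_lt_one (by positivity) ((div_lt_one hrpos).2 hqr)).const_mul A
  have h3 : ∀ s, b 0 ≤ A * (q / r) ^ s := by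
    intro s
    rw [div_pow, mul_div_assoc', le_div_iff₀ (by positivity)]
    exact (h2 s).trans (hle s)
  have := ge_of_tendsto' hlim h3
  simp at this
  linarith

namespace LatticePath

variable {n : ℕ}

lemma rate_le_one (hn : 1 ≤ n) : rate n ≤ 1 := by
  unfold rate
  have h1 : (3 : ℝ) ≤ ((3 * n : ℕ) : ℝ) := by exact_mod_cast (by omega)
  have h2 : (1 : ℝ) ≤ ((3 * n - 1 : ℕ) : ℝ) := by exact_mod_cast (by omega : 1 ≤ 3 * n - 1)
  rw [div_le_one (by positivity)]
  nlinarith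

/-- Lipschitz decay bounds the squared norms of the iterates by a constant times `(1 - rate n) ^ (2
s)`. Self-adjointness and Cauchy–Schwarz make these squared norms log-convex, so the asymptotic rate
already holds in the first step and the constant drops out. -/
lemma sum_sq_avg_le (hn : 1 ≤ n) (f : LatticePath n → ℝ) (h0 : ∑ x, f x = 0) :
    ∑ x, avg f x ^ 2 ≤ (1 - rate n) ^ 2 * ∑ x, f x ^ 2 := by
  obtain ⟨K, hK, hf⟩ := exists_lipBound f
  have hr := rate_le_one hn
  set g : ℕ → LatticePath n → ℝ := fun s => avg^[s] f with hg
  have gs : ∀ s, g (s + 1) = avg (g s) := fun s => Function.iterate_succ_apply' _ _ _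
  have hlip : ∀ s, LipBound (g s) (K * (1 - rate n) ^ s) ∧ ∑ x, g s x = 0 := by
    intro s
    induction s with
    | zero => simpa [hg] using ⟨hf, h0⟩
    | succ s ih =>
      rw [gs]
      refine ⟨?_, by rw [sum_avg hn, ih.2]⟩
      have := ih.1.avg hn (mul_nonneg hK (pow_nonneg (by linarith) _))
      rwa [mul_assoc, ← pow_succ] at this
  have := le_mul_of_logConvex (b := fun s => ∑ x, g s x ^ 2)
    (A := Fintype.card (LatticePath n) * (2 * K * wdiam n) ^ 2) (q := (1 - rate n) ^ 2)
    (fun s => Finset.sum_nonneg fun x _ => sq_nonneg _) ?_ (sq_nonneg _) ?_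
  · simpa [hg] using this
  · intro s
    have h1 : ∑ x, g (s + 1) x ^ 2 = ∑ x, g s x * g (s + 2) x := by
      rw [gs (s + 1), sum_mul_avg, ← gs]
      exact Finset.sum_congr rfl fun x _ => by ring
    rw [h1]
    exact Finset.sum_mul_sq_le_sq_mul_sq _ _ _
  · intro s
    have h1 : ∀ x, g s x ^ 2 ≤ (2 * K * wdiam n) ^ 2 * ((1 - rate n) ^ 2) ^ s := by
      intro x
      have h2 := (hlip s).1.abs_le (mul_nonneg hK (pow_nonneg (by linarith) _)) (hlip s).2 x
      calc g s x ^ 2 = |g s x| ^ 2 := (sq_abs _).symm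
        _ ≤ _ := pow_le_pow_left₀ (abs_nonneg _) h2 2
        _ = _ := by rw [← pow_mul, mul_comm 2 s, pow_mul]; ring
    refine (Finset.sum_le_sum fun x _ => h1 x).trans ?_
    simp [mul_assoc]

/-- Poincaré inequality for adjacent transpositions of lattice paths. -/
theorem poincare (hn : 1 ≤ n) (f : LatticePath n → ℝ) (h0 : ∑ x, f x = 0) :
    16 * ∑ x, f x ^ 2 ≤ ((3 * n : ℕ) : ℝ) ^ 2 *
      ∑ j ∈ Finset.range (3 * n - 1), ∑ x, (f x - f (x.swap j)) ^ 2 := by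
  have h1 := sum_sq_avg_le hn f h0
  have hr := rate_le_one hn
  have h2 : ∑ x, f x * avg f x ≤ (1 - rate n) * ∑ x, f x ^ 2 := by
    have h3 := Finset.sum_mul_sq_le_sq_mul_sq Finset.univ f (avg f)
    have hnn : 0 ≤ ∑ x, f x ^ 2 := Finset.sum_nonneg fun x _ => sq_nonneg _
    refine abs_le_of_sq_le_sq' ?_ (mul_nonneg (by linarith) hnn) |>.2
    calc _ ≤ _ := h3
      _ ≤ (∑ x, f x ^ 2) * ((1 - rate n) ^ 2 * ∑ x, f x ^ 2) := mul_le_mul_of_nonneg_left h1 hnn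
      _ = _ := by ring
  have h4 := energy_eq hn f
  have h5 : rate n * ∑ x, f x ^ 2 ≤ ∑ x, f x * (f x - avg f x) := by
    have : ∑ x, f x * (f x - avg f x) = ∑ x, f x ^ 2 - ∑ x, f x * avg f x := by
      rw [← Finset.sum_sub_distrib]
      exact Finset.sum_congr rfl fun x _ => by ring
    rw [this]
    linarith
  have hpos : (0 : ℝ) < ((3 * n : ℕ) : ℝ) := by exact_mod_cast (by omega : 0 < 3 * n)
  have hpos' : (0 : ℝ) < ((3 * n - 1 : ℕ) : ℝ) := by exact_mod_cast (by omega : 0 < 3 * n - 1)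
  rw [h4, rate, le_div_iff₀ (by positivity), div_mul_eq_mul_div, div_mul_eq_mul_div,
    div_le_iff₀ (by positivity)] at h5
  refine le_of_mul_le_mul_right (a := ((3 * n - 1 : ℕ) : ℝ)) ?_ hpos'
  linarith

end LatticePath

/-! ### Words coding ternary trees -/

/-- The letters of the code of a non-crossing tree: open an edge at the current vertex, go to the next
vertex, close the last open edge at the current vertex. -/
inductive Letter
  | O | B | C
  deriving DecidableEq

open Letter

instance : Fintype Letter := ⟨{O, B, C}, fun l => by cases l <;> simp⟩

/-- Ternary trees, encoding non-crossing trees. -/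
inductive TT
  | nil : TT
  | node : TT → TT → TT → TT

namespace TT

def size : TT → ℕ
  | nil => 0
  | node a b c => a.size + b.size + c.size + 1

/-- A node stands for the longest edge at the first vertex. Beneath it, `a` hangs from its left end
and `b` from its right end, with `B` as the gap between them; `c` is the part from the right end
onwards. -/
def enc : TT → List Letter
  | nil => []
  | node a b c => O :: (a.enc ++ B :: (b.enc ++ C :: c.enc))

lemma length_enc (t : TT) : t.enc.length = 3 * t.size := by
  induction t with
  | nil => rfl
  | node a b c ha hb hc => simp [enc, size, ha, hb, hc]; ring

@[simp] lemma count_B_enc (t : TT) : t.enc.count B = t.size := by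
  induction t with
  | nil => rfl
  | node a b c ha hb hc => simp [enc, size, ha, hb, hc]; ring

@[simp] lemma count_C_enc (t : TT) : t.enc.count C = t.size := by
  induction t with
  | nil => rfl
  | node a b c ha hb hc => simp [enc, size, ha, hb, hc]; ring

@[simp] lemma count_O_enc (t : TT) : t.enc.count O = t.size := by
  induction t with
  | nil => rfl
  | node a b c ha hb hc => simp [enc, size, ha, hb, hc]; ring

/-- Unique parsing of a code from the left. -/
lemma enc_append_cons_inj {a b : TT} {l m : Letter} {r s : List Letter} (hl : l ≠ O) (hm : m ≠ O)
    (h : a.enc ++ l :: r = b.enc ++ m :: s) : a = b ∧ l = m ∧ r = s := by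
  induction a generalizing b l m r s with
  | nil =>
    cases b with
    | nil => simpa [enc] using h
    | node => simp [enc] at h; exact absurd h.1 hl
  | node a₁ a₂ a₃ h₁ h₂ h₃ =>
    cases b with
    | nil => simp [enc] at h; exact absurd h.1.symm hm
    | node b₁ b₂ b₃ =>
      simp only [enc, List.cons_append, List.append_assoc, List.cons.injEq, true_and] at h
      obtain ⟨rfl, -, h⟩ := h₁ (by decide) (by decide) h
      obtain ⟨rfl, -, h⟩ := h₂ (by decide) (by decide) h
      obtain ⟨rfl, h'⟩ := h₃ hl hm h
      exact ⟨rfl, h'⟩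

lemma enc_injective : Function.Injective enc := fun a b h =>
  (enc_append_cons_inj (l := B) (m := B) (r := []) (s := []) (by decide) (by decide) (by rw [h])).1

end TT

open TT

/-- The phases of the open edges while reading a word, `none` for an ill-formed word. -/
def run : List Letter → List Bool → Option (List Bool)
  | [], s => some s
  | O :: w, s => run w (false :: s)
  | B :: w, s => match s with
    | false :: s => run w (true :: s)
    | _ => none
  | C :: w, s => match s with
    | true :: s => run w s
    | _ => none

lemma run_append (v w : List Letter) (s : List Bool) :
    run (v ++ w) s = (run v s).bind (run w) := by
  induction v generalizing s with
  | nil => rfl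
  | cons l v ih =>
    cases l with
    | O => simp [run, ih]
    | B => rcases s with _ | ⟨_ | _, s⟩ <;> simp [run, ih]
    | C => rcases s with _ | ⟨_ | _, s⟩ <;> simp [run, ih]

@[simp] lemma run_enc_append (t : TT) (w : List Letter) (s : List Bool) :
    run (t.enc ++ w) s = run w s := by
  induction t generalizing w s with
  | nil => rfl
  | node a b c ha hb hc => simp [enc, run, ha, hb, hc]

@[simp] lemma run_enc (t : TT) (s : List Bool) : run t.enc s = some s := by
  simpa [run] using run_enc_append t [] s

/-- The rest of a well-formed word after a maximal code. -/
def Continues : List Bool → List Letter → Prop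
  | [], w => w = []
  | false :: s, w => ∃ v, w = B :: v ∧ run v (true :: s) = some []
  | true :: s, w => ∃ v, w = C :: v ∧ run v s = some []

lemma exists_parse (w : List Letter) (s : List Bool) (h : run w s = some []) :
    ∃ (t : TT) (v : List Letter), w = t.enc ++ v ∧ Continues s v := by
  induction hk : w.length using Nat.strong_induction_on generalizing w s with
  | _ k ih =>
    subst hk
    rcases w with _ | ⟨l, w⟩
    · simp [run] at h
      subst h
      exact ⟨nil, [], rfl, rfl⟩
    · cases l with
      | O =>
        obtain ⟨a, v, rfl, v, rfl, h₁⟩ := ih _ (by simp) w (false :: s) h rfl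
        obtain ⟨b, v, rfl, v, rfl, h₂⟩ := ih _ (by simp; omega) v (true :: s) h₁ rfl
        obtain ⟨c, v, rfl, h₃⟩ := ih _ (by simp; omega) v s h₂ rfl
        exact ⟨node a b c, v, by simp [enc], h₃⟩
      | B =>
        rcases s with _ | ⟨_ | _, s⟩
        · simp [run] at h
        · exact ⟨nil, _, rfl, w, rfl, h⟩
        · simp [run] at h
      | C =>
        rcases s with _ | ⟨_ | _, s⟩
        · simp [run] at h
        · simp [run] at h
        · exact ⟨nil, _, rfl, w, rfl, h⟩

/-- The stack lists the open edges, `true` marking those that have passed their own `B`. So every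
prefix of a code has at least as many `O` as `B` and at least as many `B` as `C`. -/
lemma run_counts {w : List Letter} {s s' : List Bool} (h : run w s = some s') :
    w.count O + s.length = w.count C + s'.length ∧
      w.count B + s.count true = w.count C + s'.count true := by
  induction w generalizing s with
  | nil => simp [run] at h; subst h; simp
  | cons l w ih =>
    cases l with
    | O =>
      have := ih h
      simp at this ⊢
      omega
    | B =>
      rcases s with _ | ⟨_ | _, s⟩
      · simp [run] at h
      · have := ih h
        simp at this ⊢
        omega
      · simp [run] at h
    | C =>
      rcases s with _ | ⟨_ | _, s⟩
      · simp [run] at h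
      · simp [run] at h
      · have := ih h
        simp at this ⊢
        omega

/-- Codes contain the three letters equally often, hence so would `z ++ [l]`. But the prefix `z`
already has at least as many `O` and `B` as `C`, so the last letter would have to be `C`. -/
lemma not_enc_eq_append_cons {a b : TT} {z : List Letter} {l : Letter} (hl : l ≠ C)
    (h : b.enc = z ++ l :: a.enc) : False := by
  have h1 : run (z ++ l :: a.enc) [] = some [] := by rw [← h]; simp
  rw [run_append] at h1
  obtain ⟨s, hs, -⟩ := Option.bind_eq_some_iff.1 h1
  have h2 := run_counts hs
  have h3 := congrArg (List.count O) h
  have h4 := congrArg (List.count B) h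
  have h5 := congrArg (List.count C) h
  have h6 := List.count_le_length (a := true) (l := s)
  cases l <;> simp at h2 h3 h4 h5 <;> first | omega | exact hl rfl

/-- Unique parsing of a code from the right. -/
lemma append_cons_enc_inj {a b : TT} {l m : Letter} {r s : List Letter} (hl : l ≠ C) (hm : m ≠ C)
    (h : r ++ l :: a.enc = s ++ m :: b.enc) : r = s ∧ l = m ∧ a = b := by
  rcases List.append_eq_append_iff.1 h with ⟨z, h1, h2⟩ | ⟨z, h1, h2⟩
  · rcases z with _ | ⟨k, z⟩
    · simp at h1 h2
      exact ⟨h1.symm, h2.1, enc_injective h2.2⟩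
    · simp at h2
      exact (not_enc_eq_append_cons hm h2.2).elim
  · rcases z with _ | ⟨k, z⟩
    · simp at h1 h2
      exact ⟨h1, h2.1.symm, (enc_injective h2.2).symm⟩
    · simp at h2
      exact (not_enc_eq_append_cons hl h2.2).elim

/-- The codes of the ternary trees with `n` nodes. -/
def IsCode (n : ℕ) (w : List Letter) : Prop := ∃ t : TT, t.size = n ∧ t.enc = w

lemma isCode_iff {n : ℕ} {w : List Letter} : IsCode n w ↔ run w [] = some [] ∧ w.count O = n := by
  constructor
  · rintro ⟨t, rfl, rfl⟩
    simp
  · rintro ⟨h, rfl⟩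
    obtain ⟨t, v, rfl, hv⟩ := exists_parse w [] h
    cases hv
    exact ⟨t, by simp, by simp⟩

lemma IsCode.exists_after_O {n : ℕ} {v w : List Letter} (h : IsCode n (v ++ O :: w)) :
    ∃ (x y : TT) (z : List Letter), w = x.enc ++ B :: (y.enc ++ C :: z) := by
  have h1 := (isCode_iff.1 h).1
  rw [run_append] at h1
  obtain ⟨s, -, h1⟩ := Option.bind_eq_some_iff.1 h1
  obtain ⟨x, v, rfl, v, rfl, h2⟩ := exists_parse w (false :: s) h1
  obtain ⟨y, v, rfl, v, rfl, -⟩ := exists_parse v (true :: s) h2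
  exact ⟨x, y, v, rfl⟩

lemma IsCode.exists_after_B {n : ℕ} {v w : List Letter} (h : IsCode n (v ++ B :: w)) :
    ∃ (x : TT) (z : List Letter), w = x.enc ++ C :: z := by
  have h1 := (isCode_iff.1 h).1
  rw [run_append] at h1
  obtain ⟨s, -, h1⟩ := Option.bind_eq_some_iff.1 h1
  rcases s with _ | ⟨_ | _, s⟩
  · simp [run] at h1
  · obtain ⟨x, v, rfl, v, rfl, h2⟩ := exists_parse w (true :: s) h1
    exact ⟨x, v, rfl⟩
  · simp [run] at h1

lemma IsCode.length {n : ℕ} {w : List Letter} (h : IsCode n w) : w.length = 3 * n := by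
  obtain ⟨t, rfl, rfl⟩ := h
  exact t.length_enc

/-- Replacing a factor by one with the same effect on the phases preserves codes. -/
lemma IsCode.congr {n : ℕ} {v w w' : List Letter} (h : IsCode n (v ++ w))
    (hrun : ∀ s, run w s = some [] → run w' s = some []) (hc : w'.count O = w.count O) :
    IsCode n (v ++ w') := by
  rw [isCode_iff, run_append] at h ⊢
  obtain ⟨s, hs, h1⟩ := Option.bind_eq_some_iff.1 h.1
  refine ⟨Option.bind_eq_some_iff.2 ⟨s, hs, hrun s h1⟩, ?_⟩
  rw [← h.2, List.count_append, List.count_append, hc]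

/-! ### The edges of a word -/

/-- The edges closed while reading a word, with the starts of the open edges and the current vertex. -/
def ed : List Letter → List ℕ → ℕ → List (ℕ × ℕ)
  | [], _, _ => []
  | O :: w, st, c => ed w (c :: st) c
  | B :: w, st, c => ed w st (c + 1)
  | C :: w, st, c => (st.headD 0, c) :: ed w st.tail c

/-- The starts of the open edges after reading a word. -/
def stk : List Letter → List ℕ → ℕ → List ℕ
  | [], st, _ => st
  | O :: w, st, c => stk w (c :: st) c
  | B :: w, st, c => stk w st (c + 1)
  | C :: w, st, c => stk w st.tail c

lemma ed_append (v w : List Letter) (st : List ℕ) (c : ℕ) :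
    ed (v ++ w) st c = ed v st c ++ ed w (stk v st c) (c + v.count B) := by
  induction v generalizing st c with
  | nil => simp [ed, stk]
  | cons l v ih => cases l <;> simp [ed, stk, ih, add_left_comm, add_comm]

lemma stk_append (v w : List Letter) (st : List ℕ) (c : ℕ) :
    stk (v ++ w) st c = stk w (stk v st c) (c + v.count B) := by
  induction v generalizing st c with
  | nil => simp [stk]
  | cons l v ih => cases l <;> simp [stk, ih, add_left_comm, add_comm]

lemma length_ed (w : List Letter) (st : List ℕ) (c : ℕ) : (ed w st c).length = w.count C := by
  induction w generalizing st c with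
  | nil => rfl
  | cons l v ih => cases l <;> simp [ed, ih]

/-- The edges of the non-crossing tree encoded by `t`, on the vertices `s, …, s + t.size`. -/
def TT.arcs : TT → ℕ → List (ℕ × ℕ)
  | nil, _ => []
  | node a b c, s => a.arcs s ++ (b.arcs (s + a.size + 1) ++
      (s, s + a.size + 1 + b.size) :: c.arcs (s + a.size + 1 + b.size))

@[simp] lemma ed_enc_append (t : TT) (w : List Letter) (st : List ℕ) (c : ℕ) :
    ed (t.enc ++ w) st c = t.arcs c ++ ed w st (c + t.size) := by
  induction t generalizing w st c with
  | nil => simp [enc, TT.arcs, size]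
  | node a b d ha hb hd =>
    simp only [enc, TT.arcs, List.cons_append, List.append_assoc, ed, ha, hb, hd, size,
      List.headD_cons, List.tail_cons]
    have e : c + a.size + 1 + b.size + d.size = c + (a.size + b.size + d.size + 1) := by omega
    rw [e]

@[simp] lemma ed_enc (t : TT) (st : List ℕ) (c : ℕ) : ed t.enc st c = t.arcs c := by
  simpa [ed] using ed_enc_append t [] st c

@[simp] lemma stk_enc_append (t : TT) (w : List Letter) (st : List ℕ) (c : ℕ) :
    stk (t.enc ++ w) st c = stk w st (c + t.size) := by
  induction t generalizing w st c with
  | nil => simp [enc, size]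
  | node a b d ha hb hd =>
    simp only [enc, List.cons_append, List.append_assoc, stk, ha, hb, hd, size, List.tail_cons]
    congr 1
    omega

@[simp] lemma stk_enc (t : TT) (st : List ℕ) (c : ℕ) : stk t.enc st c = st := by
  simpa [stk] using stk_enc_append t [] st c

/-! ### Marked words and elementary moves -/

/-- A word with a marked letter `C`, given by what precedes and what follows that letter. -/
abbrev Marked : Type := List Letter × List Letter

namespace Marked

/-- The underlying word. -/
def word (z : Marked) : List Letter := z.1 ++ C :: z.2

/-- The edge closed by the marked letter. -/
def edge (z : Marked) : ℕ × ℕ := ((stk z.1 [] 0).headD 0, z.1.count B)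

/-- The other edges. -/
def rest (z : Marked) : List (ℕ × ℕ) :=
  ed z.1 [] 0 ++ ed z.2 (stk z.1 [] 0).tail (z.1.count B)

lemma ed_word (z : Marked) : ed z.word [] 0 =
    ed z.1 [] 0 ++ z.edge :: ed z.2 (stk z.1 [] 0).tail (z.1.count B) := by
  simp [word, ed_append, ed, edge]

lemma perm_ed_word (z : Marked) : (ed z.word [] 0).Perm (z.edge :: z.rest) := by
  rw [ed_word]
  exact List.perm_middle

/-- `w` arises from the word of `z` by exchanging the marked edge for another one. -/
def FlipsTo (z : Marked) (w : List Letter) : Prop := ∃ f, (ed w [] 0).Perm (f :: z.rest)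

/-- One step of moving a letter `B` past a code. The marked letter closes the edge that this letter
`B` belongs to. -/
inductive Step : Marked → Marked → Prop
  | enter (v z : List Letter) (x y u : TT) :
      Step (v ++ B :: O :: (x.enc ++ B :: (y.enc ++ C :: u.enc)), z)
        (v ++ B :: (x.enc ++ O :: B :: y.enc), u.enc ++ C :: z)
  | cross (v z : List Letter) (x y u : TT) :
      Step (v ++ B :: (x.enc ++ O :: (y.enc ++ [B])), u.enc ++ C :: z)
        (v ++ O :: B :: x.enc, y.enc ++ B :: (u.enc ++ C :: z))
  | leave (v z : List Letter) (x y u : TT) :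
      Step (v ++ O :: (x.enc ++ [B]), y.enc ++ B :: (u.enc ++ C :: z))
        (v ++ O :: (x.enc ++ B :: (y.enc ++ C :: B :: u.enc)), z)

end Marked

namespace Marked

lemma FlipsTo.of_count {z : Marked} {w : List Letter} (f : ℕ × ℕ)
    (h : ∀ e, (ed w [] 0).count e = (f :: z.rest).count e) : z.FlipsTo w :=
  ⟨f, List.perm_iff_count.2 h⟩

lemma Step.isCode {n : ℕ} {a b : Marked} (h : Step a b) (ha : IsCode n a.word) :
    IsCode n b.word := by
  cases h with
  | enter v z x y u =>
    simp only [word, List.append_assoc, List.cons_append] at ha ⊢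
    refine ha.congr (fun s hs => ?_) (by simp; omega)
    rcases s with _ | ⟨_ | _, s⟩ <;> simp [run] at hs ⊢
    exact hs
  | cross v z x y u =>
    simp only [word, List.append_assoc, List.cons_append] at ha ⊢
    refine ha.congr (fun s hs => ?_) (by simp; omega)
    rcases s with _ | ⟨_ | _, s⟩ <;> simp [run] at hs ⊢
    exact hs
  | leave v z x y u =>
    simp only [word, List.append_assoc, List.cons_append] at ha ⊢
    refine ha.congr (fun s hs => ?_) (by simp)
    rcases s with _ | ⟨_ | _, s⟩ <;> simp [run] at hs ⊢
    exact hs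

/-- Each move exchanges the edge of the node being passed. That edge carries the mark in the source
for `cross` and `leave`; in `enter` the mark comes from the enclosing edge, so the exchange is seen
from the target. -/
lemma Step.flipsTo {a b : Marked} (h : Step a b) : a.FlipsTo b.word ∨ b.FlipsTo a.word := by
  cases h with
  | enter v z x y u =>
    right
    -- Vertices are numbered by the letters `B` read so far; this is the edge of the passed node as
    -- it stands in the source.
    refine FlipsTo.of_count (v.count B + 1, v.count B + 1 + x.size + 1 + y.size) fun e => ?_
    simp only [word, rest, ed_append, stk_append, ed, stk, ed_enc, stk_enc,
      List.count_append, List.count_cons_self, count_B_enc, List.headD_cons,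
      List.tail_cons, List.count_cons_of_ne, ne_eq, reduceCtorEq, not_false_eq_true,
      List.append_assoc, List.cons_append]
    ring_nf
    simp only [List.count_append, List.count_cons]
    ring
  | cross v z x y u =>
    left
    refine FlipsTo.of_count (v.count B, v.count B + 1 + x.size) fun e => ?_
    simp only [word, rest, ed_append, stk_append, ed, stk, ed_enc, stk_enc,
      List.count_append, List.count_cons_self, count_B_enc, List.headD_cons,
      List.tail_cons, List.count_cons_of_ne, ne_eq, reduceCtorEq, not_false_eq_true,
      List.append_assoc, List.cons_append, List.nil_append, List.count_nil]
    ring_nf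
    simp only [List.count_append, List.count_cons]
    ring
  | leave v z x y u =>
    left
    refine FlipsTo.of_count (v.count B, v.count B + x.size + 1 + y.size) fun e => ?_
    simp only [word, rest, ed_append, stk_append, ed, stk, ed_enc, stk_enc,
      List.count_append, List.count_cons_self, count_B_enc, List.headD_cons,
      List.tail_cons, List.count_cons_of_ne, ne_eq, reduceCtorEq, not_false_eq_true,
      List.append_assoc, List.cons_append, List.nil_append, List.count_nil]
    ring_nf
    simp only [List.count_append, List.count_cons]
    ring

/-- The target reveals the kind of move. Parsed from the right, the part before the mark ends in
`C`, `B`, code after `leave`, and in `O`, `B`, code otherwise. The code following the mark is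
followed by `C` after `enter` and by `B` after `cross`. Unique parsing then recovers all data. -/
lemma Step.source_unique {a b c : Marked} (ha : Step a c) (hb : Step b c) : a = b := by
  cases ha with
  | enter v z x y u =>
    generalize hp : v ++ B :: (x.enc ++ O :: B :: y.enc) = p at hb
    generalize hq : u.enc ++ C :: z = q at hb
    cases hb with
    | enter v' z' x' y' u' =>
      obtain ⟨h1, -, rfl⟩ := append_cons_enc_inj (r := v ++ B :: (x.enc ++ [O])) (l := B) (a := y)
        (s := v' ++ B :: (x'.enc ++ [O])) (m := B) (b := y') (by decide) (by decide)
        (by simpa using hp)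
      obtain ⟨rfl, -, rfl⟩ := append_cons_enc_inj (r := v) (l := B) (a := x) (s := v') (m := B)
        (b := x') (by decide) (by decide)
        (List.append_cancel_right (bs := [O]) (by simpa using h1))
      obtain ⟨rfl, -, rfl⟩ := enc_append_cons_inj (by decide) (by decide) hq
      rfl
    | cross v' z' x' y' u' =>
      obtain ⟨-, h, -⟩ := enc_append_cons_inj (by decide) (by decide) hq
      simp at h
    | leave v' z' x' y' u' =>
      obtain ⟨h1, -, -⟩ := append_cons_enc_inj (r := v ++ B :: (x.enc ++ [O])) (l := B) (a := y)
        (s := v' ++ O :: (x'.enc ++ B :: (y'.enc ++ [C]))) (m := B) (b := u') (by decide)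
        (by decide) (by simpa using hp)
      have := congrArg List.getLast? h1
      simp [List.getLast?_append, List.getLast?_cons] at this
  | cross v z x y u =>
    generalize hp : v ++ O :: B :: x.enc = p at hb
    generalize hq : y.enc ++ B :: (u.enc ++ C :: z) = q at hb
    cases hb with
    | enter v' z' x' y' u' =>
      obtain ⟨-, h, -⟩ := enc_append_cons_inj (by decide) (by decide) hq
      simp at h
    | cross v' z' x' y' u' =>
      obtain ⟨h1, -, rfl⟩ := append_cons_enc_inj (r := v ++ [O]) (l := B) (a := x)
        (s := v' ++ [O]) (m := B) (b := x') (by decide) (by decide) (by simpa using hp)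
      obtain rfl := List.append_cancel_right h1
      obtain ⟨rfl, -, h⟩ := enc_append_cons_inj (by decide) (by decide) hq
      obtain ⟨rfl, -, rfl⟩ := enc_append_cons_inj (by decide) (by decide) h
      rfl
    | leave v' z' x' y' u' =>
      obtain ⟨h1, -, -⟩ := append_cons_enc_inj (r := v ++ [O]) (l := B) (a := x)
        (s := v' ++ O :: (x'.enc ++ B :: (y'.enc ++ [C]))) (m := B) (b := u') (by decide)
        (by decide) (by simpa using hp)
      have := congrArg List.getLast? h1
      simp [List.getLast?_append, List.getLast?_cons] at this
  | leave v z x y u =>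
    generalize hp : v ++ O :: (x.enc ++ B :: (y.enc ++ C :: B :: u.enc)) = p at hb
    cases hb with
    | enter v' z' x' y' u' =>
      obtain ⟨h1, -, -⟩ := append_cons_enc_inj
        (r := v ++ O :: (x.enc ++ B :: (y.enc ++ [C]))) (l := B) (a := u)
        (s := v' ++ B :: (x'.enc ++ [O])) (m := B) (b := y') (by decide) (by decide)
        (by simpa using hp)
      have := congrArg List.getLast? h1
      simp [List.getLast?_append, List.getLast?_cons] at this
    | cross v' z' x' y' u' =>
      obtain ⟨h1, -, -⟩ := append_cons_enc_inj
        (r := v ++ O :: (x.enc ++ B :: (y.enc ++ [C]))) (l := B) (a := u)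
        (s := v' ++ [O]) (m := B) (b := x') (by decide) (by decide) (by simpa using hp)
      have := congrArg List.getLast? h1
      simp [List.getLast?_append, List.getLast?_cons] at this
    | leave v' z' x' y' u' =>
      obtain ⟨h1, -, rfl⟩ := append_cons_enc_inj
        (r := v ++ O :: (x.enc ++ B :: (y.enc ++ [C]))) (l := B) (a := u)
        (s := v' ++ O :: (x'.enc ++ B :: (y'.enc ++ [C]))) (m := B) (b := u') (by decide)
        (by decide) (by simpa using hp)
      obtain ⟨h2, -, rfl⟩ := append_cons_enc_inj (r := v ++ O :: x.enc) (l := B) (a := y)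
        (s := v' ++ O :: x'.enc) (m := B) (b := y') (by decide) (by decide)
        (List.append_cancel_right (bs := [C]) (by simpa using h1))
      obtain ⟨rfl, -, rfl⟩ := append_cons_enc_inj (l := O) (m := O) (by decide) (by decide) h2
      rfl

/-- `k` successive steps. -/
inductive Steps : ℕ → Marked → Marked → Prop
  | refl (a : Marked) : Steps 0 a a
  | tail {k : ℕ} {a b c : Marked} : Steps k a b → Step b c → Steps (k + 1) a c

lemma Steps.trans {k l : ℕ} {a b c : Marked} (h : Steps k a b) (h' : Steps l b c) :
    Steps (k + l) a c := by
  induction h' with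
  | refl => exact h
  | tail _ hs ih => exact Steps.tail (ih h) hs

lemma Step.steps {a b : Marked} (h : Step a b) : Steps 1 a b := (Steps.refl a).tail h

/-- A letter `B` moves past a code in three steps per node. -/
lemma steps_enc (t : TT) (v z : List Letter) :
    Steps (3 * t.size) (v ++ B :: t.enc, z) (v ++ (t.enc ++ [B]), z) := by
  induction t generalizing v z with
  | nil => exact Steps.refl _
  | node c d u hc hd hu =>
    -- The letter enters the node, passes its second subtree, crosses, passes its first subtree,
    -- leaves, and passes its third subtree: three moves belong to the node itself.
    have h1 := (Step.enter v z c d u).steps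
    have h2 := hd (v ++ B :: (c.enc ++ [O])) (u.enc ++ C :: z)
    have h3 := (Step.cross v z c d u).steps
    have h4 := hc (v ++ [O]) (d.enc ++ B :: (u.enc ++ C :: z))
    have h5 := (Step.leave v z c d u).steps
    have h6 := hu (v ++ O :: (c.enc ++ B :: (d.enc ++ [C]))) z
    simp only [List.append_assoc, List.cons_append, List.nil_append] at h1 h2 h3 h4 h5 h6
    have h := ((((h1.trans h2).trans h3).trans h4).trans h5).trans h6
    have e : 1 + 3 * d.size + 1 + 3 * c.size + 1 + 3 * u.size = 3 * (node c d u).size := by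
      simp only [TT.size]
      ring
    rw [e] at h
    simpa [enc] using h

lemma Steps.isCode {n k : ℕ} {a b : Marked} (h : Steps k a b) (ha : IsCode n a.word) :
    IsCode n b.word := by
  induction h with
  | refl => exact ha
  | tail _ hs ih => exact hs.isCode (ih ha)

/-- Moves are deterministic backwards, so runs from different starts occupy different marked words
at each time. This is the whole congestion estimate. -/
lemma Steps.source_unique {k : ℕ} {a b c : Marked} (ha : Steps k a c) (hb : Steps k b c) :
    a = b := by
  induction ha generalizing b with
  | refl => cases hb; rfl
  | tail _ hs ih =>
    cases hb with
    | tail hb' hs' =>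
      obtain rfl := hs.source_unique hs'
      exact ih hb'

end Marked

/-! ### Simulating transpositions by flips -/

lemma finite_isCode_append (n : ℕ) (m : List Letter) :
    {p : List Letter × List Letter | IsCode n (p.1 ++ (m ++ p.2))}.Finite := by
  refine ((List.finite_length_le Letter (3 * n)).prod
    (List.finite_length_le Letter (3 * n))).subset ?_
  rintro ⟨v, w⟩ h
  have := h.length
  simp at this
  exact ⟨by simp; omega, by simp; omega⟩

/-- The ways to split a code as `v ++ m ++ w` for a fixed word `m`. -/
noncomputable def splits (n : ℕ) (m : List Letter) : Finset (List Letter × List Letter) :=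
  (finite_isCode_append n m).toFinset

lemma mem_splits {n : ℕ} {m : List Letter} {p : List Letter × List Letter} :
    p ∈ splits n m ↔ IsCode n (p.1 ++ (m ++ p.2)) := by
  simp [splits]

lemma mem_splits_C {n : ℕ} {z : Marked} : z ∈ splits n [C] ↔ IsCode n z.word := mem_splits

lemma sum_comp_le_of_injOn {ι κ : Type*} [DecidableEq κ] {s : Finset ι} {t : Finset κ} (φ : ι → κ)
    (hinj : Set.InjOn φ s) (hmem : ∀ i ∈ s, φ i ∈ t) (M : κ → ℝ) (hM : ∀ k, 0 ≤ M k) :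
    ∑ i ∈ s, M (φ i) ≤ ∑ k ∈ t, M k := by
  rw [← Finset.sum_image (f := M) hinj]
  exact Finset.sum_le_sum_of_subset_of_nonneg (Finset.image_subset_iff.2 hmem) fun k _ _ => hM k

namespace Marked

lemma Steps.exists_seq {k : ℕ} {a b : Marked} (h : Steps k a b) :
    ∃ c : ℕ → Marked, c 0 = a ∧ c k = b ∧ (∀ j < k, Step (c j) (c (j + 1))) ∧
      ∀ j ≤ k, Steps j a (c j) := by
  induction h with
  | refl a => exact ⟨fun _ => a, rfl, rfl, by simp, fun j hj => by
      obtain rfl : j = 0 := by omega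
      exact Steps.refl a⟩
  | @tail k a b c h hs ih =>
    obtain ⟨e, h0, hk, hstep, hsteps⟩ := ih
    refine ⟨fun j => if j ≤ k then e j else c, by simpa using h0, by simp, ?_, ?_⟩
    · intro j hj
      rcases Nat.lt_succ_iff_lt_or_eq.1 hj with hj | rfl
      · simpa [hj.le, Nat.succ_le_iff.2 hj] using hstep j hj
      · simpa [hk] using hs
    · intro j hj
      by_cases hjk : j ≤ k
      · simpa [hjk] using hsteps j hjk
      · obtain rfl : j = k + 1 := by omega
        simpa using h.tail hs

/-- `M z` bounds the squared change of `F` under an exchange of the marked edge of `z`. -/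
def Dominates (n : ℕ) (F : List Letter → ℝ) (M : Marked → ℝ) : Prop :=
  (∀ z, 0 ≤ M z) ∧ ∀ z w, IsCode n z.word → IsCode n w → z.FlipsTo w → (F z.word - F w) ^ 2 ≤ M z

/-- Both terms are needed because the exchanged edge may be the marked one at either end of the
move. -/
lemma Dominates.step_le {n : ℕ} {F : List Letter → ℝ} {M : Marked → ℝ} (hM : Dominates n F M)
    {a b : Marked} (ha : IsCode n a.word) (h : Step a b) :
    (F a.word - F b.word) ^ 2 ≤ M a + M b := by
  rcases h.flipsTo with hf | hf
  · exact (hM.2 a _ ha (h.isCode ha) hf).trans (le_add_of_nonneg_right (hM.1 b))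
  · rw [← neg_sub, neg_sq]
    exact (hM.2 b _ (h.isCode ha) ha hf).trans (le_add_of_nonneg_left (hM.1 a))

/-- Runs of at most `L` steps from distinct starting points. -/
lemma Dominates.sum_steps_le {n : ℕ} {F : List Letter → ℝ} {M : Marked → ℝ} (hM : Dominates n F M)
    {ι : Type*} {s : Finset ι} {a b : ι → Marked} {k : ι → ℕ} {L : ℕ}
    (hsteps : ∀ i ∈ s, Steps (k i) (a i) (b i)) (hcode : ∀ i ∈ s, IsCode n (a i).word)
    (hinj : Set.InjOn a s) (hk : ∀ i ∈ s, k i ≤ L) :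
    ∑ i ∈ s, (F (a i).word - F (b i).word) ^ 2 ≤ 2 * (L : ℝ) ^ 2 * ∑ z ∈ splits n [C], M z := by
  classical
  have hex : ∀ i, ∃ c : ℕ → Marked, i ∈ s → c 0 = a i ∧ c (k i) = b i ∧
      (∀ j < k i, Step (c j) (c (j + 1))) ∧ ∀ j ≤ k i, Steps j (a i) (c j) := by
    intro i
    by_cases hi : i ∈ s
    · obtain ⟨c, hc⟩ := (hsteps i hi).exists_seq
      exact ⟨c, fun _ => hc⟩
    · exact ⟨fun _ => a i, fun h => absurd h hi⟩
  choose c hc using hex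
  set S := ∑ z ∈ splits n [C], M z with hS
  have hbound : ∀ i ∈ s, (F (a i).word - F (b i).word) ^ 2 ≤
      L * ∑ j ∈ Finset.range L, if j < k i then M (c i j) + M (c i (j + 1)) else 0 := by
    intro i hi
    obtain ⟨h0, hk', hstep, hst⟩ := hc i hi
    have h1 : F (b i).word - F (a i).word =
        ∑ j ∈ Finset.range (k i), (F (c i (j + 1)).word - F (c i j).word) := by
      rw [Finset.sum_range_sub (fun j => F (c i j).word), h0, hk']
    have h2 : ∑ j ∈ Finset.range (k i), (F (c i (j + 1)).word - F (c i j).word) ^ 2 ≤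
        ∑ j ∈ Finset.range (k i), (M (c i j) + M (c i (j + 1))) := by
      refine Finset.sum_le_sum fun j hj => ?_
      have hj' := Finset.mem_range.1 hj
      rw [← neg_sub, neg_sq]
      exact hM.step_le ((hst j hj'.le).isCode (hcode i hi)) (hstep j hj')
    have h3 : ∑ j ∈ Finset.range (k i), (M (c i j) + M (c i (j + 1))) =
        ∑ j ∈ Finset.range L, if j < k i then M (c i j) + M (c i (j + 1)) else 0 := by
      rw [← Finset.sum_filter]
      congr 1
      ext j
      simp only [Finset.mem_range, Finset.mem_filter]
      exact ⟨fun h => ⟨h.trans_le (hk i hi), h⟩, fun h => h.2⟩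
    rw [← neg_sub, neg_sq, h1]
    calc _ ≤ ((Finset.range (k i)).card : ℝ) *
          ∑ j ∈ Finset.range (k i), (F (c i (j + 1)).word - F (c i j).word) ^ 2 :=
          sq_sum_le_card_mul_sum_sq
      _ ≤ L * _ := by
          rw [Finset.card_range]
          refine mul_le_mul (by exact_mod_cast hk i hi) (h2.trans h3.le)
            (Finset.sum_nonneg fun _ _ => sq_nonneg _) (Nat.cast_nonneg _)
  -- At a fixed time each marked word is visited by at most one run. Cauchy–Schwarz along a run
  -- costs one factor `L`, the sum over times another, and the two ends of each move the factor 2.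
  have hcol : ∀ j, ∀ d ∈ ({0, 1} : Finset ℕ),
      ∑ i ∈ s.filter (fun i => j < k i), M (c i (j + d)) ≤ S := by
    intro j d hd
    have hd' : d ≤ 1 := by
      simp at hd
      omega
    refine sum_comp_le_of_injOn (fun i => c i (j + d)) ?_ ?_ M hM.1
    · intro i hi i' hi' heq
      simp only [Finset.coe_filter, Set.mem_ofPred_eq] at hi hi'
      have h1 := (hc i hi.1).2.2.2 (j + d) (by omega)
      have h2 := (hc i' hi'.1).2.2.2 (j + d) (by omega)
      simp only at heq
      rw [← heq] at h2
      exact hinj hi.1 hi'.1 (h1.source_unique h2)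
    · intro i hi
      simp only [Finset.mem_filter] at hi
      exact mem_splits_C.2 (((hc i hi.1).2.2.2 (j + d) (by omega)).isCode (hcode i hi.1))
  calc _ ≤ ∑ i ∈ s, L * ∑ j ∈ Finset.range L,
        (if j < k i then M (c i j) + M (c i (j + 1)) else 0) := Finset.sum_le_sum hbound
    _ = L * ∑ j ∈ Finset.range L, (∑ i ∈ s.filter (fun i => j < k i), M (c i (j + 0)) +
        ∑ i ∈ s.filter (fun i => j < k i), M (c i (j + 1))) := by
        rw [← Finset.mul_sum, Finset.sum_comm]
        congr 1
        refine Finset.sum_congr rfl fun j _ => ?_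
        rw [← Finset.sum_filter, Finset.sum_add_distrib]
        rfl
    _ ≤ L * ∑ j ∈ Finset.range L, (S + S) := by
        refine mul_le_mul_of_nonneg_left (Finset.sum_le_sum fun j _ => ?_) (Nat.cast_nonneg _)
        exact add_le_add (hcol j 0 (by simp)) (hcol j 1 (by simp))
    _ = _ := by
        simp only [Finset.sum_const, Finset.card_range, nsmul_eq_mul]
        ring

/-- Moving an opening letter to the left past a letter `B`. -/
lemma Dominates.sum_raise_B_le {n : ℕ} {F : List Letter → ℝ} {M : Marked → ℝ}
    (hM : Dominates n F M) (t : List Letter × List Letter → List Letter)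
    (ht : ∀ (v z : List Letter) (x y : TT),
      t (v, x.enc ++ B :: (y.enc ++ C :: z)) = v ++ O :: B :: (x.enc ++ C :: (y.enc ++ B :: z))) :
    ∑ p ∈ splits n [B, O], (F (p.1 ++ B :: O :: p.2) - F (t p)) ^ 2 ≤
      18 * (n : ℝ) ^ 2 * ∑ z ∈ splits n [C], M z := by
  have hex : ∀ p : List Letter × List Letter, ∃ (x y u : TT) (z : List Letter), p ∈ splits n [B, O] →
      p.2 = x.enc ++ B :: (y.enc ++ C :: (u.enc ++ C :: z)) := by
    intro p
    by_cases hp : p ∈ splits n [B, O]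
    · have hp' : IsCode n (p.1 ++ B :: O :: p.2) := mem_splits.1 hp
      obtain ⟨r, z, hr⟩ := hp'.exists_after_B
      rcases r with _ | ⟨x, y, u⟩
      · simp [enc] at hr
      · simp only [enc, List.cons_append, List.append_assoc, List.cons.injEq, true_and] at hr
        exact ⟨x, y, u, z, fun _ => hr⟩
    · exact ⟨nil, nil, nil, [], fun h => absurd h hp⟩
  choose x y u z hxy using hex
  -- The run enters the node `x`, `y`, `u`, passes `y` and crosses. The initial mark is the letter
  -- `C` closing the edge of the leading `B`. The run has `2 + 3 |y|` moves, fewer than letters in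
  -- the word, and `2 (3n)² = 18 n²`.
  have h := hM.sum_steps_le (s := splits n [B, O]) (L := 3 * n)
    (a := fun p => (p.1 ++ B :: O :: ((x p).enc ++ B :: ((y p).enc ++ C :: (u p).enc)), z p))
    (b := fun p => (p.1 ++ O :: B :: (x p).enc, (y p).enc ++ B :: ((u p).enc ++ C :: z p)))
    (k := fun p => 1 + 3 * (y p).size + 1) ?_ ?_ ?_ ?_
  · calc _ = _ := ?_
      _ ≤ _ := h
      _ = _ := by push_cast; ring
    refine Finset.sum_congr rfl fun p hp => ?_
    have h1 : p = (p.1, p.2) := rfl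
    have h2 := hxy p hp
    rw [show t p = t (p.1, p.2) from rfl, h2, ht]
    simp [word]
  · intro p hp
    have h1 := (Step.enter p.1 (z p) (x p) (y p) (u p)).steps
    have h2 := steps_enc (y p) (p.1 ++ B :: ((x p).enc ++ [O])) ((u p).enc ++ C :: z p)
    have h3 := (Step.cross p.1 (z p) (x p) (y p) (u p)).steps
    simp only [List.append_assoc, List.cons_append, List.nil_append] at h1 h2 h3
    exact (h1.trans h2).trans h3
  · intro p hp
    have h1 : IsCode n (p.1 ++ B :: O :: p.2) := mem_splits.1 hp
    rw [hxy p hp] at h1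
    simpa [word] using h1
  · intro p hp q hq heq
    simp only [Prod.mk.injEq] at heq
    obtain ⟨h1, h2⟩ := heq
    obtain ⟨h3, -, h4⟩ := append_cons_enc_inj (l := B) (m := B)
      (a := node (x p) (y p) (u p)) (b := node (x q) (y q) (u q)) (by decide) (by decide)
      (by simpa [enc] using h1)
    injection h4 with h5 h6 h7
    refine Prod.ext h3 ?_
    rw [hxy p hp, hxy q hq, h2, h5, h6, h7]
  · intro p hp
    have h1 : IsCode n (p.1 ++ B :: O :: p.2) := mem_splits.1 hp
    have h2 := h1.length
    rw [hxy p hp] at h2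
    simp [length_enc] at h2
    omega

/-- A closing letter followed by a code may be moved behind it. -/
lemma flipsTo_jump_C (v w : List Letter) (t : TT) :
    FlipsTo (v, t.enc ++ w) (v ++ (t.enc ++ C :: w)) := by
  refine FlipsTo.of_count ((stk v [] 0).headD 0, v.count B + t.size) fun e => ?_
  simp only [rest, ed_append, ed, ed_enc, stk_enc, count_B_enc]
  ring_nf
  simp only [List.count_append, List.count_cons]
  ring

/-- Moving an opening letter to the left past a letter `C`. -/
lemma Dominates.sum_raise_C_le {n : ℕ} (hn : 1 ≤ n) {F : List Letter → ℝ} {M : Marked → ℝ}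
    (hM : Dominates n F M) (t : List Letter × List Letter → List Letter)
    (ht : ∀ (v z : List Letter) (x y : TT),
      t (v, x.enc ++ B :: (y.enc ++ C :: z)) = v ++ O :: B :: (x.enc ++ C :: (y.enc ++ C :: z))) :
    ∑ p ∈ splits n [C, O], (F (p.1 ++ C :: O :: p.2) - F (t p)) ^ 2 ≤
      60 * (n : ℝ) ^ 2 * ∑ z ∈ splits n [C], M z := by
  classical
  have hex : ∀ p : List Letter × List Letter, ∃ (x y : TT) (z : List Letter), p ∈ splits n [C, O] →
      p.2 = x.enc ++ B :: (y.enc ++ C :: z) := by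
    intro p
    by_cases hp : p ∈ splits n [C, O]
    · have hp' : IsCode n ((p.1 ++ [C]) ++ O :: p.2) := by simpa using mem_splits.1 hp
      obtain ⟨x, y, z, h⟩ := hp'.exists_after_O
      exact ⟨x, y, z, fun _ => h⟩
    · exact ⟨nil, nil, [], fun h => absurd h hp⟩
  choose x y z hxy using hex
  have hcode : ∀ p ∈ splits n [C, O],
      IsCode n (p.1 ++ C :: O :: ((x p).enc ++ B :: ((y p).enc ++ C :: z p))) := by
    intro p hp
    rw [← hxy p hp]
    exact mem_splits.1 hp
  have hcode' : ∀ p ∈ splits n [C, O],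
      IsCode n (p.1 ++ O :: B :: ((x p).enc ++ C :: ((y p).enc ++ C :: z p))) := by
    intro p hp
    refine (hcode p hp).congr (fun s hs => ?_) (by simp)
    rcases s with _ | ⟨_ | _, s⟩ <;> simp [run] at hs ⊢
    exact hs
  have hcode'' : ∀ p ∈ splits n [C, O],
      IsCode n (p.1 ++ O :: ((x p).enc ++ B :: ((y p).enc ++ C :: C :: z p))) := by
    intro p hp
    refine (hcode p hp).congr (fun s hs => ?_) (by simp)
    rcases s with _ | ⟨_ | _, s⟩ <;> simp [run] at hs ⊢
    exact hs
  -- The route has three legs meeting in the word of `hcode''`. From the source, the leading `C`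
  -- jumps over the following node (`d`). From the target, the letter `B` passes `x` (the run from
  -- `a` to `b`), and then the marked `C` jumps over `y`.
  set a : List Letter × List Letter → Marked :=
    fun p => (p.1 ++ O :: B :: (x p).enc, (y p).enc ++ C :: z p) with ha
  set b : List Letter × List Letter → Marked :=
    fun p => (p.1 ++ O :: ((x p).enc ++ [B]), (y p).enc ++ C :: z p) with hb
  set d : List Letter × List Letter → Marked := fun p => (p.1, O :: p.2) with hd
  set S := ∑ z ∈ splits n [C], M z with hS
  have hsteps : ∀ p, Steps (3 * (x p).size) (a p) (b p) := by
    intro p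
    have h2 := steps_enc (x p) (p.1 ++ [O]) ((y p).enc ++ C :: z p)
    simpa only [List.append_assoc, List.cons_append, List.nil_append] using h2
  have hacode : ∀ p ∈ splits n [C, O], IsCode n (a p).word := fun p hp => by
    simpa [word, ha] using hcode' p hp
  have hbcode : ∀ p ∈ splits n [C, O], IsCode n (b p).word := fun p hp =>
    (hsteps p).isCode (hacode p hp)
  have hparse : ∀ p ∈ splits n [C, O], ∀ q ∈ splits n [C, O], p.1 = q.1 → x p = x q →
      (y p).enc ++ C :: z p = (y q).enc ++ C :: z q → p = q := by
    intro p hp q hq h1 h2 h3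
    refine Prod.ext h1 ?_
    rw [hxy p hp, hxy q hq, h2, h3]
  have h := hM.sum_steps_le (s := splits n [C, O]) (L := 3 * n) (a := a) (b := b)
    (k := fun p => 3 * (x p).size) (fun p _ => hsteps p) hacode ?_ ?_
  · have h1 : ∑ p ∈ splits n [C, O], M (b p) ≤ S := by
      refine sum_comp_le_of_injOn b ?_ (fun p hp => mem_splits_C.2 (hbcode p hp)) M hM.1
      intro p hp q hq heq
      simp only [hb, Prod.mk.injEq] at heq
      obtain ⟨h3, -, h4⟩ := append_cons_enc_inj (l := O) (m := O) (r := p.1) (s := q.1)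
        (a := x p) (b := x q) (by decide) (by decide)
        (List.append_cancel_right (bs := [B]) (by simpa using heq.1))
      exact hparse p hp q hq h3 h4 heq.2
    have h2 : ∑ p ∈ splits n [C, O], M (d p) ≤ S := by
      refine sum_comp_le_of_injOn d ?_ (fun p hp => mem_splits_C.2 (mem_splits.1 hp)) M hM.1
      intro p hp q hq heq
      simp only [hd, Prod.mk.injEq, List.cons.injEq, true_and] at heq
      exact Prod.ext heq.1 heq.2
    -- Cauchy–Schwarz over three legs; summed, `3 (18 n² + 1 + 1) ≤ 60 n²`.
    have h3 : ∀ p ∈ splits n [C, O], (F (p.1 ++ C :: O :: p.2) - F (t p)) ^ 2 ≤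
        3 * ((F (a p).word - F (b p).word) ^ 2 + M (b p) + M (d p)) := by
      intro p hp
      have e1 : t p = (a p).word := by
        rw [show t p = t (p.1, p.2) from rfl, hxy p hp, ht]
        simp [ha, word]
      have e2 := hM.2 (b p) _ (hbcode p hp) (hcode'' p hp) (by
        simpa using flipsTo_jump_C (p.1 ++ O :: ((x p).enc ++ [B])) (C :: z p) (y p))
      have e3 := hM.2 (d p) _ (mem_splits.1 hp) (hcode'' p hp) (by
        have := flipsTo_jump_C p.1 (z p) (node (x p) (y p) nil)
        simp only [enc, List.append_assoc, List.cons_append, List.nil_append] at this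
        simpa [hd, hxy p hp] using this)
      have e4 : (d p).word = p.1 ++ C :: O :: p.2 := rfl
      rw [e4] at e3
      rw [e1]
      set A := F (p.1 ++ C :: O :: p.2)
      set E := F (p.1 ++ O :: ((x p).enc ++ B :: ((y p).enc ++ C :: C :: z p)))
      nlinarith [sq_nonneg ((A - E) - (E - F (b p).word)),
        sq_nonneg ((E - F (b p).word) - (F (b p).word - F (a p).word)),
        sq_nonneg ((A - E) - (F (b p).word - F (a p).word))]
    refine (Finset.sum_le_sum h3).trans ?_
    rw [← Finset.mul_sum, Finset.sum_add_distrib, Finset.sum_add_distrib]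
    have hS0 : 0 ≤ S := Finset.sum_nonneg fun z _ => hM.1 z
    have hn' : (1 : ℝ) ≤ (n : ℝ) ^ 2 := by
      have : (1 : ℝ) ≤ n := by exact_mod_cast hn
      nlinarith
    push_cast at h
    nlinarith
  · intro p hp q hq heq
    simp only [ha, Prod.mk.injEq] at heq
    obtain ⟨h3, -, h4⟩ := append_cons_enc_inj (l := B) (m := B) (r := p.1 ++ [O]) (s := q.1 ++ [O])
      (a := x p) (b := x q) (by decide) (by decide) (by simpa using heq.1)
    exact hparse p hp q hq (List.append_cancel_right h3) h4 heq.2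
  · intro p hp
    have h2 := (hcode p hp).length
    simp [length_enc] at h2
    omega

end Marked

/-! ### Codes and lattice paths -/

/-- Which letters of a word are opening letters. -/
def bits (w : List Letter) : List Bool := w.map fun l => decide (l = O)

/-- The number of opening letters among the first `k` ones. -/
def height (b : List Bool) (k : ℕ) : ℤ := ((b.take k).count true : ℕ)

lemma bits_append (v w : List Letter) : bits (v ++ w) = bits v ++ bits w := List.map_append

lemma bits_cons (l : Letter) (w : List Letter) : bits (l :: w) = decide (l = O) :: bits w := rfl

lemma length_bits (w : List Letter) : (bits w).length = w.length := List.length_map _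

lemma count_true_bits (w : List Letter) : (bits w).count true = w.count O := by
  induction w with
  | nil => rfl
  | cons l w ih => cases l <;> simp [bits_cons, ih]

lemma height_bits (w : List Letter) (k : ℕ) : height (bits w) k = ((w.take k).count O : ℕ) := by
  rw [height, ← count_true_bits, bits, bits, List.map_take]

lemma height_append_le {v w : List Bool} {k : ℕ} (hk : k ≤ v.length) :
    height (v ++ w) k = height v k := by
  rw [height, height, List.take_append_of_le_length hk]

lemma height_append_add (v w : List Bool) (k : ℕ) :
    height (v ++ w) (v.length + k) = v.count true + height w k := by
  simp [height, List.take_append, List.take_of_length_le]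

lemma height_succ (b : List Bool) (k : ℕ) :
    height b (k + 1) = height b k + if b[k]? = some true then 1 else 0 := by
  unfold height
  rw [List.take_add_one]
  rcases h : b[k]? with _ | c
  · simp
  · cases c <;> simp

lemma height_swap (v r : List Bool) : height (v ++ true :: false :: r) =
    Function.update (height (v ++ false :: true :: r)) (v.length + 1)
      (height (v ++ false :: true :: r) (v.length + 1) + 1) := by
  funext k
  by_cases h1 : k ≤ v.length
  · rw [Function.update_of_ne (by omega), height_append_le h1, height_append_le h1]
  · obtain ⟨j, rfl⟩ := Nat.exists_eq_add_of_lt (not_le.1 h1)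
    rw [add_assoc, height_append_add]
    rcases j with _ | j
    · rw [Function.update_self, height_append_add]
      simp [height]
    · rw [Function.update_of_ne (by omega), height_append_add]
      simp [height]

lemma length_eq_counts (w : List Letter) : w.length = w.count O + w.count B + w.count C := by
  induction w with
  | nil => rfl
  | cons l w ih => cases l <;> simp [ih] <;> omega

/-- In a prefix of a code `O` is at least as frequent as `B` and as `C`, so its length is at most
three times its number of letters `O`. -/
lemma IsCode.isLatticePath {n : ℕ} {w : List Letter} (h : IsCode n w) :
    IsLatticePath n (height (bits w)) := by
  have hl := h.length
  obtain ⟨hr, hc⟩ := isCode_iff.1 h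
  refine ⟨rfl, fun k => ?_, fun k hk => ?_, fun k hk => ?_⟩
  · rw [height_succ]
    split_ifs <;> omega
  · rw [height_bits, List.take_of_length_le (by omega), hc]
  · rw [height_bits]
    have h1 : run (w.take k ++ w.drop k) [] = some [] := by rwa [List.take_append_drop]
    rw [run_append] at h1
    obtain ⟨s, hs, -⟩ := Option.bind_eq_some_iff.1 h1
    have h2 := run_counts hs
    have h3 := length_eq_counts (w.take k)
    have h4 := List.count_le_length (a := true) (l := s)
    rw [List.length_take, min_eq_left (by omega)] at h3
    simp at h2
    omega

/-- Identifying `B` with `C` loses nothing: after an `O`, the first complete subtree is ended by `B`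
and the second by `C`. -/
lemma bits_enc_append_cons_inj {a b : TT} {r s : List Bool}
    (h : bits a.enc ++ false :: r = bits b.enc ++ false :: s) : a = b ∧ r = s := by
  induction a generalizing b r s with
  | nil =>
    cases b with
    | nil => simpa [enc, bits] using h
    | node => simp [enc, bits] at h
  | node a₁ a₂ a₃ h₁ h₂ h₃ =>
    cases b with
    | nil => simp [enc, bits] at h
    | node b₁ b₂ b₃ =>
      simp only [enc, bits_cons, bits_append, List.cons_append, List.append_assoc, List.cons.injEq,
        true_and, reduceCtorEq, decide_false] at h
      obtain ⟨rfl, e₁⟩ := h₁ h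
      obtain ⟨rfl, e₂⟩ := h₂ e₁
      obtain ⟨rfl, e₃⟩ := h₃ e₂
      exact ⟨rfl, e₃⟩

lemma eq_of_height_eq {b d : List Bool} (hl : b.length = d.length) (h : height b = height d) :
    b = d := by
  refine List.ext_getElem hl fun k h1 h2 => ?_
  have e1 := height_succ b k
  have e2 := height_succ d k
  rw [h, e2] at e1
  rw [List.getElem?_eq_getElem h1, List.getElem?_eq_getElem h2] at e1
  rcases hb : b[k] <;> rcases hd : d[k] <;> simp [hb, hd] at e1 ⊢

lemma IsCode.eq_of_height_eq {n : ℕ} {w w' : List Letter} (h : IsCode n w) (h' : IsCode n w')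
    (he : height (bits w) = height (bits w')) : w = w' := by
  have h1 := _root_.eq_of_height_eq (by rw [length_bits, length_bits, h.length, h'.length]) he
  obtain ⟨t, -, rfl⟩ := h
  obtain ⟨t', -, rfl⟩ := h'
  rw [(bits_enc_append_cons_inj (a := t) (b := t') (r := []) (s := []) (by rw [h1])).1]

/-- The lattice word of a sequence of trees. -/
def forestBits : List TT → List Bool
  | [] => []
  | t :: ts => bits t.enc ++ if ts = [] then [] else false :: forestBits ts

/-- A path descending from height `h` to 0 splits at its first passages to lower levels into `h + 1`
trees. An initial up-step raises the height by 2 and joins the first three trees of the remainder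
into one node. -/
lemma exists_forest (b : List Bool) (h : ℕ)
    (hpre : ∀ k ≤ b.length, k ≤ h + 3 * (b.take k).count true)
    (htot : b.length = h + 3 * b.count true) :
    ∃ ts : List TT, ts.length = h + 1 ∧ forestBits ts = b := by
  induction b generalizing h with
  | nil =>
    obtain rfl : h = 0 := by simp at htot; omega
    exact ⟨[TT.nil], rfl, rfl⟩
  | cons c b ih =>
    cases c with
    | false =>
      have h1 := hpre 1 (by simp)
      simp at h1
      obtain ⟨ts, hts, hb⟩ := ih (h - 1) (fun k hk => by
        have := hpre (k + 1) (by simpa using hk)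
        simp at this
        omega) (by simp at htot; omega)
      refine ⟨TT.nil :: ts, by simp; omega, ?_⟩
      have : ts ≠ [] := by
        rintro rfl
        simp at hts
      simp [forestBits, this, hb, enc, bits]
    | true =>
      obtain ⟨ts, hts, hb⟩ := ih (h + 2) (fun k hk => by
        have := hpre (k + 1) (by simpa using hk)
        simp at this
        omega) (by simp at htot; omega)
      rcases ts with _ | ⟨x, _ | ⟨y, _ | ⟨z, ts⟩⟩⟩
      · simp at hts
      · simp at hts
      · simp at hts
      · refine ⟨TT.node x y z :: ts, by simp at hts ⊢; omega, ?_⟩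
        rw [← hb]
        simp [forestBits, enc, bits_cons, bits_append]

lemma LatticePath.exists_code {n : ℕ} (x : LatticePath n) :
    ∃ w, IsCode n w ∧ height (bits w) = x.1 := by
  set b : List Bool := (List.range (3 * n)).map fun k => decide (x.1 k < x.1 (k + 1)) with hb
  have hbl : b.length = 3 * n := by simp [hb]
  have hh : ∀ k, height b k = x.1 k := by
    intro k
    induction k with
    | zero => exact x.2.1.symm
    | succ k ih =>
      rw [height_succ, ih]
      have h1 := x.2.2.1 k
      by_cases hk : k < 3 * n
      · have : b[k]? = some (decide (x.1 k < x.1 (k + 1))) := by simp [hb, hk]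
        rw [this]
        by_cases h2 : x.1 k < x.1 (k + 1)
        · simp [h2]; omega
        · simp [h2]; omega
      · have : b[k]? = none := List.getElem?_eq_none (by omega)
        rw [this, x.2.2.2.1 k (by omega), x.2.2.2.1 (k + 1) (by omega)]
        simp
  have hcount : b.count true = n := by
    have h1 := hh (3 * n)
    rw [x.2.2.2.1 _ le_rfl, height, List.take_of_length_le hbl.le] at h1
    exact_mod_cast h1
  obtain ⟨ts, hts, hf⟩ := exists_forest b 0 (fun k hk => by
    have h1 := x.2.2.2.2 k (by omega)
    rw [← hh k, height] at h1
    rw [zero_add]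
    exact_mod_cast h1) (by rw [hcount, hbl]; simp)
  obtain ⟨t, rfl⟩ := List.length_eq_one_iff.1 hts
  simp [forestBits] at hf
  refine ⟨t.enc, ⟨t, ?_, rfl⟩, by rw [hf]; exact funext hh⟩
  rw [← count_O_enc, ← count_true_bits, hf, hcount]

namespace LatticePath

/-- The code with a given lattice path. -/
noncomputable def code {n : ℕ} (x : LatticePath n) : List Letter := x.exists_code.choose

variable {n : ℕ}

lemma isCode_code (x : LatticePath n) : IsCode n x.code := x.exists_code.choose_spec.1

lemma height_code (x : LatticePath n) : height (bits x.code) = x.1 := x.exists_code.choose_spec.2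

lemma code_injective : Function.Injective (code (n := n)) := fun x y h =>
  Subtype.ext (by rw [← x.height_code, ← y.height_code, h])

lemma code_eq {x : LatticePath n} {w : List Letter} (hw : IsCode n w)
    (h : height (bits w) = x.1) : x.code = w :=
  x.isCode_code.eq_of_height_eq hw (by rw [x.height_code, h])

/-- The form of a path that can be raised at `j + 1`. -/
lemma exists_code_eq_of_lt_swap {x : LatticePath n} {j : ℕ} (hj : j + 1 < 3 * n)
    (h : x.1 (j + 1) < (x.swap j).1 (j + 1)) :
    ∃ (v : List Letter) (l : Letter) (a b : TT) (z : List Letter), v.length = j ∧ l ≠ O ∧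
      x.code = v ++ l :: O :: (a.enc ++ B :: (b.enc ++ C :: z)) ∧
      (x.swap j).code = v ++ O :: B :: (a.enc ++ C :: (b.enc ++ l :: z)) := by
  have hlo := x.lo_le hj
  have hhi := x.le_hi j
  have hhl := hi_le_lo_add_one x.1 j
  have hsw := swap_coe hj x
  rw [hsw, Function.update_self] at h
  have hval : lo x.1 j + hi x.1 j - x.1 (j + 1) = x.1 (j + 1) + 1 := by omega
  have h1 : x.1 (j + 1) = x.1 j := by
    have := (x.2.2.1 j).1
    have : hi x.1 j ≤ x.1 j + 1 := min_le_left _ _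
    omega
  have h2 : x.1 (j + 2) = x.1 (j + 1) + 1 := by
    have := (x.2.2.1 (j + 1)).2
    have : hi x.1 j ≤ x.1 (j + 2) := min_le_right _ _
    have e : j + 1 + 1 = j + 2 := rfl
    rw [e] at *
    omega
  have hlen := x.isCode_code.length
  obtain ⟨v, l, m, r, hv, hw⟩ : ∃ (v : List Letter) (l m : Letter) (r : List Letter),
      v.length = j ∧ x.code = v ++ l :: m :: r := by
    refine ⟨x.code.take j, x.code[j], x.code[j + 1], x.code.drop (j + 2), by simp; omega, ?_⟩
    rw [List.getElem_cons_drop, List.getElem_cons_drop, List.take_append_drop]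
  have hlO : l ≠ O := by
    rintro rfl
    have h3 := height_succ (bits x.code) j
    rw [x.height_code, h1, hw] at h3
    simp [bits_append, bits_cons, ← hv, length_bits] at h3
  have hmO : m = O := by
    by_contra hm
    have h3 := height_succ (bits x.code) (j + 1)
    have e : j + 1 + 1 = j + 2 := rfl
    rw [x.height_code, e, h2, hw] at h3
    simp [bits_append, bits_cons, ← hv, length_bits, hm] at h3
  subst hmO
  have hcode := x.isCode_code
  rw [hw] at hcode
  obtain ⟨a, b, z, rfl⟩ := IsCode.exists_after_O (v := v ++ [l]) (by simpa using hcode)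
  -- After the exchange the node at `O` has an empty first subtree: the exchanged bit is read as
  -- `B`, the separator after `a` as `C`, and the one after `b` takes over the role of `l`.
  refine ⟨v, l, a, b, z, hv, hlO, hw, code_eq ?_ ?_⟩
  · refine hcode.congr (fun s hs => ?_) (by cases l <;> simp at hlO ⊢)
    rcases s with _ | ⟨_ | _, s⟩ <;> cases l <;> simp [run] at hs hlO ⊢ <;> exact hs
  · have e1 : bits (v ++ O :: B :: (a.enc ++ C :: (b.enc ++ l :: z))) =
        bits v ++ true :: false :: (bits a.enc ++ false :: (bits b.enc ++ false :: bits z)) := by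
      simp [bits_append, bits_cons, hlO]
    have e2 : bits x.code =
        bits v ++ false :: true :: (bits a.enc ++ false :: (bits b.enc ++ false :: bits z)) := by
      rw [hw]
      simp [bits_append, bits_cons, hlO]
    rw [e1, height_swap, ← e2, x.height_code, hsw, length_bits, hv, hval]

/-- The sum over all transpositions is bounded by the cost of flips. -/
lemma sum_sq_swap_le (hn : 1 ≤ n) {F : List Letter → ℝ} {M : Marked → ℝ}
    (hM : Marked.Dominates n F M) :
    ∑ j ∈ Finset.range (3 * n - 1), ∑ x : LatticePath n, (F x.code - F (x.swap j).code) ^ 2 ≤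
      156 * (n : ℝ) ^ 2 * ∑ z ∈ splits n [C], M z := by
  classical
  -- The swap is an involution, so the paths that it raises account for half of the sum; fixed paths
  -- contribute nothing.
  have hhalf : ∀ j, ∑ x : LatticePath n, (F x.code - F (x.swap j).code) ^ 2 ≤
      2 * ∑ x : LatticePath n, if x.1 (j + 1) < (x.swap j).1 (j + 1) then
        (F x.code - F (x.swap j).code) ^ 2 else 0 := by
    intro j
    have h1 : ∑ x : LatticePath n, (if x.1 (j + 1) < (x.swap j).1 (j + 1) then
        (F x.code - F (x.swap j).code) ^ 2 else 0) =
        ∑ x : LatticePath n, if (x.swap j).1 (j + 1) < x.1 (j + 1) then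
          (F x.code - F (x.swap j).code) ^ 2 else 0 := by
      rw [← Equiv.sum_comp (swap_involutive j).toPerm]
      refine Finset.sum_congr rfl fun x _ => ?_
      simp only [Function.Involutive.coe_toPerm, swap_involutive j x]
      rw [← neg_sub, neg_sq]
    rw [two_mul]
    nth_rewrite 2 [h1]
    rw [← Finset.sum_add_distrib]
    refine Finset.sum_le_sum fun x _ => ?_
    rcases lt_trichotomy (x.1 (j + 1)) ((x.swap j).1 (j + 1)) with h | h | h
    · simp [h, h.not_gt]
    · have : x.swap j = x := by
        by_cases hj : j + 1 < 3 * n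
        · apply Subtype.ext
          have h2 := swap_coe hj x
          have h3 := h
          rw [h2, Function.update_self] at h3
          rw [h2, ← h3, Function.update_eq_self]
        · simp [swap, hj]
      simp [this]
    · simp [h, h.not_gt]
  set A : Finset (ℕ × LatticePath n) :=
    (Finset.range (3 * n - 1) ×ˢ Finset.univ).filter
      fun p => p.2.1 (p.1 + 1) < (p.2.swap p.1).1 (p.1 + 1) with hA
  have hform : ∀ p : ℕ × LatticePath n, ∃ (v : List Letter) (l : Letter) (a b : TT)
      (z : List Letter), p ∈ A → v.length = p.1 ∧ l ≠ O ∧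
      p.2.code = v ++ l :: O :: (a.enc ++ B :: (b.enc ++ C :: z)) ∧
      (p.2.swap p.1).code = v ++ O :: B :: (a.enc ++ C :: (b.enc ++ l :: z)) := by
    intro p
    by_cases hp : p ∈ A
    · simp only [hA, Finset.mem_filter, Finset.mem_product, Finset.mem_range, Finset.mem_univ,
        and_true] at hp
      obtain ⟨v, l, a, b, z, h⟩ := exists_code_eq_of_lt_swap (by omega) hp.2
      exact ⟨v, l, a, b, z, fun _ => h⟩
    · exact ⟨[], B, nil, nil, [], fun h => absurd h hp⟩
  choose v l a b z hv using hform
  have hparse : ∀ (m : Letter) (p : List Letter × List Letter), ∃ w : List Letter,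
      ∀ (a b : TT) (z : List Letter), p.2 = a.enc ++ B :: (b.enc ++ C :: z) →
        w = p.1 ++ O :: B :: (a.enc ++ C :: (b.enc ++ m :: z)) := by
    intro m p
    by_cases h : ∃ (a b : TT) (z : List Letter), p.2 = a.enc ++ B :: (b.enc ++ C :: z)
    · obtain ⟨a, b, z, h⟩ := h
      refine ⟨p.1 ++ O :: B :: (a.enc ++ C :: (b.enc ++ m :: z)), fun a' b' z' h' => ?_⟩
      rw [h] at h'
      obtain ⟨rfl, -, h'⟩ := enc_append_cons_inj (by decide) (by decide) h'
      obtain ⟨rfl, -, rfl⟩ := enc_append_cons_inj (by decide) (by decide) h'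
      rfl
    · exact ⟨[], fun a b z h' => absurd ⟨a, b, z, h'⟩ h⟩
  choose t ht using hparse
  have hpart : ∀ m : Letter,
      ∑ p ∈ A.filter (fun p => l p = m), (F p.2.code - F (p.2.swap p.1).code) ^ 2 ≤
        ∑ q ∈ splits n [m, O], (F (q.1 ++ m :: O :: q.2) - F (t m q)) ^ 2 := by
    intro m
    have h1 := sum_comp_le_of_injOn (s := A.filter (fun p => l p = m)) (t := splits n [m, O])
      (fun p => (v p, (a p).enc ++ B :: ((b p).enc ++ C :: z p))) ?_ ?_
      (fun q => (F (q.1 ++ m :: O :: q.2) - F (t m q)) ^ 2) (fun _ => sq_nonneg _)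
    · refine le_trans (Finset.sum_le_sum fun p hp => ?_) h1
      obtain ⟨hp, hm⟩ := Finset.mem_filter.1 hp
      obtain ⟨-, -, h3, h4⟩ := hv p hp
      simp only
      rw [h3, h4, ht m _ _ _ _ rfl, hm]
    · intro p hp q hq heq
      simp only [Finset.coe_filter, Set.mem_ofPred_eq] at hp hq
      simp only [Prod.mk.injEq] at heq
      obtain ⟨h1, -, h3, -⟩ := hv p hp.1
      obtain ⟨h1', -, h3', -⟩ := hv q hq.1
      refine Prod.ext (by rw [← h1, ← h1', heq.1]) (code_injective ?_)
      rw [h3, h3', heq.1, heq.2, hp.2, hq.2]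
    · intro p hp
      obtain ⟨hp, hm⟩ := Finset.mem_filter.1 hp
      obtain ⟨-, -, h3, -⟩ := hv p hp
      have := p.2.isCode_code
      rw [h3, hm] at this
      exact mem_splits.2 this
  have hB := (hpart B).trans (hM.sum_raise_B_le (t B) fun v z x y => ht B _ x y z rfl)
  have hC := (hpart C).trans (hM.sum_raise_C_le hn (t C) fun v z x y => ht C _ x y z rfl)
  have hsum : ∑ j ∈ Finset.range (3 * n - 1), ∑ x : LatticePath n,
      (if x.1 (j + 1) < (x.swap j).1 (j + 1) then (F x.code - F (x.swap j).code) ^ 2 else 0) =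
      ∑ p ∈ A.filter (fun p => l p = B), (F p.2.code - F (p.2.swap p.1).code) ^ 2 +
        ∑ p ∈ A.filter (fun p => l p = C), (F p.2.code - F (p.2.swap p.1).code) ^ 2 := by
    rw [← Finset.sum_product', ← Finset.sum_filter, ← hA,
      ← Finset.sum_filter_add_sum_filter_not A (fun p => l p = B)]
    congr 2
    ext p
    simp only [Finset.mem_filter]
    refine and_congr_right fun hp => ?_
    have := (hv p hp).2.1
    cases h : l p <;> simp_all
  refine (Finset.sum_le_sum fun j _ => hhalf j).trans ?_
  -- The constant is `2 (18 + 60) = 156`.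
  rw [← Finset.mul_sum, hsum]
  linarith

end LatticePath

/-- The finite set of codes. -/
noncomputable def codes (n : ℕ) : Finset (List Letter) :=
  Finset.univ.map ⟨LatticePath.code (n := n), LatticePath.code_injective⟩

lemma mem_codes {n : ℕ} {w : List Letter} : w ∈ codes n ↔ IsCode n w := by
  simp only [codes, Finset.mem_map, Finset.mem_univ, true_and, Function.Embedding.coeFn_mk]
  constructor
  · rintro ⟨x, rfl⟩
    exact x.isCode_code
  · intro h
    exact ⟨⟨_, h.isLatticePath⟩, LatticePath.code_eq h rfl⟩

/-- Poincaré inequality for flips of codes. -/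
theorem codes_poincare {n : ℕ} (hn : 1 ≤ n) {F : List Letter → ℝ} {M : Marked → ℝ}
    (hM : Marked.Dominates n F M) (h0 : ∑ w ∈ codes n, F w = 0) :
    ∑ w ∈ codes n, F w ^ 2 ≤ 88 * (n : ℝ) ^ 4 * ∑ z ∈ splits n [C], M z := by
  simp only [codes, Finset.sum_map, Function.Embedding.coeFn_mk] at h0 ⊢
  have h1 := LatticePath.poincare hn (fun x => F x.code) h0
  have h2 := LatticePath.sum_sq_swap_le hn hM
  have h3 := mul_le_mul_of_nonneg_left h2 (sq_nonneg ((3 * n : ℕ) : ℝ))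
  have hS : 0 ≤ (n : ℝ) ^ 4 * ∑ z ∈ splits n [C], M z :=
    mul_nonneg (by positivity) (Finset.sum_nonneg fun z _ => hM.1 z)
  -- `9 n² · 156 n² / 16 = 87.75 n⁴`.
  push_cast at h1 h3
  nlinarith

/-! ### Non-crossing trees on intervals of integers -/

namespace TT

lemma arcs_range {t : TT} {s x y : ℕ} (h : (x, y) ∈ t.arcs s) : s ≤ x ∧ x < y ∧ y ≤ s + t.size := by
  induction t generalizing s with
  | nil => simp [arcs] at h
  | node a b c ha hb hc =>
    simp only [arcs, List.mem_append, List.mem_cons, Prod.mk.injEq] at h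
    simp only [size]
    rcases h with h | h | ⟨rfl, rfl⟩ | h
    · have := ha h; omega
    · have := hb h; omega
    · omega
    · have := hc h; omega

lemma arcs_conn {t : TT} {s : ℕ} {φ : ℕ → Prop} (h : ∀ x y, (x, y) ∈ t.arcs s → (φ x ↔ φ y)) {v : ℕ}
    (h1 : s ≤ v) (h2 : v ≤ s + t.size) : φ v ↔ φ s := by
  induction t generalizing s v with
  | nil =>
    obtain rfl : v = s := by simp [size] at h2; omega
    rfl
  | node a b c ha hb hc =>
    simp only [arcs, List.mem_append, List.mem_cons, Prod.mk.injEq] at h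
    simp only [size] at h2
    have e1 := h s (s + a.size + 1 + b.size) (by simp)
    have hb' : ∀ v, s + a.size + 1 ≤ v → v ≤ s + a.size + 1 + b.size → (φ v ↔ φ (s + a.size + 1)) :=
      fun v h3 h4 => hb (fun x y hxy => h x y (by simp [hxy])) h3 h4
    have hc' : ∀ v, s + a.size + 1 + b.size ≤ v → v ≤ s + a.size + 1 + b.size + c.size →
        (φ v ↔ φ (s + a.size + 1 + b.size)) :=
      fun v h3 h4 => hc (fun x y hxy => h x y (by simp [hxy])) h3 h4
    by_cases h3 : v ≤ s + a.size
    · exact ha (fun x y hxy => h x y (by simp [hxy])) h1 h3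
    · have e2 := hb' (s + a.size + 1 + b.size) (by omega) le_rfl
      by_cases h4 : v ≤ s + a.size + 1 + b.size
      · rw [hb' v (by omega) h4, ← e2, ← e1]
      · rw [hc' v (by omega) (by omega), ← e1]

/-- A colouring for an edge inside a subtree is extended by a constant, its value at the vertex
where that subtree is attached. For the root edge, the cut is between the parts `a` and `b`. -/
lemma arcs_bridge {t : TT} {s x y : ℕ} (h : (x, y) ∈ t.arcs s) :
    ∃ φ : ℕ → Prop, φ x ∧ ¬ φ y ∧
      ∀ u v, (u, v) ∈ t.arcs s → (u, v) ≠ (x, y) → (φ u ↔ φ v) := by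
  induction t generalizing s with
  | nil => simp [arcs] at h
  | node a b c ha hb hc =>
    have ra : ∀ {x y}, (x, y) ∈ a.arcs s → s ≤ x ∧ x < y ∧ y ≤ s + a.size := arcs_range
    have rb : ∀ {x y}, (x, y) ∈ b.arcs (s + a.size + 1) →
      s + a.size + 1 ≤ x ∧ x < y ∧ y ≤ s + a.size + 1 + b.size := arcs_range
    have rc : ∀ {x y}, (x, y) ∈ c.arcs (s + a.size + 1 + b.size) →
      s + a.size + 1 + b.size ≤ x ∧ x < y ∧ y ≤ s + a.size + 1 + b.size + c.size := arcs_range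
    simp only [arcs, List.mem_append, List.mem_cons, Prod.mk.injEq] at h ⊢
    rcases h with h | h | ⟨rfl, rfl⟩ | h
    · obtain ⟨φ, h1, h2, h3⟩ := ha h
      refine ⟨fun v => if v ≤ s + a.size then φ v else φ s, ?_, ?_, ?_⟩
      · have := ra h
        simpa [show x ≤ s + a.size by omega] using h1
      · have := ra h
        simpa [show y ≤ s + a.size by omega] using h2
      · rintro u v (huv | huv | ⟨rfl, rfl⟩ | huv) hne
        · have := ra huv
          simpa [show u ≤ s + a.size by omega, show v ≤ s + a.size by omega] using h3 u v huv hne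
        · have := rb huv
          simp [show ¬ u ≤ s + a.size by omega, show ¬ v ≤ s + a.size by omega]
        · simp [show ¬ u + a.size + 1 + b.size ≤ u + a.size by omega]
        · have := rc huv
          simp [show ¬ u ≤ s + a.size by omega, show ¬ v ≤ s + a.size by omega]
    · obtain ⟨φ, h1, h2, h3⟩ := hb h
      refine ⟨fun v => if s + a.size + 1 ≤ v ∧ v ≤ s + a.size + 1 + b.size then φ v
        else φ (s + a.size + 1 + b.size), ?_, ?_, ?_⟩
      · have := rb h
        simpa [show s + a.size + 1 ≤ x ∧ x ≤ s + a.size + 1 + b.size by omega] using h1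
      · have := rb h
        simpa [show s + a.size + 1 ≤ y ∧ y ≤ s + a.size + 1 + b.size by omega] using h2
      · rintro u v (huv | huv | ⟨rfl, rfl⟩ | huv) hne
        · have := ra huv
          beta_reduce
          rw [if_neg (by omega), if_neg (by omega)]
        · have := rb huv
          beta_reduce
          rw [if_pos (by omega), if_pos (by omega)]
          exact h3 u v huv hne
        · beta_reduce
          rw [if_neg (by omega), if_pos (by omega)]
        · have := rc huv
          beta_reduce
          rw [if_neg (c := s + a.size + 1 ≤ v ∧ v ≤ s + a.size + 1 + b.size) (by omega)]
          by_cases hu : u = s + a.size + 1 + b.size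
          · subst hu
            rw [if_pos (by omega)]
          · rw [if_neg (by omega)]
    · refine ⟨fun v => v ≤ x + a.size, by omega, by omega, ?_⟩
      rintro u v (huv | huv | ⟨rfl, rfl⟩ | huv) hne
      · have := ra huv; omega
      · have := rb huv; omega
      · exact absurd rfl hne
      · have := rc huv; omega
    · obtain ⟨φ, h1, h2, h3⟩ := hc h
      refine ⟨fun v => if s + a.size + 1 + b.size ≤ v then φ v
        else φ (s + a.size + 1 + b.size), ?_, ?_, ?_⟩
      · have := rc h
        simpa [show s + a.size + 1 + b.size ≤ x by omega] using h1
      · have := rc h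
        simpa [show s + a.size + 1 + b.size ≤ y by omega] using h2
      · rintro u v (huv | huv | ⟨rfl, rfl⟩ | huv) hne
        · have := ra huv
          beta_reduce
          rw [if_neg (by omega), if_neg (by omega)]
        · have := rb huv
          beta_reduce
          rw [if_neg (by omega)]
          by_cases hv : v = s + a.size + 1 + b.size
          · subst hv
            rw [if_pos (by omega)]
          · rw [if_neg (by omega)]
        · beta_reduce
          rw [if_neg (by omega), if_pos (by omega)]
        · have := rc huv
          beta_reduce
          rw [if_pos (by omega), if_pos (by omega)]
          exact h3 u v huv hne

lemma arcs_noncrossing {t : TT} {s x y u v : ℕ} (h : (x, u) ∈ t.arcs s) (h' : (y, v) ∈ t.arcs s)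
    (hxy : x < y) (hyu : y < u) (huv : u < v) : False := by
  induction t generalizing s with
  | nil => simp [arcs] at h
  | node a b c ha hb hc =>
    have ra : ∀ {x y}, (x, y) ∈ a.arcs s → s ≤ x ∧ x < y ∧ y ≤ s + a.size := arcs_range
    have rb : ∀ {x y}, (x, y) ∈ b.arcs (s + a.size + 1) →
      s + a.size + 1 ≤ x ∧ x < y ∧ y ≤ s + a.size + 1 + b.size := arcs_range
    have rc : ∀ {x y}, (x, y) ∈ c.arcs (s + a.size + 1 + b.size) →
      s + a.size + 1 + b.size ≤ x ∧ x < y ∧ y ≤ s + a.size + 1 + b.size + c.size := arcs_range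
    simp only [arcs, List.mem_append, List.mem_cons, Prod.mk.injEq] at h h'
    rcases h with h | h | ⟨rfl, rfl⟩ | h <;> rcases h' with h' | h' | ⟨rfl, rfl⟩ | h' <;>
      first
      | exact ha h h'
      | exact hb h h'
      | exact hc h h'
      | (try have r1 := ra h
         try have r2 := rb h
         try have r3 := rc h
         try have r4 := ra h'
         try have r5 := rb h'
         try have r6 := rc h'
         omega)

lemma arcs_nodup (t : TT) (s : ℕ) : (t.arcs s).Nodup := by
  induction t generalizing s with
  | nil => simp [arcs]
  | node a b c ha hb hc =>
    have ra : ∀ {x y}, (x, y) ∈ a.arcs s → s ≤ x ∧ x < y ∧ y ≤ s + a.size := arcs_range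
    have rb : ∀ {x y}, (x, y) ∈ b.arcs (s + a.size + 1) →
      s + a.size + 1 ≤ x ∧ x < y ∧ y ≤ s + a.size + 1 + b.size := arcs_range
    have rc : ∀ {x y}, (x, y) ∈ c.arcs (s + a.size + 1 + b.size) →
      s + a.size + 1 + b.size ≤ x ∧ x < y ∧ y ≤ s + a.size + 1 + b.size + c.size := arcs_range
    simp only [arcs]
    refine List.Nodup.append (ha s) (List.Nodup.append (hb _) (List.nodup_cons.2 ⟨?_, hc _⟩) ?_) ?_
    · intro h
      have := rc h
      omega
    · rintro ⟨x, y⟩ h h'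
      have h1 := rb h
      rcases List.mem_cons.1 h' with h' | h'
      · simp only [Prod.mk.injEq] at h'
        omega
      · have := rc h'
        omega
    · rintro ⟨x, y⟩ h h'
      have h1 := ra h
      rcases List.mem_append.1 h' with h' | h'
      · have := rb h'
        omega
      · rcases List.mem_cons.1 h' with h' | h'
        · simp only [Prod.mk.injEq] at h'
          omega
        · have := rc h'
          omega

/-- The root edge is the longest one at `s`, which fixes its right end. The size of `a` is fixed
because the interval of `a` is connected by its own arcs, while only the root edge passes over the
gap behind it. -/
lemma arcs_inj {t t' : TT} {s : ℕ} (hsize : t.size = t'.size)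
    (h : ∀ x y, (x, y) ∈ t.arcs s ↔ (x, y) ∈ t'.arcs s) : t = t' := by
  induction t generalizing t' s with
  | nil =>
    cases t' with
    | nil => rfl
    | node => simp [size] at hsize
  | node a b c ha hb hc =>
    cases t' with
    | nil => simp [size] at hsize
    | node a' b' c' =>
      have ra : ∀ {x y}, (x, y) ∈ a.arcs s → s ≤ x ∧ x < y ∧ y ≤ s + a.size := arcs_range
      have rb : ∀ {x y}, (x, y) ∈ b.arcs (s + a.size + 1) →
        s + a.size + 1 ≤ x ∧ x < y ∧ y ≤ s + a.size + 1 + b.size := arcs_range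
      have rc : ∀ {x y}, (x, y) ∈ c.arcs (s + a.size + 1 + b.size) →
        s + a.size + 1 + b.size ≤ x ∧ x < y ∧ y ≤ s + a.size + 1 + b.size + c.size := arcs_range
      have ra' : ∀ {x y}, (x, y) ∈ a'.arcs s → s ≤ x ∧ x < y ∧ y ≤ s + a'.size := arcs_range
      have rb' : ∀ {x y}, (x, y) ∈ b'.arcs (s + a'.size + 1) →
        s + a'.size + 1 ≤ x ∧ x < y ∧ y ≤ s + a'.size + 1 + b'.size := arcs_range
      have rc' : ∀ {x y}, (x, y) ∈ c'.arcs (s + a'.size + 1 + b'.size) →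
        s + a'.size + 1 + b'.size ≤ x ∧ x < y ∧ y ≤ s + a'.size + 1 + b'.size + c'.size :=
        arcs_range
      simp only [arcs, List.mem_append, List.mem_cons, Prod.mk.injEq] at h
      simp only [size] at hsize
      have k1 : s + a.size + 1 + b.size = s + a'.size + 1 + b'.size := by
        rcases (h s (s + a.size + 1 + b.size)).1 (by simp) with e | e | e | e
        · rcases (h s (s + a'.size + 1 + b'.size)).2 (by simp) with e' | e' | e' | e'
          · have := ra e'; have := ra' e; omega
          · have := rb e'; omega
          · omega
          · have := rc e'; omega
        · have := rb' e; omega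
        · omega
        · have := rc' e; omega
      have no_lt : ∀ {a b c a' b' c' : TT},
          (∀ x y, (x, y) ∈ a'.arcs s → (x, y) ∈ a.arcs s ∨ (x, y) ∈ b.arcs (s + a.size + 1) ∨
            (x = s ∧ y = s + a.size + 1 + b.size) ∨
            (x, y) ∈ c.arcs (s + a.size + 1 + b.size)) →
          s + a.size + 1 + b.size = s + a'.size + 1 + b'.size → ¬ a.size < a'.size := by
        intro a b c a' b' c' h k1 hlt
        have := arcs_conn (t := a') (s := s) (φ := fun v => v ≤ s + a.size) (fun x y hxy => by
          have h1 := arcs_range hxy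
          rcases h x y hxy with e | e | e | e
          · have := arcs_range e; omega
          · have := arcs_range e; omega
          · omega
          · have := arcs_range e; omega) (v := s + a.size + 1) (by omega) (by omega)
        omega
      have hsa : a.size = a'.size := by
        have h1 := no_lt (a := a) (b := b) (c := c) (a' := a') (b' := b') (c' := c')
          (fun x y hxy => (h x y).2 (Or.inl hxy)) k1
        have h2 := no_lt (a := a') (b := b') (c := c') (a' := a) (b' := b) (c' := c)
          (fun x y hxy => (h x y).1 (Or.inl hxy)) k1.symm
        omega
      have hsb : b.size = b'.size := by omega
      have hsc : c.size = c'.size := by omega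
      rw [← hsa, ← hsb] at h
      rw [← hsa] at rb'
      rw [← hsa, ← hsb] at rc'
      have ea : a = a' := ha hsa fun x y => by
        constructor
        · intro hxy
          have h1 := ra hxy
          rcases (h x y).1 (Or.inl hxy) with e | e | e | e
          · exact e
          · have := rb' e; omega
          · omega
          · have := rc' e; omega
        · intro hxy
          have h1 := ra' hxy
          rcases (h x y).2 (Or.inl hxy) with e | e | e | e
          · exact e
          · have := rb e; omega
          · omega
          · have := rc e; omega
      have eb : b = b' := hb (s := s + a.size + 1) hsb fun x y => by
        constructor
        · intro hxy
          have h1 := rb hxy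
          rcases (h x y).1 (Or.inr (Or.inl hxy)) with e | e | e | e
          · have := ra' e; omega
          · exact e
          · omega
          · have := rc' e; omega
        · intro hxy
          have h1 := rb' hxy
          rcases (h x y).2 (Or.inr (Or.inl hxy)) with e | e | e | e
          · have := ra e; omega
          · exact e
          · omega
          · have := rc e; omega
      have ec : c = c' := hc (s := s + a.size + 1 + b.size) hsc fun x y => by
        constructor
        · intro hxy
          have h1 := rc hxy
          rcases (h x y).1 (Or.inr (Or.inr (Or.inr hxy))) with e | e | e | e
          · have := ra' e; omega
          · have := rb' e; omega
          · omega
          · exact e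
        · intro hxy
          have h1 := rc' hxy
          rcases (h x y).2 (Or.inr (Or.inr (Or.inr hxy))) with e | e | e | e
          · have := ra e; omega
          · have := rb e; omega
          · omega
          · exact e
      rw [ea, eb, ec]

end TT

/-- The relation `A` on pairs `x < y` of `s, …, s + n` is a non-crossing tree. Connectedness and
acyclicity are expressed by two-colourings of the vertices. -/
structure IsNCTree (A : ℕ → ℕ → Prop) (s n : ℕ) : Prop where
  range : ∀ {x y}, A x y → s ≤ x ∧ x < y ∧ y ≤ s + n
  noncrossing : ∀ {x y u v}, A x u → A y v → x < y → y < u → u < v → False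
  conn : ∀ φ : ℕ → Prop, (∀ x y, A x y → (φ x ↔ φ y)) → ∀ v, s ≤ v → v ≤ s + n → (φ v ↔ φ s)
  bridge : ∀ {x y}, A x y → ∃ φ : ℕ → Prop, φ x ∧ ¬ φ y ∧
    ∀ u v, A u v → (u, v) ≠ (x, y) → (φ u ↔ φ v)

lemma TT.isNCTree (t : TT) (s : ℕ) : IsNCTree (fun x y => (x, y) ∈ t.arcs s) s t.size where
  range := arcs_range
  noncrossing := arcs_noncrossing
  conn _ h _ h1 h2 := arcs_conn h h1 h2
  bridge := arcs_bridge

/-- A connected part of a non-crossing tree on an interval is a non-crossing tree. -/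
lemma IsNCTree.restrict {A : ℕ → ℕ → Prop} {s n : ℕ} (hA : IsNCTree A s n) (s' n' : ℕ)
    (hconn : ∀ φ : ℕ → Prop, (∀ x y, A x y → s' ≤ x → y ≤ s' + n' → (φ x ↔ φ y)) →
      ∀ v, s' ≤ v → v ≤ s' + n' → (φ v ↔ φ s')) :
    IsNCTree (fun x y => A x y ∧ s' ≤ x ∧ y ≤ s' + n') s' n' where
  range h := ⟨h.2.1, (hA.range h.1).2.1, h.2.2⟩
  noncrossing h h' := hA.noncrossing h.1 h'.1
  conn φ h := hconn φ fun x y hxy h1 h2 => h x y ⟨hxy, h1, h2⟩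
  bridge h := by
    obtain ⟨φ, h1, h2, h3⟩ := hA.bridge h.1
    exact ⟨φ, h1, h2, fun u v huv => h3 u v huv.1⟩

/-- Every non-crossing tree is encoded by a ternary tree. -/
theorem IsNCTree.exists_tree {A : ℕ → ℕ → Prop} {s n : ℕ} (hA : IsNCTree A s n) :
    ∃ t : TT, t.size = n ∧ ∀ x y, (x, y) ∈ t.arcs s ↔ A x y := by
  classical
  induction n using Nat.strong_induction_on generalizing A s with
  | _ n ih =>
  rcases Nat.eq_zero_or_pos n with rfl | hn
  · refine ⟨nil, rfl, fun x y => ?_⟩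
    simp only [arcs, List.not_mem_nil, false_iff]
    intro h
    have := hA.range h
    omega
  obtain ⟨y₀, hy₀⟩ : ∃ y, A s y := by
    by_contra! hc
    have := hA.conn (fun v => v = s) (fun x y hxy => by
      have := hA.range hxy
      have : x ≠ s := by
        rintro rfl
        exact hc _ hxy
      omega) (s + 1) (by omega) (by omega)
    omega
  -- The root edge is the longest edge at `s`; the colouring `φ` tells the two sides of the tree
  -- apart once it is removed.
  obtain ⟨k, hk, hmax⟩ : ∃ k, A s k ∧ ∀ y, A s y → y ≤ k := by
    refine ⟨Nat.findGreatest (A s) (s + n), Nat.findGreatest_spec (hA.range hy₀).2.2 hy₀,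
      fun y hy => Nat.le_findGreatest (hA.range hy).2.2 hy⟩
  have rk := hA.range hk
  obtain ⟨φ, hφs, hφk, hφ⟩ := hA.bridge hk
  have hside : ∀ {x y}, A x y → y ≤ k ∨ k ≤ x := by
    intro x y hxy
    by_contra! hc
    have h1 := hA.range hxy
    rcases h1.1.eq_or_lt with rfl | h2
    · have := hmax y hxy
      omega
    · exact hA.noncrossing hk hxy h2 hc.2 hc.1
  -- Below `k`, the side of `s` is an initial segment. Otherwise, by connectedness, an edge `p q` of
  -- that side passes over a vertex `x` of the other side. By non-crossing, the vertices of the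
  -- other side strictly between `p` and `q` have no edges leaving them, which contradicts
  -- connectedness.
  have hinit : ∀ x y, s < x → x < y → y < k → ¬ φ x → φ y → False := by
    intro x y hsx hxy hyk hφx hφy
    obtain ⟨p, q, hpq, hp, hq, hpx, hxq⟩ : ∃ p q, A p q ∧ φ p ∧ φ q ∧ p < x ∧ x < q := by
      by_contra! hc
      have h1 := hA.conn (fun v => φ v ∧ x < v) (fun u v huv => by
        have hne : u < v := (hA.range huv).2.1
        by_cases he : (u, v) = (s, k)
        · simp only [Prod.mk.injEq] at he
          obtain ⟨rfl, rfl⟩ := he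
          constructor
          · rintro ⟨-, h⟩; omega
          · rintro ⟨h, -⟩; exact absurd h hφk
        · have h2 := hφ u v huv he
          by_cases hu : φ u
          · have hv := h2.1 hu
            have h3 := hc u v huv hu hv
            have h4 : u ≠ x := by rintro rfl; exact hφx hu
            simp only [hu, hv, true_and]
            constructor
            · intro h; omega
            · intro h
              by_contra h5
              have := h3 (by omega)
              omega
          · have hv : ¬ φ v := fun h => hu (h2.2 h)
            simp [hu, hv]) y (by omega) (by omega)
      have := (h1.1 ⟨hφy, hxy⟩).2
      omega
    have hqk : q < k := by
      rcases hside hpq with h | h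
      · rcases h.eq_or_lt with rfl | h
        · exact absurd hq hφk
        · exact h
      · omega
    have h1 := hA.conn (fun v => ¬ φ v ∧ p < v ∧ v < q) (fun u v huv => by
      by_cases he : (u, v) = (s, k)
      · simp only [Prod.mk.injEq] at he
        obtain ⟨rfl, rfl⟩ := he
        constructor
        · rintro ⟨h, -⟩; exact absurd hφs h
        · rintro ⟨-, -, h⟩; omega
      · have h2 := hφ u v huv he
        by_cases hu : φ u
        · simp [hu, h2.1 hu]
        · have hv : ¬ φ v := fun h => hu (h2.2 h)
          have n1 : u ≠ p := by rintro rfl; exact hu hp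
          have n2 : u ≠ q := by rintro rfl; exact hu hq
          have n3 : v ≠ p := by rintro rfl; exact hv hp
          have n4 : v ≠ q := by rintro rfl; exact hv hq
          have h3 := (hA.range huv).2.1
          have c1 := hA.noncrossing huv hpq
          have c2 := hA.noncrossing hpq huv
          simp only [hu, hv, not_false_eq_true, true_and]
          constructor
          · intro h
            by_contra h'
            exact c2 h.1 h.2 (by omega)
          · intro h
            by_contra h'
            exact c1 (by omega) h.1 h.2) x (by omega) (by omega)
    exact (h1.1 ⟨hφx, hpx, hxq⟩).1 hφs
  obtain ⟨j, hsj, hjk, hjt, hjf⟩ : ∃ j, s ≤ j ∧ j < k ∧ (∀ v, s ≤ v → v ≤ j → φ v) ∧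
      ∀ v, j < v → v ≤ k → ¬ φ v := by
    set j := Nat.findGreatest (fun v => φ v) (k - 1) with hj
    have h1 : s ≤ j := Nat.le_findGreatest (by omega) hφs
    have h2 : j ≤ k - 1 := Nat.findGreatest_le _
    have h3 : φ j := Nat.findGreatest_spec (P := fun v => φ v) (by omega : s ≤ k - 1) hφs
    refine ⟨j, h1, by omega, fun v hv1 hv2 => ?_, fun v hv1 hv2 hv => ?_⟩
    · by_contra hv
      have e1 : v ≠ s := by rintro rfl; exact hv hφs
      have e2 : v ≠ j := by intro h; rw [h] at hv; exact hv h3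
      exact hinit v j (by omega) (by omega) (by omega) hv h3
    · rcases hv2.eq_or_lt with rfl | hv2
      · exact hφk hv
      · have := Nat.le_findGreatest (P := fun v => φ v) (by omega : v ≤ k - 1) hv
        omega
  have hcut : ∀ {x y}, A x y → y ≤ k → y ≤ j ∨ j < x ∨ (x = s ∧ y = k) := by
    intro x y hxy hyk
    by_contra! hc
    have h1 := hA.range hxy
    have h2 := hφ x y hxy (by
      simp only [ne_eq, Prod.mk.injEq, not_and]
      exact hc.2.2)
    exact hjf y hc.1 hyk (h2.1 (hjt x h1.1 hc.2.1))
  have ka : IsNCTree (fun x y => A x y ∧ s ≤ x ∧ y ≤ s + (j - s)) s (j - s) := by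
    refine hA.restrict s (j - s) fun ψ hψ v h1 h2 => ?_
    have := hA.conn (fun v => if v ≤ j then ψ v else ψ s) (fun x y hxy => by
      have h3 := hA.range hxy
      by_cases hy : y ≤ j
      · simpa [hy, show x ≤ j by omega] using hψ x y hxy h3.1 (by omega)
      · by_cases hx : x ≤ j
        · obtain ⟨rfl, rfl⟩ : x = s ∧ y = k := by
            rcases hside hxy with h | h
            · rcases hcut hxy h with h | h | h <;> omega
            · omega
          simp [hy, hx]
        · simp [hx, hy]) v h1 (by omega)
    simpa [show v ≤ j by omega, hsj] using this
  have kb : IsNCTree (fun x y => A x y ∧ j + 1 ≤ x ∧ y ≤ j + 1 + (k - (j + 1))) (j + 1)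
      (k - (j + 1)) := by
    refine hA.restrict (j + 1) (k - (j + 1)) fun ψ hψ v h1 h2 => ?_
    have h0 : ∀ v, j + 1 ≤ v → v ≤ k → (ψ v ↔ ψ k) := by
      intro v h1 h2
      -- Everything outside the interval gets the colour of `k`, where this part is attached; the
      -- base vertex `s` of `conn` lies outside.
      have key := hA.conn (fun v => if j + 1 ≤ v ∧ v ≤ k then ψ v else ψ k) (fun x y hxy => by
        have h3 := hA.range hxy
        rcases hside hxy with h | h
        · rcases hcut hxy h with h' | h' | ⟨rfl, rfl⟩
          · rw [if_neg (by omega), if_neg (by omega)]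
          · rw [if_pos (by omega), if_pos (by omega)]
            exact hψ x y hxy (by omega) (by omega)
          · rw [if_neg (by omega), if_pos (by omega)]
        · rw [if_neg (c := j + 1 ≤ y ∧ y ≤ k) (by omega)]
          by_cases hx : x = k
          · subst hx
            rw [if_pos (by omega)]
          · rw [if_neg (by omega)])
      have e1 := key v (by omega) (by omega)
      beta_reduce at e1
      rw [if_pos (by omega), if_neg (by omega)] at e1
      exact e1
    rw [h0 v h1 (by omega), h0 (j + 1) le_rfl (by omega)]
  have kc : IsNCTree (fun x y => A x y ∧ k ≤ x ∧ y ≤ k + (s + n - k)) k (s + n - k) := by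
    refine hA.restrict k (s + n - k) fun ψ hψ v h1 h2 => ?_
    have := hA.conn (fun v => if k ≤ v then ψ v else ψ k) (fun x y hxy => by
      have h3 := hA.range hxy
      rcases hside hxy with h | h
      · rw [if_neg (by omega)]
        by_cases hy : y = k
        · subst hy
          rw [if_pos le_rfl]
        · rw [if_neg (by omega)]
      · rw [if_pos (by omega), if_pos (by omega)]
        exact hψ x y hxy (by omega) (by omega)) v (by omega) (by omega)
    beta_reduce at this
    rwa [if_pos h1, if_neg (by omega)] at this
  obtain ⟨a, ha, ha'⟩ := ih (j - s) (by omega) ka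
  obtain ⟨b, hb, hb'⟩ := ih (k - (j + 1)) (by omega) kb
  obtain ⟨c, hc, hc'⟩ := ih (s + n - k) (by omega) kc
  refine ⟨node a b c, by simp only [size]; omega, fun x y => ?_⟩
  have e1 : s + a.size + 1 = j + 1 := by omega
  have e2 : j + 1 + b.size = k := by omega
  simp only [arcs, List.mem_append, List.mem_cons, Prod.mk.injEq]
  rw [e1, e2, ha', hb', hc']
  constructor
  · rintro (h | h | ⟨rfl, rfl⟩ | h)
    · exact h.1
    · exact h.1
    · exact hk
    · exact h.1
  · intro hxy
    have h3 := hA.range hxy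
    rcases hside hxy with h | h
    · rcases hcut hxy h with h' | h' | h'
      · exact Or.inl ⟨hxy, h3.1, by omega⟩
      · exact Or.inr (Or.inl ⟨hxy, by omega, by omega⟩)
      · exact Or.inr (Or.inr (Or.inl h'))
    · exact Or.inr (Or.inr (Or.inr ⟨hxy, h, by omega⟩))

/-! ### Points in convex position -/

/-- Twice the signed area of a triangle. -/
def orient (a b c : Plane) : ℝ := (b 0 - a 0) * (c 1 - a 1) - (b 1 - a 1) * (c 0 - a 0)

lemma orient_rotate (a b c : Plane) : orient a b c = orient b c a := by
  unfold orient; ring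

lemma orient_swap (a b c : Plane) : orient a c b = -orient a b c := by
  unfold orient; ring

lemma orient_left (a b : Plane) : orient a b a = 0 := by
  unfold orient; ring

lemma orient_right (a b : Plane) : orient a b b = 0 := by
  unfold orient; ring

lemma orient_add (o a b c : Plane) :
    orient a b c = orient o a b + orient o b c - orient o a c := by
  unfold orient; ring

lemma orient_comb (a b c d : Plane) {s t : ℝ} (hst : s + t = 1) :
    orient a b (s • c + t • d) = s * orient a b c + t * orient a b d := by
  obtain rfl : t = 1 - s := by linarith
  simp only [orient, PiLp.add_apply, PiLp.smul_apply, smul_eq_mul]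
  ring

/-- The affine dependence of four points of the plane has signed areas as coefficients. Depending on
their signs it yields a convex combination or the crossing point of two diagonals. -/
lemma orient_relation (a b c d : Plane) :
    orient b c d • a + orient a b d • c = orient a c d • b + orient a b c • d := by
  ext i
  fin_cases i <;> simp [orient] <;> ring

lemma not_mem_hull_three {ι : Type*} {p : ι → Plane} (hp : ConvexIndependent ℝ p) {a b c d : ι}
    {x y z : ℝ} (hx : 0 ≤ x) (hy : 0 ≤ y) (hz : 0 ≤ z) (hsum : x + y + z = 1)
    (h : p d = x • p a + y • p b + z • p c) : d = a ∨ d = b ∨ d = c := by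
  refine hp {a, b, c} d ?_
  have hs : ∀ i ∈ ({a, b, c} : Set ι), p i ∈ convexHull ℝ (p '' {a, b, c}) := fun i hi =>
    subset_convexHull ℝ _ (Set.mem_image_of_mem p hi)
  have := (convex_convexHull ℝ (p '' {a, b, c})).sum_mem (t := Finset.univ) (w := ![x, y, z])
    (z := ![p a, p b, p c])
    (by intro i _; fin_cases i <;> simpa) (by simpa [Fin.sum_univ_three] using hsum)
    (by intro i _; fin_cases i <;> simp <;> exact hs _ (by simp))
  rw [h]
  simpa [Fin.sum_univ_three] using this

/-- Points seen from `p o` in counterclockwise order are in convex position only if they are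
counterclockwise themselves. -/
lemma orient_pos_of_fan {ι : Type*} {p : ι → Plane} (hp : ConvexIndependent ℝ p) {o a b c : ι}
    (hab : 0 < orient (p o) (p a) (p b)) (hbc : 0 < orient (p o) (p b) (p c))
    (hac : 0 < orient (p o) (p a) (p c)) : 0 < orient (p a) (p b) (p c) := by
  -- If the triangle were not counterclockwise, the affine dependence would write `p b` as a convex
  -- combination of `p a`, `p c` and `p o`.
  by_contra! hle
  have hrel := orient_relation (p o) (p a) (p b) (p c)
  have hadd := orient_add (p o) (p a) (p b) (p c)
  set D := orient (p o) (p a) (p c)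
  have hD : D ≠ 0 := hac.ne'
  have key : p b = (orient (p o) (p b) (p c) / D) • p a + (orient (p o) (p a) (p b) / D) • p c +
      (-orient (p a) (p b) (p c) / D) • p o := by
    have h2 : D • p b = orient (p o) (p b) (p c) • p a + orient (p o) (p a) (p b) • p c +
        (-orient (p a) (p b) (p c)) • p o := by
      rw [← hrel, neg_smul]; abel
    calc p b = D⁻¹ • (D • p b) := by rw [smul_smul, inv_mul_cancel₀ hD, one_smul]
      _ = _ := by rw [h2, smul_add, smul_add, smul_smul, smul_smul, smul_smul]; simp only [div_eq_inv_mul]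
  rcases not_mem_hull_three hp (by positivity) (by positivity)
    (div_nonneg (by linarith) hac.le) (by field_simp; linarith) key with rfl | rfl | rfl
  · rw [orient_right] at hab; exact lt_irrefl _ hab
  · rw [orient_right] at hbc; exact lt_irrefl _ hbc
  · rw [orient_left] at hab; exact lt_irrefl _ hab

/-- Seen from `p o`, all other points lie in one open half-plane, so a slope orders them by angle
without any case distinction. -/
lemma exists_separating {ι : Type*} [Finite ι] {p : ι → Plane} (hp : ConvexIndependent ℝ p) (o : ι) :
    ∃ α β : ℝ, ∀ i, i ≠ o → 0 < α * (p i 0 - p o 0) + β * (p i 1 - p o 1) := by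
  have hfin : (p '' {i | i ≠ o}).Finite := Set.toFinite _
  obtain ⟨f, u, hu, hf⟩ := geometric_hahn_banach_point_closed (convex_convexHull ℝ (p '' {i | i ≠ o}))
    (hfin.isClosed_convexHull ℝ) (x := p o) (fun h => (hp _ _ h) rfl)
  have hrep : ∀ w : Plane, f w = f (EuclideanSpace.single 0 1) * w 0 +
      f (EuclideanSpace.single 1 1) * w 1 := by
    intro w
    have : w = w 0 • EuclideanSpace.single 0 1 + w 1 • EuclideanSpace.single 1 1 := by
      ext i; fin_cases i <;> simp
    conv_lhs => rw [this]
    simp only [map_add, map_smul, smul_eq_mul]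
    ring
  refine ⟨f (EuclideanSpace.single 0 1), f (EuclideanSpace.single 1 1), fun i hi => ?_⟩
  have h1 := hf (p i) (subset_convexHull ℝ _ (Set.mem_image_of_mem p hi))
  rw [hrep] at h1 hu
  linarith

/-- Points in convex position can be ordered counterclockwise. -/
theorem exists_counterclockwise {n : ℕ} {p : Fin (n + 1) → Plane} (hp : ConvexIndependent ℝ p) :
    ∃ σ : Equiv.Perm (Fin (n + 1)), ∀ i j k, i < j → j < k →
      0 < orient (p (σ i)) (p (σ j)) (p (σ k)) := by
  obtain ⟨α, β, hpos⟩ := exists_separating hp 0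
  set l : Fin (n + 1) → ℝ := fun i => α * (p i 0 - p 0 0) + β * (p i 1 - p 0 1) with hl
  -- `l` and `m` are coordinates in a rotated and scaled frame at `p 0`; as `l` is positive on the
  -- other points, `m / l` increases with the angle.
  set m : Fin (n + 1) → ℝ := fun i => α * (p i 1 - p 0 1) - β * (p i 0 - p 0 0) with hm
  have hcross : ∀ i j, l i * m j - m i * l j = (α ^ 2 + β ^ 2) * orient (p 0) (p i) (p j) := by
    intro i j
    simp only [hl, hm, orient]
    ring
  set θ : Fin (n + 1) → ℝ := fun i => m i / l i with hθ
  have hlt : ∀ i j, i ≠ 0 → j ≠ 0 → θ i < θ j → 0 < orient (p 0) (p i) (p j) := by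
    intro i j hi hj h
    have h1 := hpos i hi
    have h2 := hpos j hj
    simp only [hθ] at h
    rw [div_lt_div_iff₀ h1 h2] at h
    have h3 := hcross i j
    have h4 : 0 < (α ^ 2 + β ^ 2) * orient (p 0) (p i) (p j) := by rw [← h3]; linarith
    exact pos_of_mul_pos_right h4 (by positivity)
  -- Equal slopes put the two points on one ray from `p 0`, and the nearer one would lie on the
  -- segment from `p 0` to the farther one.
  have hinj : ∀ i j, i ≠ 0 → j ≠ 0 → θ i = θ j → i = j := by
    have key : ∀ i j, i ≠ 0 → j ≠ 0 → θ i = θ j → l i ≤ l j → i = j := by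
      intro i j hi hj h hle
      have h1 : 0 < l i := hpos i hi
      have h2 : 0 < l j := hpos j hj
      simp only [hθ] at h
      rw [div_eq_div_iff h1.ne' h2.ne'] at h
      have hab : 0 < α ^ 2 + β ^ 2 := by
        rcases eq_or_ne α 0 with ha | ha
        · rcases eq_or_ne β 0 with hb | hb
          · simp only [hl, ha, hb] at h1
            simp at h1
          · positivity
        · positivity
      have h3 : orient (p 0) (p i) (p j) = 0 := by
        have := hcross i j
        have h4 : (α ^ 2 + β ^ 2) * orient (p 0) (p i) (p j) = 0 := by rw [← this]; linarith
        exact (mul_eq_zero.1 h4).resolve_left hab.ne'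
      have hq : l j • (p i - p 0) = l i • (p j - p 0) := by
        simp only [orient] at h3
        ext k
        fin_cases k
        · simp only [hl, Fin.zero_eta, PiLp.smul_apply, PiLp.sub_apply, smul_eq_mul]
          linear_combination β * h3
        · simp only [hl, Fin.mk_one, PiLp.smul_apply, PiLp.sub_apply, smul_eq_mul]
          linear_combination (-α) * h3
      have hi' : p i = (l i / l j) • p j + (1 - l i / l j) • p 0 + (0 : ℝ) • p 0 := by
        have : p i - p 0 = (l j)⁻¹ • (l i • (p j - p 0)) := by
          rw [← hq, smul_smul, inv_mul_cancel₀ h2.ne', one_smul]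
        rw [smul_smul, ← div_eq_inv_mul, sub_eq_iff_eq_add] at this
        rw [this]
        module
      rcases not_mem_hull_three hp (by positivity)
        (sub_nonneg.2 ((div_le_one h2).2 hle)) le_rfl (by ring) hi' with h | h | h
      · exact h
      · exact absurd h hi
      · exact absurd h hi
    intro i j hi hj h
    rcases le_total (l i) (l j) with hle | hle
    · exact key i j hi hj h hle
    · exact (key j i hj hi h.symm hle).symm
  -- The base point has no slope; it gets a key below all others, so that it comes first.
  set κ : Fin (n + 1) → ℝ := fun i => if i = 0 then -1 - ∑ j, |θ j| else θ i with hκ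
  have hκ0 : ∀ i, i ≠ 0 → κ 0 < κ i := by
    intro i hi
    simp only [hκ, if_true, if_neg hi]
    have h1 : |θ i| ≤ ∑ j, |θ j| :=
      Finset.single_le_sum (f := fun j => |θ j|) (fun j _ => abs_nonneg _) (Finset.mem_univ i)
    linarith [neg_abs_le (θ i)]
  have hκinj : Function.Injective κ := by
    intro i j h
    by_cases hi : i = 0
    · by_cases hj : j = 0
      · rw [hi, hj]
      · rw [hi] at h
        exact absurd h (hκ0 j hj).ne
    · by_cases hj : j = 0
      · rw [hj] at h
        exact absurd h (hκ0 i hi).ne'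
      · simp only [hκ, if_neg hi, if_neg hj] at h
        exact hinj i j hi hj h
  have hmono : StrictMono (κ ∘ Tuple.sort κ) :=
    (Tuple.monotone_sort κ).strictMono_of_injective (hκinj.comp (Equiv.injective _))
  refine ⟨Tuple.sort κ, fun i j k hij hjk => ?_⟩
  have h1 : κ (Tuple.sort κ i) < κ (Tuple.sort κ j) := hmono hij
  have h2 : κ (Tuple.sort κ j) < κ (Tuple.sort κ k) := hmono hjk
  generalize Tuple.sort κ i = a at *
  generalize Tuple.sort κ j = b at *
  generalize Tuple.sort κ k = c at *
  have ne0 : ∀ {x y}, κ x < κ y → y ≠ 0 := by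
    rintro x y h rfl
    by_cases hx : x = 0
    · rw [hx] at h; exact lt_irrefl _ h
    · exact lt_asymm h (hκ0 x hx)
  have hb := ne0 h1
  have hc := ne0 h2
  have hθκ : ∀ x, x ≠ 0 → κ x = θ x := fun x hx => by simp only [hκ, if_neg hx]
  have hbc := hlt b c hb hc (by rwa [← hθκ b hb, ← hθκ c hc])
  by_cases ha : a = 0
  · rwa [ha]
  · refine orient_pos_of_fan hp (o := 0) (hlt a b ha hb ?_) hbc (hlt a c ha hc ?_)
    · rwa [← hθκ a ha, ← hθκ b hb]
    · rw [← hθκ a ha, ← hθκ c hc]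
      exact h1.trans h2

/-! ### Codes and non-crossing spanning trees of the points -/

/-- A counterclockwise numbering of the points. -/
structure Labelling {n : ℕ} (p : Fin (n + 1) → Plane) where
  v : ℕ → Fin (n + 1)
  idx : Fin (n + 1) → ℕ
  idx_le : ∀ a, idx a ≤ n
  v_idx : ∀ a, v (idx a) = a
  idx_v : ∀ x, x ≤ n → idx (v x) = x
  orient_pos : ∀ x y z, x < y → y < z → z ≤ n → 0 < orient (p (v x)) (p (v y)) (p (v z))

lemma exists_labelling {n : ℕ} {p : Fin (n + 1) → Plane} (hp : ConvexIndependent ℝ p) :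
    Nonempty (Labelling p) := by
  obtain ⟨σ, hσ⟩ := exists_counterclockwise hp
  refine ⟨⟨fun x => σ (Fin.ofNat (n + 1) x), fun a => (σ.symm a).val, fun a => ?_, fun a => ?_,
    fun x hx => ?_, fun x y z hxy hyz hz => hσ _ _ _ ?_ ?_⟩⟩
  · have := (σ.symm a).isLt; omega
  · simp
  · simp [Fin.ofNat, Nat.mod_eq_of_lt (Nat.lt_succ_of_le hx)]
  · simp [Fin.lt_def, Fin.ofNat, Nat.mod_eq_of_lt (show x < n + 1 by omega),
      Nat.mod_eq_of_lt (show y < n + 1 by omega), hxy]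
  · simp [Fin.lt_def, Fin.ofNat, Nat.mod_eq_of_lt (show y < n + 1 by omega),
      Nat.mod_eq_of_lt (show z < n + 1 by omega), hyz]

lemma SimpleGraph.Reachable.iff_of_adj {V : Type*} {G : SimpleGraph V} {φ : V → Prop}
    (h : ∀ a b, G.Adj a b → (φ a ↔ φ b)) {a b : V} (hab : G.Reachable a b) : φ a ↔ φ b := by
  obtain ⟨w⟩ := hab
  induction w with
  | nil => rfl
  | cons hadj _ ih => exact (h _ _ hadj).trans ih

namespace Labelling

variable {n : ℕ} {p : Fin (n + 1) → Plane} (ℓ : Labelling p)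

lemma v_inj {x y : ℕ} (hx : x ≤ n) (hy : y ≤ n) (h : ℓ.v x = ℓ.v y) : x = y := by
  rw [← ℓ.idx_v x hx, ← ℓ.idx_v y hy, h]

/-- Interleaved chords meet. -/
lemma exists_mem_of_interleaved {x y z w : ℕ} (hxy : x < y) (hyz : y < z) (hzw : z < w)
    (hw : w ≤ n) : ∃ q, q ∈ segment ℝ (p (ℓ.v x)) (p (ℓ.v z)) ∧
      q ∈ segment ℝ (p (ℓ.v y)) (p (ℓ.v w)) := by
  have h1 := ℓ.orient_pos y z w hyz hzw hw
  have h2 := ℓ.orient_pos x y w hxy (by omega) hw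
  have h3 := ℓ.orient_pos x z w (by omega) hzw hw
  have h4 := ℓ.orient_pos x y z hxy hyz (by omega)
  have hrel := orient_relation (p (ℓ.v x)) (p (ℓ.v y)) (p (ℓ.v z)) (p (ℓ.v w))
  have hsum : orient (p (ℓ.v y)) (p (ℓ.v z)) (p (ℓ.v w)) + orient (p (ℓ.v x)) (p (ℓ.v y)) (p (ℓ.v w))
      = orient (p (ℓ.v x)) (p (ℓ.v z)) (p (ℓ.v w)) + orient (p (ℓ.v x)) (p (ℓ.v y)) (p (ℓ.v z)) := by
    rw [orient_add (p (ℓ.v x)) (p (ℓ.v y)) (p (ℓ.v z)) (p (ℓ.v w))]; ring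
  set D₁ := orient (p (ℓ.v y)) (p (ℓ.v z)) (p (ℓ.v w))
  set D₂ := orient (p (ℓ.v x)) (p (ℓ.v y)) (p (ℓ.v w))
  set D₃ := orient (p (ℓ.v x)) (p (ℓ.v z)) (p (ℓ.v w))
  set D₄ := orient (p (ℓ.v x)) (p (ℓ.v y)) (p (ℓ.v z))
  refine ⟨(D₁ + D₂)⁻¹ • (D₁ • p (ℓ.v x) + D₂ • p (ℓ.v z)),
    ⟨D₁ / (D₁ + D₂), D₂ / (D₁ + D₂), by positivity, by positivity, by field_simp, ?_⟩,
    ⟨D₃ / (D₁ + D₂), D₄ / (D₁ + D₂), by positivity, by positivity, ?_, ?_⟩⟩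
  · rw [smul_add, smul_smul, smul_smul, div_eq_inv_mul, div_eq_inv_mul]
  · rw [← add_div, hsum, div_self (by positivity)]
  · rw [hrel, smul_add, smul_smul, smul_smul, div_eq_inv_mul, div_eq_inv_mul]

/-- The side of the chord `x y` on which the points lie. -/
lemma orient_chord {x y z : ℕ} (hxy : x < y) (hy : y ≤ n) (hz : z ≤ n) :
    ((z < x ∨ y < z) ∧ 0 < orient (p (ℓ.v x)) (p (ℓ.v y)) (p (ℓ.v z))) ∨
      ((x < z ∧ z < y) ∧ orient (p (ℓ.v x)) (p (ℓ.v y)) (p (ℓ.v z)) < 0) ∨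
      ((z = x ∨ z = y) ∧ orient (p (ℓ.v x)) (p (ℓ.v y)) (p (ℓ.v z)) = 0) := by
  rcases lt_trichotomy z x with h | rfl | h
  · left
    refine ⟨Or.inl h, ?_⟩
    rw [← orient_rotate]
    exact ℓ.orient_pos z x y h hxy hy
  · exact Or.inr (Or.inr ⟨Or.inl rfl, orient_left _ _⟩)
  · rcases lt_trichotomy z y with h' | rfl | h'
    · refine Or.inr (Or.inl ⟨⟨h, h'⟩, ?_⟩)
      rw [orient_swap]
      have := ℓ.orient_pos x z y h h' hy
      linarith
    · exact Or.inr (Or.inr ⟨Or.inr rfl, orient_right _ _⟩)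
    · exact Or.inl ⟨Or.inr h', ℓ.orient_pos x y z hxy h' hz⟩

/-- Chords that are not interleaved meet only in common endpoints. -/
lemma segment_inter_subset {x y z w : ℕ} (hxy : x < y) (hy : y ≤ n) (hzw : z < w) (hw : w ≤ n)
    (hne : (x, y) ≠ (z, w)) (h1 : ¬ (x < z ∧ z < y ∧ y < w)) (h2 : ¬ (z < x ∧ x < w ∧ w < y)) :
    segment ℝ (p (ℓ.v x)) (p (ℓ.v y)) ∩ segment ℝ (p (ℓ.v z)) (p (ℓ.v w)) ⊆
      ({p (ℓ.v x), p (ℓ.v y)} ∩ {p (ℓ.v z), p (ℓ.v w)} : Set Plane) := by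
  rintro q ⟨⟨s, t, -, -, hst, rfl⟩, ⟨a, b, ha, hb, hab, hq⟩⟩
  have e : orient (p (ℓ.v x)) (p (ℓ.v y)) (s • p (ℓ.v x) + t • p (ℓ.v y)) = 0 := by
    rw [orient_comb _ _ _ _ hst, orient_left, orient_right]; ring
  rw [← hq, orient_comb _ _ _ _ hab] at e
  rw [← hq]
  simp only [ne_eq, Prod.mk.injEq, not_and] at hne
  have hends : ∀ u, (u = x ∨ u = y) → p (ℓ.v u) ∈ ({p (ℓ.v x), p (ℓ.v y)} : Set Plane) := by
    rintro u (rfl | rfl) <;> simp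
  -- The orientation relative to the chord `x y` vanishes at the common point. Ends `z`, `w`
  -- strictly on one side make this impossible, and ends on opposite sides interleave. If just one
  -- end is on the line, the common point is that end.
  rcases ℓ.orient_chord hxy hy (show z ≤ n by omega) with ⟨c1, d1⟩ | ⟨c1, d1⟩ | ⟨c1, d1⟩ <;>
    rcases ℓ.orient_chord hxy hy hw with ⟨c2, d2⟩ | ⟨c2, d2⟩ | ⟨c2, d2⟩
  · exact absurd e (ne_of_gt (convex_Ioi (𝕜 := ℝ) (0 : ℝ) d1 d2 ha hb hab))
  · omega
  · rw [d2, mul_zero, add_zero] at e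
    obtain rfl : a = 0 := (mul_eq_zero.1 e).resolve_right d1.ne'
    obtain rfl : b = 1 := by linarith
    simpa using hends w c2
  · omega
  · exact absurd e (ne_of_lt (convex_Iio (𝕜 := ℝ) (0 : ℝ) d1 d2 ha hb hab))
  · rw [d2, mul_zero, add_zero] at e
    obtain rfl : a = 0 := (mul_eq_zero.1 e).resolve_right d1.ne
    obtain rfl : b = 1 := by linarith
    simpa using hends w c2
  · rw [d1, mul_zero, zero_add] at e
    obtain rfl : b = 0 := (mul_eq_zero.1 e).resolve_right d2.ne'
    obtain rfl : a = 1 := by linarith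
    simpa using hends z c1
  · rw [d1, mul_zero, zero_add] at e
    obtain rfl : b = 0 := (mul_eq_zero.1 e).resolve_right d2.ne
    obtain rfl : a = 1 := by linarith
    simpa using hends z c1
  · omega

/-- The chord with the given ends. -/
def chord (e : ℕ × ℕ) : Sym2 (Fin (n + 1)) := s(ℓ.v e.1, ℓ.v e.2)

/-- The graph with the given chords. -/
def graph (L : List (ℕ × ℕ)) : SimpleGraph (Fin (n + 1)) :=
  SimpleGraph.fromEdgeSet {e | ∃ a ∈ L, ℓ.chord a = e}

lemma graph_perm {L L' : List (ℕ × ℕ)} (h : L.Perm L') : ℓ.graph L = ℓ.graph L' := by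
  simp only [graph, h.mem_iff]

lemma chord_inj {a b : ℕ × ℕ} (ha : a.1 < a.2 ∧ a.2 ≤ n) (hb : b.1 < b.2 ∧ b.2 ≤ n)
    (h : ℓ.chord a = ℓ.chord b) : a = b := by
  rcases Sym2.eq_iff.1 h with ⟨h1, h2⟩ | ⟨h1, h2⟩
  · exact Prod.ext (ℓ.v_inj (by omega) (by omega) h1) (ℓ.v_inj (by omega) (by omega) h2)
  · have := ℓ.v_inj (by omega) (by omega) h1
    have := ℓ.v_inj (by omega) (by omega) h2
    omega

lemma v_ne {x y : ℕ} (hxy : x < y) (hy : y ≤ n) : ℓ.v x ≠ ℓ.v y := fun h => by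
  have := ℓ.v_inj (by omega) hy h
  omega

lemma exists_of_adj_graph {L : List (ℕ × ℕ)} {a b : Fin (n + 1)} (h : (ℓ.graph L).Adj a b) :
    ∃ x y, (x, y) ∈ L ∧ ((ℓ.v x = a ∧ ℓ.v y = b) ∨ (ℓ.v x = b ∧ ℓ.v y = a)) := by
  simp only [graph, SimpleGraph.fromEdgeSet_adj] at h
  obtain ⟨⟨⟨x, y⟩, hL, he⟩, -⟩ := h
  exact ⟨x, y, hL, Sym2.eq_iff.1 he⟩

lemma adj_graph {L : List (ℕ × ℕ)} (hL : ∀ a ∈ L, a.1 < a.2 ∧ a.2 ≤ n) {x y : ℕ} (hxy : x < y)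
    (hy : y ≤ n) : (ℓ.graph L).Adj (ℓ.v x) (ℓ.v y) ↔ (x, y) ∈ L := by
  constructor
  · intro h
    simp only [graph, SimpleGraph.fromEdgeSet_adj] at h
    obtain ⟨⟨a, ha, he⟩, -⟩ := h
    rwa [← ℓ.chord_inj (a := a) (b := (x, y)) (hL a ha) ⟨hxy, hy⟩ he]
  · intro h
    simp only [graph, SimpleGraph.fromEdgeSet_adj]
    exact ⟨⟨(x, y), h, rfl⟩, ℓ.v_ne hxy hy⟩

lemma isTree_graph {L : List (ℕ × ℕ)} (hL : IsNCTree (fun x y => (x, y) ∈ L) 0 n) :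
    (ℓ.graph L).IsTree := by
  have hr : ∀ a ∈ L, a.1 < a.2 ∧ a.2 ≤ n := fun a ha => by
    have := hL.range ha
    omega
  refine ⟨⟨?_⟩, ?_⟩
  · have hconn : ∀ a, (ℓ.graph L).Reachable a (ℓ.v 0) := by
      intro a
      have := hL.conn (fun x => (ℓ.graph L).Reachable (ℓ.v x) (ℓ.v 0)) (fun x y hxy => by
        have hadj := (ℓ.adj_graph hr (hr _ hxy).1 (hr _ hxy).2).2 hxy
        exact ⟨fun h => hadj.symm.reachable.trans h, fun h => hadj.reachable.trans h⟩)
        (ℓ.idx a) (Nat.zero_le _) (by simpa using ℓ.idx_le a)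
      rw [ℓ.v_idx] at this
      exact this.2 (SimpleGraph.Reachable.refl _)
    exact fun a b => (hconn a).trans (hconn b).symm
  · rw [SimpleGraph.isAcyclic_iff_forall_isBridge]
    rintro ⟨a, b⟩ hab
    obtain ⟨x, y, hxy, hends⟩ := ℓ.exists_of_adj_graph hab
    obtain ⟨φ, hx, hy, hφ⟩ := hL.bridge hxy
    have hn := hr _ hxy
    have hinv : ∀ c d, ((ℓ.graph L).deleteEdges {s(a, b)}).Adj c d →
        (φ (ℓ.idx c) ↔ φ (ℓ.idx d)) := by
      intro c d hcd
      rw [SimpleGraph.deleteEdges_adj] at hcd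
      obtain ⟨u, w, huw, hends'⟩ := ℓ.exists_of_adj_graph hcd.1
      have hn' := hr _ huw
      have hne : (u, w) ≠ (x, y) := by
        rintro ⟨⟩
        refine hcd.2 ?_
        rw [Set.mem_singleton_iff, ← Sym2.eq_iff.2 hends, ← Sym2.eq_iff.2 hends']
      have := hφ u w huw hne
      rcases hends' with ⟨rfl, rfl⟩ | ⟨rfl, rfl⟩ <;>
        rw [ℓ.idx_v _ (by omega), ℓ.idx_v _ (by omega)]
      · exact this
      · exact this.symm
    intro hreach
    have := SimpleGraph.Reachable.iff_of_adj (φ := fun c => φ (ℓ.idx c)) hinv hreach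
    rcases hends with ⟨rfl, rfl⟩ | ⟨rfl, rfl⟩ <;>
      rw [ℓ.idx_v _ (by omega), ℓ.idx_v _ (by omega)] at this
    · exact hy (this.1 hx)
    · exact hy (this.2 hx)

lemma isNCST_graph {L : List (ℕ × ℕ)} (hL : IsNCTree (fun x y => (x, y) ∈ L) 0 n) :
    IsNCST p (ℓ.graph L) := by
  refine ⟨ℓ.isTree_graph hL, fun a b c d hab hcd hne => ?_⟩
  obtain ⟨x, y, hxy, h1⟩ := ℓ.exists_of_adj_graph hab
  obtain ⟨z, w, hzw, h2⟩ := ℓ.exists_of_adj_graph hcd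
  have r1 := hL.range hxy
  have r2 := hL.range hzw
  have key := ℓ.segment_inter_subset (x := x) (y := y) (z := z) (w := w) (by omega) (by omega)
    (by omega) (by omega) (by
      rintro ⟨⟩
      exact hne ((Sym2.eq_iff.2 h1).symm.trans (Sym2.eq_iff.2 h2)))
    (fun h => hL.noncrossing hxy hzw h.1 h.2.1 h.2.2)
    (fun h => hL.noncrossing hzw hxy h.1 h.2.1 h.2.2)
  rcases h1 with ⟨rfl, rfl⟩ | ⟨rfl, rfl⟩ <;> rcases h2 with ⟨rfl, rfl⟩ | ⟨rfl, rfl⟩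
  · exact key
  · rwa [segment_symm ℝ (p (ℓ.v w)), Set.pair_comm (p (ℓ.v w))]
  · rwa [segment_symm ℝ (p (ℓ.v y)), Set.pair_comm (p (ℓ.v y))]
  · rwa [segment_symm ℝ (p (ℓ.v w)), Set.pair_comm (p (ℓ.v w)), segment_symm ℝ (p (ℓ.v y)),
      Set.pair_comm (p (ℓ.v y))]

lemma isNCTree_of_isNCST (hp : Function.Injective p) {G : SimpleGraph (Fin (n + 1))}
    (hG : IsNCST p G) :
    IsNCTree (fun x y => x < y ∧ y ≤ n ∧ G.Adj (ℓ.v x) (ℓ.v y)) 0 n where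
  range h := ⟨Nat.zero_le _, h.1, by omega⟩
  noncrossing {x y u w} h h' hxy hyu huw := by
    have hne : s(ℓ.v x, ℓ.v u) ≠ s(ℓ.v y, ℓ.v w) := fun he => by
      have := ℓ.chord_inj (a := (x, u)) (b := (y, w)) ⟨h.1, h.2.1⟩ ⟨h'.1, h'.2.1⟩ he
      simp only [Prod.mk.injEq] at this
      omega
    obtain ⟨q, hq1, hq2⟩ := ℓ.exists_mem_of_interleaved hxy hyu huw h'.2.1
    have h3 := hG.2 _ _ _ _ h.2.2 h'.2.2 hne ⟨hq1, hq2⟩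
    simp only [Set.mem_inter_iff, Set.mem_insert_iff, Set.mem_singleton_iff] at h3
    have hne' : ∀ {x y}, x ≤ n → y ≤ n → x ≠ y → p (ℓ.v x) ≠ p (ℓ.v y) :=
      fun hx hy hn he => hn (ℓ.v_inj hx hy (hp he))
    have hw := h'.2.1
    rcases h3 with ⟨rfl | rfl, h4 | h4⟩
    · exact hne' (by omega) (by omega) (by omega) h4
    · exact hne' (by omega) (by omega) (by omega) h4
    · exact hne' (by omega) (by omega) (by omega) h4
    · exact hne' (by omega) (by omega) (by omega) h4
  conn φ h x _ hx := by
    have hinv : ∀ a b, G.Adj a b → (φ (ℓ.idx a) ↔ φ (ℓ.idx b)) := by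
      intro a b hab
      rcases lt_trichotomy (ℓ.idx a) (ℓ.idx b) with hlt | heq | hlt
      · exact h _ _ ⟨hlt, ℓ.idx_le b, by rwa [ℓ.v_idx, ℓ.v_idx]⟩
      · rw [heq]
      · exact (h _ _ ⟨hlt, ℓ.idx_le a, by rw [ℓ.v_idx, ℓ.v_idx]; exact hab.symm⟩).symm
    have := SimpleGraph.Reachable.iff_of_adj (φ := fun c => φ (ℓ.idx c)) hinv
      (hG.1.1.preconnected (ℓ.v x) (ℓ.v 0))
    rwa [ℓ.idx_v x (by omega), ℓ.idx_v 0 (by omega)] at this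
  bridge {x y} h := by
    have hb := SimpleGraph.isAcyclic_iff_forall_isBridge.1 hG.1.2
      (e := s(ℓ.v x, ℓ.v y)) h.2.2
    rw [SimpleGraph.isBridge_iff] at hb
    refine ⟨fun u => (G.deleteEdges {s(ℓ.v x, ℓ.v y)}).Reachable (ℓ.v x) (ℓ.v u),
      SimpleGraph.Reachable.refl _, hb, fun u w huw hne => ?_⟩
    have hadj : (G.deleteEdges {s(ℓ.v x, ℓ.v y)}).Adj (ℓ.v u) (ℓ.v w) := by
      rw [SimpleGraph.deleteEdges_adj]
      exact ⟨huw.2.2, fun he => hne (ℓ.chord_inj (a := (u, w)) (b := (x, y)) ⟨huw.1, huw.2.1⟩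
        ⟨h.1, h.2.1⟩ he)⟩
    exact ⟨fun h' => h'.trans hadj.reachable, fun h' => h'.trans hadj.symm.reachable⟩

lemma isNCTree_ed {w : List Letter} (hw : IsCode n w) :
    IsNCTree (fun x y => (x, y) ∈ ed w [] 0) 0 n := by
  obtain ⟨t, rfl, rfl⟩ := hw
  simpa only [ed_enc] using t.isNCTree 0

/-- The non-crossing spanning tree with the given code. -/
noncomputable def tree (w : List Letter) (hw : IsCode n w) : NCST p :=
  ⟨ℓ.graph (ed w [] 0), ℓ.isNCST_graph (isNCTree_ed hw)⟩

lemma range_ed {w : List Letter} (hw : IsCode n w) : ∀ a ∈ ed w [] 0, a.1 < a.2 ∧ a.2 ≤ n :=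
  fun a ha => by
    have := (isNCTree_ed hw).range (x := a.1) (y := a.2) ha
    omega

lemma code_eq_of_graph_eq {w w' : List Letter} (hw : IsCode n w) (hw' : IsCode n w')
    (h : ℓ.graph (ed w [] 0) = ℓ.graph (ed w' [] 0)) : w = w' := by
  have hr := range_ed hw
  have hr' := range_ed hw'
  have hiff : ∀ x y, (x, y) ∈ ed w [] 0 ↔ (x, y) ∈ ed w' [] 0 := by
    intro x y
    constructor
    · intro hxy
      have hn := hr _ hxy
      rw [← ℓ.adj_graph hr' hn.1 hn.2, ← h]
      exact (ℓ.adj_graph hr hn.1 hn.2).2 hxy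
    · intro hxy
      have hn := hr' _ hxy
      rw [← ℓ.adj_graph hr hn.1 hn.2, h]
      exact (ℓ.adj_graph hr' hn.1 hn.2).2 hxy
  obtain ⟨t, ht, rfl⟩ := hw
  obtain ⟨t', ht', rfl⟩ := hw'
  simp only [ed_enc] at hiff
  rw [arcs_inj (ht.trans ht'.symm) hiff]

lemma exists_code_of_isNCST (hp : Function.Injective p) {G : SimpleGraph (Fin (n + 1))}
    (hG : IsNCST p G) : ∃ w, IsCode n w ∧ ℓ.graph (ed w [] 0) = G := by
  obtain ⟨t, ht, h⟩ := (ℓ.isNCTree_of_isNCST hp hG).exists_tree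
  have hw : IsCode n t.enc := ⟨t, ht, rfl⟩
  refine ⟨t.enc, hw, ?_⟩
  have hlt : ∀ {x y}, x < y → y ≤ n →
      ((ℓ.graph (ed t.enc [] 0)).Adj (ℓ.v x) (ℓ.v y) ↔ G.Adj (ℓ.v x) (ℓ.v y)) := by
    intro x y hxy hy
    rw [ℓ.adj_graph (range_ed hw) hxy hy, ed_enc, h]
    tauto
  ext a b
  rcases lt_trichotomy (ℓ.idx a) (ℓ.idx b) with hab | hab | hab
  · have := hlt hab (ℓ.idx_le b)
    rwa [ℓ.v_idx, ℓ.v_idx] at this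
  · obtain rfl : a = b := by rw [← ℓ.v_idx a, hab, ℓ.v_idx]
    simp
  · have := hlt hab (ℓ.idx_le a)
    rw [ℓ.v_idx, ℓ.v_idx] at this
    rw [SimpleGraph.adj_comm, this, SimpleGraph.adj_comm]

lemma sum_codes_eq (hp : Function.Injective p) {F : List Letter → ℝ} {f : NCST p → ℝ}
    (h : ∀ w hw, F w = f (ℓ.tree w hw)) : ∑ w ∈ codes n, F w = ∑ S, f S := by
  refine Finset.sum_bij (fun w hw => ℓ.tree w (mem_codes.1 hw)) (fun _ _ => Finset.mem_univ _)
    (fun w hw w' hw' he => ?_) (fun S _ => ?_) fun w hw => h w _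
  · exact ℓ.code_eq_of_graph_eq (mem_codes.1 hw) (mem_codes.1 hw') (congrArg Subtype.val he)
  · obtain ⟨w, hw, he⟩ := ℓ.exists_code_of_isNCST hp S.2
    exact ⟨w, mem_codes.2 hw, Subtype.ext he⟩

end Labelling

/-! ### Block chains and their mixing times -/

/-- The chain which, from `S`, chooses uniformly one of the `n` blocks containing `S` and moves to a
uniform element of this block. -/
noncomputable def blockChain {Ω ι : Type*} [Fintype ι] [DecidableEq Ω] (K : ι → Finset Ω) (n : ℕ) :
    Matrix Ω Ω ℝ :=
  fun S T => (n : ℝ)⁻¹ * ∑ i, if S ∈ K i ∧ T ∈ K i then ((K i).card : ℝ)⁻¹ else 0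

section BlockChain

variable {Ω ι : Type*} [Fintype ι] [DecidableEq Ω] {K : ι → Finset Ω} {n : ℕ}

lemma blockChain_comm (S T : Ω) : blockChain K n S T = blockChain K n T S := by
  simp only [blockChain, and_comm]

lemma blockChain_nonneg (S T : Ω) : 0 ≤ blockChain K n S T := by
  refine mul_nonneg (by positivity) (Finset.sum_nonneg fun i _ => ?_)
  split_ifs <;> positivity

variable [Fintype Ω]

lemma sum_blocks (a : Ω → ι → ℝ) :
    ∑ S, ∑ i, (if S ∈ K i then a S i else 0) = ∑ i, ∑ S ∈ K i, a S i := by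
  rw [Finset.sum_comm]
  simp

lemma blockChain_mulVec (g : Ω → ℝ) (S : Ω) : (blockChain K n).mulVec g S =
    (n : ℝ)⁻¹ * ∑ i, if S ∈ K i then ((K i).card : ℝ)⁻¹ * ∑ T ∈ K i, g T else 0 := by
  simp only [Matrix.mulVec, dotProduct, blockChain, mul_assoc, ← Finset.mul_sum, Finset.sum_mul]
  rw [Finset.sum_comm]
  congr 1
  refine Finset.sum_congr rfl fun i _ => ?_
  by_cases h : S ∈ K i <;> simp [h, Finset.mul_sum]

lemma sum_mul_blockChain (g : Ω → ℝ) : ∑ S, g S * (blockChain K n).mulVec g S =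
    (n : ℝ)⁻¹ * ∑ i, ((K i).card : ℝ)⁻¹ * (∑ S ∈ K i, g S) ^ 2 := by
  have h := sum_blocks (K := K) fun S i => g S * (((K i).card : ℝ)⁻¹ * ∑ T ∈ K i, g T)
  calc _ = (n : ℝ)⁻¹ * ∑ S, ∑ i,
        (if S ∈ K i then g S * (((K i).card : ℝ)⁻¹ * ∑ T ∈ K i, g T) else 0) := by
        rw [Finset.mul_sum]
        refine Finset.sum_congr rfl fun S _ => ?_
        rw [blockChain_mulVec, mul_left_comm, Finset.mul_sum]
        congr 1
        exact Finset.sum_congr rfl fun i _ => by split_ifs <;> simp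
    _ = _ := by
        rw [h]
        congr 1
        refine Finset.sum_congr rfl fun i _ => ?_
        rw [← Finset.sum_mul]
        ring

variable (hK : ∀ S, (Finset.univ.filter fun i => S ∈ K i).card = n) (hn : 1 ≤ n)

include hK

lemma sum_blocks_const (g : Ω → ℝ) : ∑ i, ∑ S ∈ K i, g S = n * ∑ S, g S := by
  rw [← sum_blocks, Finset.mul_sum]
  refine Finset.sum_congr rfl fun S _ => ?_
  rw [← Finset.sum_filter, Finset.sum_const, hK, nsmul_eq_mul]

include hn

lemma blockChain_row_sum (S : Ω) : ∑ T, blockChain K n S T = 1 := by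
  have h := blockChain_mulVec (K := K) (n := n) (fun _ => 1) S
  simp only [Matrix.mulVec, dotProduct, mul_one] at h
  rw [h, ← Finset.sum_filter, Finset.sum_congr rfl (g := fun _ => (1 : ℝ)), Finset.sum_const, hK]
  · have : (n : ℝ) ≠ 0 := by positivity
    simp [this]
  · intro i hi
    have : ((K i).card : ℝ) ≠ 0 := by
      simpa using Finset.ne_empty_of_mem (Finset.mem_filter.1 hi).2
    simp [this]

/-- The value of `P g` at `S` is the mean of the block averages of `g` over the `n` blocks
containing `S`, and Cauchy–Schwarz applies to this mean. The inequality `P² ≤ P` excludes negative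
eigenvalues. -/
lemma sum_sq_blockChain_le (g : Ω → ℝ) :
    ∑ S, (blockChain K n).mulVec g S ^ 2 ≤ ∑ S, g S * (blockChain K n).mulVec g S := by
  have hn' : (0 : ℝ) < n := by positivity
  set A : ι → ℝ := fun i => ((K i).card : ℝ)⁻¹ * ∑ T ∈ K i, g T with hA
  have h := sum_blocks (K := K) fun _ i => A i ^ 2
  calc ∑ S, (blockChain K n).mulVec g S ^ 2
      ≤ ∑ S, (n : ℝ)⁻¹ * ∑ i, (if S ∈ K i then A i ^ 2 else 0) := by
        refine Finset.sum_le_sum fun S _ => ?_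
        rw [blockChain_mulVec, ← Finset.sum_filter, ← Finset.sum_filter]
        have := sq_sum_le_card_mul_sum_sq (s := Finset.univ.filter fun i => S ∈ K i) (f := A)
        rw [hK] at this
        rw [mul_pow]
        calc _ ≤ ((n : ℝ)⁻¹) ^ 2 * (n * ∑ i ∈ Finset.univ.filter (fun i => S ∈ K i), A i ^ 2) := by
              gcongr
          _ = _ := by field_simp
    _ = (n : ℝ)⁻¹ * ∑ i, ∑ S ∈ K i, A i ^ 2 := by rw [← Finset.mul_sum, h]
    _ = ∑ S, g S * (blockChain K n).mulVec g S := by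
        rw [sum_mul_blockChain]
        congr 1
        refine Finset.sum_congr rfl fun i _ => ?_
        rw [Finset.sum_const, nsmul_eq_mul]
        rcases (K i).eq_empty_or_nonempty with he | he
        · simp [he]
        · have : ((K i).card : ℝ) ≠ 0 := by simpa using he.ne_empty
          simp only [hA]
          field_simp

/-- In one block the squared differences sum to twice its size times the squared distance of `g`
from its block average. Over all blocks these squared distances add up to `n` times the Dirichlet
form. -/
lemma sum_blocks_sq_le {m : ℕ} (hm : ∀ i, (K i).card ≤ m) (g : Ω → ℝ) :
    ∑ i, ∑ S ∈ K i, ∑ T ∈ K i, (g S - g T) ^ 2 ≤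
      2 * n * m * (∑ S, g S ^ 2 - ∑ S, g S * (blockChain K n).mulVec g S) := by
  have hn' : (n : ℝ) ≠ 0 := by positivity
  have key : ∀ i, ∑ S ∈ K i, ∑ T ∈ K i, (g S - g T) ^ 2 ≤
      2 * m * (∑ S ∈ K i, g S ^ 2 - ((K i).card : ℝ)⁻¹ * (∑ S ∈ K i, g S) ^ 2) := by
    intro i
    have e : ∑ S ∈ K i, ∑ T ∈ K i, (g S - g T) ^ 2 =
        2 * (K i).card * ∑ S ∈ K i, g S ^ 2 - 2 * (∑ S ∈ K i, g S) ^ 2 := by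
      simp only [sub_sq, Finset.sum_add_distrib, Finset.sum_sub_distrib, Finset.sum_const,
        nsmul_eq_mul, ← Finset.mul_sum, ← Finset.sum_mul]
      ring
    have h0 : 0 ≤ ∑ S ∈ K i, ∑ T ∈ K i, (g S - g T) ^ 2 :=
      Finset.sum_nonneg fun _ _ => Finset.sum_nonneg fun _ _ => sq_nonneg _
    rcases (K i).eq_empty_or_nonempty with he | he
    · simp [he]
    · have hc : (0 : ℝ) < (K i).card := by exact_mod_cast he.card_pos
      have e2 : ∑ S ∈ K i, ∑ T ∈ K i, (g S - g T) ^ 2 = 2 * (K i).card *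
          (∑ S ∈ K i, g S ^ 2 - ((K i).card : ℝ)⁻¹ * (∑ S ∈ K i, g S) ^ 2) := by
        rw [e]; field_simp
      rw [e2] at h0 ⊢
      have h1 : 0 ≤ ∑ S ∈ K i, g S ^ 2 - ((K i).card : ℝ)⁻¹ * (∑ S ∈ K i, g S) ^ 2 :=
        nonneg_of_mul_nonneg_right h0 (by positivity)
      gcongr
      exact hm i
  calc _ ≤ ∑ i, 2 * (m : ℝ) *
        (∑ S ∈ K i, g S ^ 2 - ((K i).card : ℝ)⁻¹ * (∑ S ∈ K i, g S) ^ 2) :=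
        Finset.sum_le_sum fun i _ => key i
    _ = _ := by
        rw [← Finset.mul_sum, Finset.sum_sub_distrib, sum_blocks_const hK, sum_mul_blockChain]
        field_simp

end BlockChain

section Mixing

variable {Ω : Type} [Fintype Ω] [DecidableEq Ω] {P : Matrix Ω Ω ℝ}

lemma isStationaryFor_uniformDist [Nonempty Ω] (hsymm : P.IsSymm) (hnonneg : ∀ S T, 0 ≤ P S T)
    (hrow : ∀ S, ∑ T, P S T = 1) : IsStationaryFor P (uniformDist Ω) := by
  have hN : (Fintype.card Ω : ℝ) ≠ 0 := by simp
  refine ⟨?_, ⟨fun x => by simp [uniformDist], by simp [uniformDist, hN]⟩, ?_⟩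
  · rw [Matrix.mem_rowStochastic]
    refine ⟨hnonneg, ?_⟩
    ext S
    simp [Matrix.mulVec, dotProduct, hrow]
  · ext T
    simp only [Matrix.vecMul, dotProduct, uniformDist, ← Finset.mul_sum]
    rw [Finset.sum_congr rfl fun S _ => hsymm.apply T S, hrow, mul_one]

/-- A spectral gap bounds the mixing time. -/
lemma mixingDist_le_of_gap [Nonempty Ω] (hsymm : P.IsSymm) (hrow : ∀ S, ∑ T, P S T = 1)
    (hpos : ∀ g : Ω → ℝ, ∑ S, P.mulVec g S ^ 2 ≤ ∑ S, g S * P.mulVec g S) {R : ℝ} (hR : 1 ≤ R)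
    (hgap : ∀ g : Ω → ℝ, ∑ S, g S = 0 →
      ∑ S, g S ^ 2 ≤ R * (∑ S, g S ^ 2 - ∑ S, g S * P.mulVec g S))
    {t : ℕ} (ht : 4 * (Fintype.card Ω : ℝ) ≤ Real.exp (t / R)) :
    mixingDist P (uniformDist Ω) t ≤ 1 / 4 := by
  have hN : (0 : ℝ) < Fintype.card Ω := by exact_mod_cast Fintype.card_pos
  have hR0 : 0 < R := by linarith
  have hr : 0 ≤ 1 - 1 / R := by
    rw [sub_nonneg, div_le_one hR0]; exact hR
  have hstep : ∀ g : Ω → ℝ, ∑ S, g S = 0 →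
      ∑ S, P.mulVec g S ^ 2 ≤ (1 - 1 / R) * ∑ S, g S ^ 2 := by
    intro g hg
    refine (hpos g).trans ?_
    have h := hgap g hg
    have : ∑ S, g S * P.mulVec g S ≤ ∑ S, g S ^ 2 - (∑ S, g S ^ 2) / R := by
      rw [le_sub_comm, div_le_iff₀ hR0]
      linarith
    calc _ ≤ _ := this
      _ = _ := by ring
  have hmean : ∀ g : Ω → ℝ, ∑ S, P.mulVec g S = ∑ S, g S := by
    intro g
    simp only [Matrix.mulVec, dotProduct]
    rw [Finset.sum_comm]
    refine Finset.sum_congr rfl fun T _ => ?_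
    rw [← Finset.sum_mul, Finset.sum_congr rfl fun S _ => hsymm.apply T S, hrow, one_mul]
  have hiter : ∀ (t : ℕ) (g : Ω → ℝ), ∑ S, g S = 0 → ∑ S, (P ^ t).mulVec g S = 0 ∧
      ∑ S, (P ^ t).mulVec g S ^ 2 ≤ (1 - 1 / R) ^ t * ∑ S, g S ^ 2 := by
    intro t g hg
    induction t with
    | zero => simp [hg]
    | succ t ih =>
      rw [pow_succ', ← Matrix.mulVec_mulVec]
      refine ⟨by rw [hmean, ih.1], (hstep _ ih.1).trans ?_⟩
      rw [pow_succ', mul_assoc]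
      exact mul_le_mul_of_nonneg_left ih.2 hr
  have hone : ∀ t : ℕ, (P ^ t).mulVec (fun _ => (Fintype.card Ω : ℝ)⁻¹) =
      fun _ => (Fintype.card Ω : ℝ)⁻¹ := by
    intro t
    induction t with
    | zero => simp
    | succ t ih =>
      rw [pow_succ', ← Matrix.mulVec_mulVec, ih]
      ext S
      simp [Matrix.mulVec, dotProduct, ← Finset.sum_mul, hrow]
  refine ciSup_le fun x => ?_
  -- By symmetry, the row of `P ^ t` at `x` minus the uniform distribution is `P ^ t` applied to the
  -- centred point mass.
  set g : Ω → ℝ := Pi.single x 1 - fun _ => (Fintype.card Ω : ℝ)⁻¹ with hg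
  have hg0 : ∑ S, g S = 0 := by
    simp [hg, Finset.sum_sub_distrib]
  have hg1 : ∑ S, g S ^ 2 ≤ 1 := by
    have e : ∀ S, g S ^ 2 = (Pi.single x (1 : ℝ) : Ω → ℝ) S * (1 - 2 * (Fintype.card Ω : ℝ)⁻¹) +
        (Fintype.card Ω : ℝ)⁻¹ ^ 2 := by
      intro S
      simp only [hg, Pi.sub_apply]
      rcases eq_or_ne S x with rfl | h
      · simp only [Pi.single_eq_same]; ring
      · simp only [Pi.single_eq_of_ne h]; ring
    rw [Finset.sum_congr rfl fun S _ => e S, Finset.sum_add_distrib, ← Finset.sum_mul]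
    simp only [Finset.sum_pi_single', Finset.mem_univ, if_true, Finset.sum_const, Finset.card_univ,
      nsmul_eq_mul]
    have h2 : 0 < (Fintype.card Ω : ℝ)⁻¹ := by positivity
    have h3 : (Fintype.card Ω : ℝ) * (Fintype.card Ω : ℝ)⁻¹ ^ 2 = (Fintype.card Ω : ℝ)⁻¹ := by
      field_simp
    rw [h3]
    linarith
  have hval : ∀ T, (P ^ t) x T - uniformDist Ω T = (P ^ t).mulVec g T := by
    intro T
    rw [hg, Matrix.mulVec_sub, hone, Matrix.mulVec_single_one]
    simp only [Pi.sub_apply, Matrix.col_apply, uniformDist]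
    rw [(hsymm.pow t).apply]
  have hbound := ((hiter t g hg0).2.trans
    (mul_le_of_le_one_right (pow_nonneg hr t) hg1))
  have hexp : (1 - 1 / R) ^ t ≤ Real.exp (-(t / R)) := by
    calc (1 - 1 / R) ^ t ≤ Real.exp (-(1 / R)) ^ t := by
          refine pow_le_pow_left₀ hr ?_ t
          have := Real.add_one_le_exp (-(1 / R))
          linarith
      _ = _ := by rw [← Real.exp_nat_mul]; congr 1; ring
  -- Passing from `L²` to `L¹` costs a factor `|Ω|`, which the assumption on `t` absorbs.
  have hsq : (∑ T, |(P ^ t).mulVec g T|) ^ 2 ≤ (1 / 2) ^ 2 := by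
    have h1 := sq_sum_le_card_mul_sum_sq (s := Finset.univ) (f := fun T => |(P ^ t).mulVec g T|)
    simp only [sq_abs, Finset.card_univ] at h1
    have h2 : (Fintype.card Ω : ℝ) * ∑ T, (P ^ t).mulVec g T ^ 2 ≤
        Fintype.card Ω * Real.exp (-(t / R)) := by
      gcongr
      exact hbound.trans hexp
    rw [Real.exp_neg] at h2
    have h3 : (Fintype.card Ω : ℝ) * (Real.exp (t / R))⁻¹ ≤ 1 / 4 := by
      rw [← div_eq_mul_inv, div_le_iff₀ (Real.exp_pos _)]
      linarith
    calc _ ≤ _ := h1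
      _ ≤ _ := h2
      _ ≤ _ := h3
      _ = _ := by norm_num
  have habs := abs_le_of_sq_le_sq hsq (by norm_num)
  rw [tvDist]
  simp only [hval]
  linarith [le_of_abs_le habs]

end Mixing

/-! ### The flip chain as a block chain -/

section Flips

variable {n : ℕ} {p : Fin (n + 1) → Plane}

lemma mem_edges {G : SimpleGraph (Fin (n + 1))} {e : Sym2 (Fin (n + 1))} :
    e ∈ edges G ↔ e ∈ G.edgeSet := by
  simp [edges]

lemma mem_validEdges {F : SimpleGraph (Fin (n + 1))} {f : Sym2 (Fin (n + 1))} :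
    f ∈ validEdges p F ↔ IsNCST p (addEdge F f) := by
  simp [validEdges]

lemma edgeSet_dropEdge (G : SimpleGraph (Fin (n + 1))) (e : Sym2 (Fin (n + 1))) :
    (dropEdge G e).edgeSet = G.edgeSet \ {e} :=
  SimpleGraph.edgeSet_deleteEdges _

lemma addEdge_dropEdge {G : SimpleGraph (Fin (n + 1))} {e : Sym2 (Fin (n + 1))}
    (he : e ∈ edges G) : addEdge (dropEdge G e) e = G := by
  rw [mem_edges] at he
  rw [← SimpleGraph.edgeSet_inj, addEdge, SimpleGraph.edgeSet_sup, edgeSet_dropEdge,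
    SimpleGraph.edgeSet_fromEdgeSet]
  ext f
  have := G.not_isDiag_of_mem_edgeSet he
  simp only [Set.mem_union, Set.mem_sdiff, Set.mem_singleton_iff]
  constructor
  · rintro (h | h)
    · exact h.1
    · rwa [h.1]
  · intro h
    by_cases hf : f = e
    · subst hf
      exact Or.inr ⟨rfl, this⟩
    · exact Or.inl ⟨h, hf⟩

lemma dropEdge_addEdge {F : SimpleGraph (Fin (n + 1))} {f : Sym2 (Fin (n + 1))}
    (hf : f ∉ F.edgeSet) : dropEdge (addEdge F f) f = F := by
  rw [← SimpleGraph.edgeSet_inj, edgeSet_dropEdge, addEdge, SimpleGraph.edgeSet_sup,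
    SimpleGraph.edgeSet_fromEdgeSet]
  ext e
  simp only [Set.mem_union, Set.mem_sdiff, Set.mem_singleton_iff]
  constructor
  · rintro ⟨h | h, h'⟩
    · exact h
    · exact absurd h.1 h'
  · intro h
    refine ⟨Or.inl h, ?_⟩
    rintro rfl
    exact hf h

lemma dropEdge_inj {G : SimpleGraph (Fin (n + 1))} {e e' : Sym2 (Fin (n + 1))} (he : e ∈ edges G)
    (h : dropEdge G e = dropEdge G e') : e = e' := by
  rw [mem_edges] at he
  by_contra hne
  have h1 : e ∈ (dropEdge G e').edgeSet := by
    rw [edgeSet_dropEdge]; exact ⟨he, hne⟩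
  rw [← h, edgeSet_dropEdge] at h1
  exact h1.2 rfl

lemma not_isNCST_dropEdge (S : NCST p) {e : Sym2 (Fin (n + 1))} (he : e ∈ edges S.1) :
    ¬ IsNCST p (dropEdge S.1 e) := by
  intro h
  rw [mem_edges] at he
  have hb := SimpleGraph.isAcyclic_iff_forall_isBridge.1 S.2.1.2 he
  induction e with
  | h a b => exact hb (h.1.1.preconnected a b)

lemma card_edges (S : NCST p) : (edges S.1).card = n := by
  classical
  have h := S.2.1.card_edgeFinset
  rw [Fintype.card_fin] at h
  have : edges S.1 = S.1.edgeFinset := by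
    ext e; simp [mem_edges]
  rw [this]
  omega

open Classical in
/-- The non-crossing spanning trees obtained from `F` by adding an edge. -/
noncomputable def completions (p : Fin (n + 1) → Plane) (F : SimpleGraph (Fin (n + 1))) :
    Finset (NCST p) :=
  Finset.univ.filter fun S => ∃ e ∈ edges S.1, dropEdge S.1 e = F

lemma mem_completions {F : SimpleGraph (Fin (n + 1))} {S : NCST p} :
    S ∈ completions p F ↔ ∃ e ∈ edges S.1, dropEdge S.1 e = F := by
  simp [completions]

/-- Adding a loop or an edge already present returns `F`, which would count as valid if `F` were a
tree. The existence of a completion excludes this. -/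
lemma validEdges_spec {F : SimpleGraph (Fin (n + 1))} {S : NCST p} (hS : S ∈ completions p F)
    {f : Sym2 (Fin (n + 1))} (hf : f ∈ validEdges p F) :
    f ∉ F.edgeSet ∧ f ∈ edges (addEdge F f) := by
  obtain ⟨e, he, rfl⟩ := mem_completions.1 hS
  rw [mem_validEdges] at hf
  have hmain : ¬ (addEdge (dropEdge S.1 e) f = dropEdge S.1 e) := fun h =>
    not_isNCST_dropEdge S he (h ▸ hf)
  have h1 : f ∉ (dropEdge S.1 e).edgeSet := by
    intro h
    refine hmain ?_
    rw [addEdge, sup_eq_left, SimpleGraph.fromEdgeSet_le]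
    rintro x ⟨rfl, -⟩
    exact h
  have h2 : ¬ f.IsDiag := by
    intro h
    refine hmain ?_
    rw [addEdge, sup_eq_left, SimpleGraph.fromEdgeSet_le]
    rintro x ⟨rfl, hx⟩
    exact absurd h hx
  refine ⟨h1, ?_⟩
  rw [mem_edges, addEdge, SimpleGraph.edgeSet_sup, SimpleGraph.edgeSet_fromEdgeSet]
  exact Or.inr ⟨rfl, h2⟩

lemma addEdge_inj {F : SimpleGraph (Fin (n + 1))} {S : NCST p} (hS : S ∈ completions p F)
    {f f' : Sym2 (Fin (n + 1))} (hf : f ∈ validEdges p F) (hf' : f' ∈ validEdges p F)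
    (h : addEdge F f = addEdge F f') : f = f' := by
  have h1 := validEdges_spec hS hf
  have h2 := validEdges_spec hS hf'
  refine dropEdge_inj (G := addEdge F f) h1.2 ?_
  rw [dropEdge_addEdge h1.1, h, dropEdge_addEdge h2.1]

lemma card_validEdges {F : SimpleGraph (Fin (n + 1))} {S : NCST p} (hS : S ∈ completions p F) :
    (validEdges p F).card = (completions p F).card := by
  refine Finset.card_bij (fun f hf => ⟨addEdge F f, mem_validEdges.1 hf⟩) (fun f hf => ?_)
    (fun f hf f' hf' h => addEdge_inj hS hf hf' (congrArg Subtype.val h)) fun T hT => ?_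
  · have h := validEdges_spec hS hf
    exact mem_completions.2 ⟨f, h.2, dropEdge_addEdge h.1⟩
  · obtain ⟨e, he, rfl⟩ := mem_completions.1 hT
    refine ⟨e, ?_, Subtype.ext (addEdge_dropEdge he)⟩
    rw [mem_validEdges, addEdge_dropEdge he]
    exact T.2

open Classical in
lemma sum_validEdges {F : SimpleGraph (Fin (n + 1))} {S : NCST p} (hS : S ∈ completions p F)
    (T : NCST p) : ∑ f ∈ validEdges p F, (if addEdge F f = T.1 then (1 : ℝ) else 0) =
      if T ∈ completions p F then 1 else 0 := by
  split_ifs with hT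
  · obtain ⟨e, he, hd⟩ := mem_completions.1 hT
    have hadd : addEdge F e = T.1 := by rw [← hd, addEdge_dropEdge he]
    have hv : e ∈ validEdges p F := by rw [mem_validEdges, hadd]; exact T.2
    rw [Finset.sum_eq_single_of_mem e hv, if_pos hadd]
    intro f hf hne
    exact if_neg fun h => hne (addEdge_inj hS hf hv (h.trans hadd.symm))
  · refine Finset.sum_eq_zero fun f hf => if_neg fun h => hT ?_
    have h1 := validEdges_spec hS hf
    exact mem_completions.2 ⟨f, h ▸ h1.2, by rw [← h, dropEdge_addEdge h1.1]⟩

open Classical in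
lemma filter_completions (S : NCST p) : (Finset.univ.filter fun F => S ∈ completions p F) =
    (edges S.1).image (dropEdge S.1) := by
  ext F
  simp [mem_completions]

open Classical in
lemma sum_completions (S : NCST p) (a : SimpleGraph (Fin (n + 1)) → ℝ) :
    ∑ F, (if S ∈ completions p F then a F else 0) = ∑ e ∈ edges S.1, a (dropEdge S.1 e) := by
  rw [← Finset.sum_filter, filter_completions, Finset.sum_image]
  exact fun e he e' _ h => dropEdge_inj he h

lemma card_completions_containing (S : NCST p) :
    (Finset.univ.filter fun F => S ∈ completions p F).card = n := by
  classical
  rw [filter_completions, Finset.card_image_of_injOn, card_edges]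
  exact fun e he e' _ h => dropEdge_inj he h

/-- The removed edge selects the block of completions of the remaining forest. Indexing blocks by
all graphs is harmless, since graphs that do not arise have empty blocks. -/
lemma flipChain_eq : flipChain p = blockChain (completions p) n := by
  classical
  ext S T
  have h := sum_completions S fun F =>
    if T ∈ completions p F then ((completions p F).card : ℝ)⁻¹ else 0
  rw [blockChain, Finset.sum_congr rfl fun F _ => ite_and _ _ _ _, h, flipChain, card_edges,
    Finset.mul_sum]
  refine Finset.sum_congr rfl fun e he => ?_
  have hS : S ∈ completions p (dropEdge S.1 e) := mem_completions.2 ⟨e, he, rfl⟩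
  rw [← Finset.mul_sum, sum_validEdges hS, card_validEdges hS]
  simp

lemma card_completions_le (hn : 1 ≤ n) (F : SimpleGraph (Fin (n + 1))) :
    (completions p F).card ≤ 3 * n ^ 2 := by
  rcases (completions p F).eq_empty_or_nonempty with h | ⟨S, hS⟩
  · simp [h]
  · rw [← card_validEdges hS]
    refine (Finset.card_le_univ _).trans ?_
    -- There are `(n + 1)(n + 2) / 2` unordered pairs, loops included.
    rw [Sym2.card, Fintype.card_fin, Nat.choose_two_right]
    refine Nat.div_le_of_le_mul ?_
    simp only [Nat.add_sub_cancel]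
    nlinarith

end Flips

/-! ### Transfer of the Poincaré inequality to trees -/

namespace Labelling

variable {n : ℕ} {p : Fin (n + 1) → Plane} (ℓ : Labelling p)

lemma nodup_ed {w : List Letter} (hw : IsCode n w) : (ed w [] 0).Nodup := by
  obtain ⟨t, -, rfl⟩ := hw
  rw [ed_enc]
  exact t.arcs_nodup 0

lemma chord_mem_edges {L : List (ℕ × ℕ)} {a : ℕ × ℕ} (ha : a ∈ L) (hr : a.1 < a.2 ∧ a.2 ≤ n) :
    ℓ.chord a ∈ edges (ℓ.graph L) := by
  rw [mem_edges, graph, SimpleGraph.edgeSet_fromEdgeSet]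
  exact ⟨⟨a, ha, rfl⟩, ℓ.v_ne hr.1 hr.2⟩

lemma dropEdge_graph {L R : List (ℕ × ℕ)} {a : ℕ × ℕ} (h : L.Perm (a :: R)) (hd : L.Nodup)
    (hr : ∀ b ∈ L, b.1 < b.2 ∧ b.2 ≤ n) : dropEdge (ℓ.graph L) (ℓ.chord a) = ℓ.graph R := by
  rw [ℓ.graph_perm h]
  have hd' : a ∉ R := (List.nodup_cons.1 (h.nodup_iff.1 hd)).1
  have hr' : ∀ b ∈ a :: R, b.1 < b.2 ∧ b.2 ≤ n := fun b hb => hr b (h.mem_iff.2 hb)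
  rw [← SimpleGraph.edgeSet_inj, edgeSet_dropEdge, graph, graph, SimpleGraph.edgeSet_fromEdgeSet,
    SimpleGraph.edgeSet_fromEdgeSet]
  ext e
  constructor
  · rintro ⟨⟨⟨b, hb, rfl⟩, hdiag⟩, hne⟩
    rcases List.mem_cons.1 hb with rfl | hb
    · exact absurd rfl hne
    · exact ⟨⟨b, hb, rfl⟩, hdiag⟩
  · rintro ⟨⟨b, hb, rfl⟩, hdiag⟩
    refine ⟨⟨⟨b, List.mem_cons_of_mem a hb, rfl⟩, hdiag⟩, fun hne => hd' ?_⟩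
    rw [← ℓ.chord_inj (hr' b (List.mem_cons_of_mem a hb)) (hr' a List.mem_cons_self) hne]
    exact hb

lemma tree_mem_completions {w : List Letter} (hw : IsCode n w) {R : List (ℕ × ℕ)} {a : ℕ × ℕ}
    (h : (ed w [] 0).Perm (a :: R)) : ℓ.tree w hw ∈ completions p (ℓ.graph R) := by
  have ha : a ∈ ed w [] 0 := h.mem_iff.2 List.mem_cons_self
  exact mem_completions.2 ⟨ℓ.chord a, ℓ.chord_mem_edges ha (range_ed hw a ha),
    ℓ.dropEdge_graph h (nodup_ed hw) (range_ed hw)⟩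

/-- The tree and the remaining forest determine the marked edge. Edges are listed without repetition
in the order in which they are closed, so the index of this edge is the number of letters `C` before
the mark. -/
lemma marked_inj {z z' : Marked} (hz : IsCode n z.word) (hz' : IsCode n z'.word)
    (hrest : ℓ.graph z.rest = ℓ.graph z'.rest)
    (hword : ℓ.graph (ed z.word [] 0) = ℓ.graph (ed z'.word [] 0)) : z = z' := by
  have hw := ℓ.code_eq_of_graph_eq hz hz' hword
  have he : z.edge ∈ ed z.word [] 0 := z.perm_ed_word.mem_iff.2 List.mem_cons_self
  have he' : z'.edge ∈ ed z'.word [] 0 := z'.perm_ed_word.mem_iff.2 List.mem_cons_self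
  have h1 := ℓ.dropEdge_graph z.perm_ed_word (nodup_ed hz) (range_ed hz)
  have h2 := ℓ.dropEdge_graph z'.perm_ed_word (nodup_ed hz') (range_ed hz')
  rw [← hrest, ← h1, ← hword] at h2
  have hc := dropEdge_inj (ℓ.chord_mem_edges he (range_ed hz _ he)) h2.symm
  have hedge := ℓ.chord_inj (range_ed hz _ he) (range_ed hz' _ he') hc
  have hnd := nodup_ed hz
  have e : ed z.1 [] 0 ++ z.edge :: ed z.2 (stk z.1 [] 0).tail (z.1.count B) =
      ed z'.1 [] 0 ++ z.edge :: ed z'.2 (stk z'.1 [] 0).tail (z'.1.count B) := by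
    rw [← Marked.ed_word, hw, Marked.ed_word, hedge]
  have hlen : z.1.count C = z'.1.count C := by
    rw [← length_ed z.1 [] 0, ← length_ed z'.1 [] 0]
    have hnd' := nodup_ed hz'
    rw [Marked.ed_word] at hnd hnd'
    rw [← hedge] at hnd'
    have i1 := List.idxOf_append_of_notMem
      (l₂ := z.edge :: ed z.2 (stk z.1 [] 0).tail (z.1.count B))
      fun h => (List.nodup_append'.1 hnd).2.2 h List.mem_cons_self
    have i2 := List.idxOf_append_of_notMem
      (l₂ := z.edge :: ed z'.2 (stk z'.1 [] 0).tail (z'.1.count B))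
      fun h => (List.nodup_append'.1 hnd').2.2 h List.mem_cons_self
    rw [e] at i1
    simpa using i1.symm.trans i2
  obtain ⟨v, r⟩ := z
  obtain ⟨v', r'⟩ := z'
  simp only [Marked.word] at hw
  rcases List.append_eq_append_iff.1 hw with ⟨s, h3, h4⟩ | ⟨s, h3, h4⟩ <;> rcases s with _ | ⟨k, s⟩
  · simp_all
  · simp only [List.cons_append, List.cons.injEq] at h4
    obtain ⟨rfl, -⟩ := h4
    simp [h3] at hlen
  · simp_all
  · simp only [List.cons_append, List.cons.injEq] at h4
    obtain ⟨rfl, -⟩ := h4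
    simp [h3] at hlen

lemma isCode_path (n : ℕ) : ∃ w, IsCode n w := by
  induction n with
  | zero => exact ⟨[], nil, rfl, rfl⟩
  | succ n ih =>
    obtain ⟨w, t, ht, -⟩ := ih
    exact ⟨_, node nil nil t, by simp [size, ht], rfl⟩

include ℓ in
lemma nonempty_NCST : Nonempty (NCST p) :=
  let ⟨w, hw⟩ := isCode_path n
  ⟨ℓ.tree w hw⟩

include ℓ in
/-- The Poincaré inequality for flips of non-crossing spanning trees. -/
theorem poincare_flips (hp : Function.Injective p) (hn : 1 ≤ n) (f : NCST p → ℝ)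
    (h0 : ∑ S, f S = 0) : ∑ S, f S ^ 2 ≤ 88 * (n : ℝ) ^ 4 *
      ∑ F, ∑ S ∈ completions p F, ∑ T ∈ completions p F, (f S - f T) ^ 2 := by
  classical
  have := ℓ.nonempty_NCST
  set tr : List Letter → NCST p := fun w =>
    if hw : IsCode n w then ℓ.tree w hw else Classical.arbitrary _ with htr
  have htr' : ∀ w hw, tr w = ℓ.tree w hw := fun w hw => by simp only [htr, dif_pos hw]
  -- `M z` collects all exchanges of the marked edge. Summing over `z` embeds into the sum over
  -- pairs of a forest and a completion of it.
  set M : Marked → ℝ := fun z =>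
    ∑ T ∈ completions p (ℓ.graph z.rest), (f (tr z.word) - f T) ^ 2 with hMdef
  have hM : Marked.Dominates n (fun w => f (tr w)) M := by
    refine ⟨fun z => Finset.sum_nonneg fun _ _ => sq_nonneg _, fun z w hz hw ⟨a, ha⟩ => ?_⟩
    have hmem : tr w ∈ completions p (ℓ.graph z.rest) := by
      rw [htr' w hw]
      exact ℓ.tree_mem_completions hw ha
    exact Finset.single_le_sum (f := fun T => (f (tr z.word) - f T) ^ 2) (fun _ _ => sq_nonneg _) hmem
  have h1 := codes_poincare hn hM
    ((ℓ.sum_codes_eq hp (f := f) fun w hw => by rw [htr' w hw]).trans h0)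
  rw [ℓ.sum_codes_eq hp (f := fun S => f S ^ 2) fun w hw => by rw [htr' w hw]] at h1
  refine h1.trans (mul_le_mul_of_nonneg_left ?_ (by positivity))
  have h2 := sum_comp_le_of_injOn (s := splits n [C])
    (t := Finset.univ.sigma fun F => completions p F)
    (fun z : Marked => (⟨ℓ.graph z.rest, tr z.word⟩ : (_ : SimpleGraph (Fin (n + 1))) × NCST p))
    (fun z hz z' hz' h => by
      have hz := mem_splits_C.1 (Finset.mem_coe.1 hz)
      have hz' := mem_splits_C.1 (Finset.mem_coe.1 hz')
      simp only [Sigma.mk.injEq, heq_eq_eq] at h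
      rw [htr' _ hz, htr' _ hz'] at h
      exact ℓ.marked_inj hz hz' h.1 (congrArg Subtype.val h.2))
    (fun z hz => by
      have hz := mem_splits_C.1 hz
      simp only [Finset.mem_sigma, Finset.mem_univ, true_and]
      rw [htr' _ hz]
      exact ℓ.tree_mem_completions hz (Marked.perm_ed_word z))
    (fun q => ∑ T ∈ completions p q.1, (f q.2 - f T) ^ 2)
    (fun q => Finset.sum_nonneg fun _ _ => sq_nonneg _)
  rw [Finset.sum_sigma] at h2
  exact h2

include ℓ in
lemma card_NCST (hp : Function.Injective p) : Fintype.card (NCST p) = (codes n).card := by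
  have h := ℓ.sum_codes_eq hp (F := fun _ => 1) (f := fun _ => 1) fun _ _ => rfl
  simp only [Finset.sum_const, nsmul_eq_mul, mul_one, Finset.card_univ] at h
  exact_mod_cast h.symm

end Labelling

/-! ### The mixing time -/

lemma card_codes_le (n : ℕ) : (codes n).card ≤ 27 ^ n := by
  have h : (codes n).card ≤ (Finset.univ : Finset (Fin (3 * n) → Letter)).card := by
    refine Finset.card_le_card_of_injOn (fun w i => w.getD i O)
      (fun _ _ => Finset.mem_coe.2 (Finset.mem_univ _)) ?_
    intro w hw w' hw' he
    have l1 := (mem_codes.1 (Finset.mem_coe.1 hw)).length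
    have l2 := (mem_codes.1 (Finset.mem_coe.1 hw')).length
    refine List.ext_getElem (l1.trans l2.symm) fun k h1 h2 => ?_
    have := congrFun he ⟨k, l1 ▸ h1⟩
    simpa [h1, h2] using this
  refine h.trans (le_of_eq ?_)
  rw [Finset.card_univ, Fintype.card_fun, Fintype.card_fin, pow_mul]
  rfl

lemma card_codes_one : (codes 1).card ≤ 1 := by
  have key : ∀ t : TT, t.size = 0 → t = nil := by
    intro t ht
    cases t with
    | nil => rfl
    | node => simp [size] at ht
  have h : ∀ t : TT, t.size = 1 → t = node nil nil nil := by
    intro t ht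
    cases t with
    | nil => simp [size] at ht
    | node a b c =>
      simp only [size] at ht
      rw [key a (by omega), key b (by omega), key c (by omega)]
  refine Finset.card_le_one.2 fun w hw w' hw' => ?_
  obtain ⟨t, ht, rfl⟩ := mem_codes.1 hw
  obtain ⟨t', ht', rfl⟩ := mem_codes.1 hw'
  rw [h t ht, h t' ht']

lemma isStationaryFor_flipChain {n : ℕ} (hn : 1 ≤ n) {p : Fin (n + 1) → Plane} (ℓ : Labelling p) :
    IsStationaryFor (flipChain p) (uniformDist (NCST p)) := by
  have := ℓ.nonempty_NCST
  rw [flipChain_eq]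
  exact isStationaryFor_uniformDist (Matrix.IsSymm.ext fun S T => blockChain_comm _ _)
    blockChain_nonneg (blockChain_row_sum card_completions_containing hn)

/-- The factors `88 n⁴` from the Poincaré inequality and `2 · n · 3n²` from the blocks give the
relaxation bound `528 n⁷`. Running `6 n` times as long suffices, because `4 · 27 ^ n ≤ 108 ^ n ≤ exp
(6 n)`. -/
lemma mixingDist_flipChain_le {n : ℕ} (hn : 1 ≤ n) {p : Fin (n + 1) → Plane}
    (hp : Function.Injective p) (ℓ : Labelling p) :
    mixingDist (flipChain p) (uniformDist (NCST p)) (3168 * n ^ 8) ≤ 1 / 4 := by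
  have := ℓ.nonempty_NCST
  have hn1 : (1 : ℝ) ≤ n := by exact_mod_cast hn
  have hR : (1 : ℝ) ≤ 528 * (n : ℝ) ^ 7 := by
    have := one_le_pow₀ hn1 (n := 7)
    linarith
  rw [flipChain_eq]
  refine mixingDist_le_of_gap (Matrix.IsSymm.ext fun S T => blockChain_comm _ _)
    (blockChain_row_sum card_completions_containing hn)
    (sum_sq_blockChain_le card_completions_containing hn) hR (fun g hg => ?_) ?_
  · have h1 := ℓ.poincare_flips hp hn g hg
    have h2 := sum_blocks_sq_le card_completions_containing hn (card_completions_le (p := p) hn) g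
    calc _ ≤ _ := h1
      _ ≤ 88 * (n : ℝ) ^ 4 * _ := mul_le_mul_of_nonneg_left h2 (by positivity)
      _ = _ := by push_cast; ring
  · have hexp : ((3168 * n ^ 8 : ℕ) : ℝ) / (528 * (n : ℝ) ^ 7) = 6 * n := by
      push_cast
      field_simp
      norm_num
    rw [hexp]
    have hcard : (Fintype.card (NCST p) : ℝ) ≤ 27 ^ n := by
      rw [ℓ.card_NCST hp]
      exact_mod_cast card_codes_le n
    have he : (108 : ℝ) ≤ Real.exp 6 := by
      have h1 : (2.7 : ℝ) ≤ Real.exp 1 := by linarith [Real.exp_one_gt_d9]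
      have h2 : Real.exp 6 = Real.exp 1 ^ 6 := by
        rw [← Real.exp_nat_mul]; norm_num
      rw [h2]
      calc (108 : ℝ) ≤ 2.7 ^ 6 := by norm_num
        _ ≤ _ := by gcongr
    calc 4 * (Fintype.card (NCST p) : ℝ) ≤ 4 ^ n * 27 ^ n := by
          gcongr
          exact le_self_pow₀ (by norm_num) (by omega)
      _ = 108 ^ n := by rw [← mul_pow]; norm_num
      _ ≤ Real.exp 6 ^ n := by gcongr
      _ = Real.exp (6 * n) := by rw [← Real.exp_nat_mul]; ring_nf

lemma mixingDist_zero_of_subsingleton {Ω : Type} [Fintype Ω] [DecidableEq Ω] [Nonempty Ω]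
    (hcard : Fintype.card Ω ≤ 1) (P : Matrix Ω Ω ℝ) : mixingDist P (uniformDist Ω) 0 ≤ 1 / 4 := by
  have h1 : Fintype.card Ω = 1 := le_antisymm hcard Fintype.card_pos
  have hsub : Subsingleton Ω := Fintype.card_le_one_iff_subsingleton.1 hcard
  refine ciSup_le fun x => ?_
  have : ∀ y, |(P ^ 0) x y - uniformDist Ω y| = 0 := by
    intro y
    obtain rfl := Subsingleton.elim x y
    simp [uniformDist, h1]
  rw [tvDist, Finset.sum_eq_zero fun y _ => this y]
  norm_num

theorem theorem1 :
    ∃ C : ℝ, 0 < C ∧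
      ∀ (n : ℕ), 1 ≤ n → ∀ p : Fin (n + 1) → Plane, ConvexIndependent ℝ p →
        IsStationaryFor (flipChain p) (uniformDist (NCST p)) ∧
        ∃ τ : ℕ, IsMixingTime (flipChain p) (uniformDist (NCST p)) τ ∧
          (τ : ℝ) ≤ C * (n : ℝ) ^ 8 * Real.log n := by
  refine ⟨6336, by norm_num, fun n hn p hp => ?_⟩
  obtain ⟨ℓ⟩ := exists_labelling hp
  have hinj := hp.injective
  have := ℓ.nonempty_NCST
  refine ⟨isStationaryFor_flipChain hn ℓ, ?_⟩
  have hmix := mixingDist_flipChain_le hn hinj ℓ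
  set A := {t : ℕ | mixingDist (flipChain p) (uniformDist (NCST p)) t ≤ 1 / 4} with hA
  have hne : A.Nonempty := ⟨_, hmix⟩
  refine ⟨sInf A, ⟨Nat.sInf_mem hne, fun t ht => Nat.sInf_le ht⟩, ?_⟩
  -- For `n = 1` the claimed bound is 0, as `log 1 = 0`, and the chain has a single state. For `n ≥
  -- 2`, `log n ≥ 1/2` turns `3168 n⁸` into the stated form with constant `6336`.
  rcases hn.eq_or_lt with rfl | hn2
  · have h0 : (0 : ℕ) ∈ A := mixingDist_zero_of_subsingleton
      (by rw [ℓ.card_NCST hinj]; exact card_codes_one) _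
    have : sInf A = 0 := Nat.le_zero.1 (Nat.sInf_le h0)
    simp [this]
  · have h1 : ((sInf A : ℕ) : ℝ) ≤ 3168 * (n : ℝ) ^ 8 := by
      exact_mod_cast Nat.sInf_le (show 3168 * n ^ 8 ∈ A from hmix)
    have h2 : 1 / 2 ≤ Real.log n := by
      have h3 : Real.log 2 ≤ Real.log n := Real.log_le_log (by norm_num) (by exact_mod_cast hn2)
      linarith [Real.log_two_gt_d9]
    calc _ ≤ _ := h1
      _ = 6336 * (n : ℝ) ^ 8 * (1 / 2) := by ring
      _ ≤ _ := by gcongr
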